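/- Let $X$ be a countable set and $m\colon X\to(0,\infty)$, viewed as a measure on $X$; write $\ell^2(X,m)$ for the real Hilbert space of $m$-square-summable functions and $C_c(X)$ for the finitely supported functions. **Forms.** A form $Q$ on a real Hilbert space is a symmetric, positive bilinear map on a subspace $D(Q)$; $Q(f):=Q(f,f)$ for $f\in D(Q)$ and $Q(f):=\infty$ otherwise; $Q\le Q'$ means $Q(f)\le Q'(f)$ for all $f$; $Q_1(f):=Q(f)+\|f\|^2$. $Q$ is closed if $D(Q)$ is complete with respect to $Q_1^{1/2}$. A form on an $L^2$-space is Markovian if $Q(C\circ f)\le Q(f)$ for all $f$ and all normal contractions $C\colon\mathbb R\to\mathbb R$ (i.e. $C(0)=0$ and $C$ is $1$-Lipschitz). A Dirichlet form in the wide sense is a closed Markovian form; it is a Dirichlet form if it is also densely defined. Let $\mathfrak D$ be the set of Dirichlet forms $Q$ on $\ell^2(X,m)$ with $C_c(X)\subset D(Q)$. **Graphs.** A graph $(b,0)$ over $X$ is a symmetric function $b\colon X\times X\to[0,\infty)$ with zero diagonal and $\sum_y b(x,y)<\infty$ for all $x$. Let $Q^{(N)}_{b,0}$ be the form with $Q^{(N)}_{b,0}(f)=\frac12\sum_{x,y}b(x,y)(f(x)-f(y))^2$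 on all $f\in\ell^2(X,m)$ for which this is finite, and $Q^{(D)}_{b,0}$ its restriction to the closure of $C_c(X)$ with respect to $(Q^{(N)}_{b,0})_1^{1/2}$. A function $u$ is $1$-harmonic if $\sum_y b(x,y)|u(y)|<\infty$ and $\frac1{m(x)}\sum_y b(x,y)(u(x)-u(y))+u(x)=0$ for all $x$. **Boundary.** Fix a graph $(b,0)$. Let $\hat X$ be the (unique) compact Hausdorff space containing $X$ as a dense subset with open points, to which all functions in $D(Q^{(N)})\cap\ell^\infty(X)$ extend continuously, these extensions separating points. The $1$-harmonic boundary $\partial X$ is the set of points of $\hat X\setminus X$ at which the extensions of all $f\in D(Q^{(D)})\cap\ell^\infty(X)$ vanish. Every $f\in D(Q^{(N)})$ extends uniquely to a continuous function $\hat X\to[-\infty,\infty]$; its restriction to $\partial X$ is denoted by $\gamma f$. For $x\in X$ let $\mu_x$ be the $1$-harmonic measure of $x$: the unique Radon measure on $\partial X$ with $\mu_x(\partial X)\le1$ such that $\int\gamma f\,d\mu_x=u(x)$ for every $f\in D(Q^{(N)})\cap\ell^\infty(X)$, where $u\in D(Q^{(N)})$ is the $1$-harmonic function with $\gamma u=\gamma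 f$, and such that $\mu_x(\{\infty\})=0$ if there is a point $\infty\in\partial X$ at which $\gamma f$ vanishes for all $f\in D(Q^{(N)})\cap\ell^\infty(X)$. For each graph fix a reference measure $\mu=\sum_x w(x)\mu_x$ on $\partial X$, where $w\colon X\to[0,\infty)$ satisfies $\sum_x w(x)<\infty$ and $\sum_x w(x)/m(x)<\infty$ and does not vanish identically on any connected component of the graph (if the graph is connected, $\mu=\mu_o$ with any vertex $o$ is allowed). Put $L^2(\partial X)=L^2(\partial X,\mu)$. **Traces.** For a Dirichlet form $Q$ with $Q^{(N)}_{b,0}\le Q\le Q^{(D)}_{b,0}$, the trace form $\mathrm{Tr}\,Q$ on $L^2(\partial X)$ has domain $\gamma D(Q)$ and is given by $\mathrm{Tr}\,Q(\varphi)=Q_1(H\varphi)$, where $H\varphi\in D(Q^{(N)}_{b,0})$ is the $1$-harmonic function with $\gamma H\varphi=\varphi$ $\mu$-a.e. Let $q^{DN}_{b,0}=\mathrm{Tr}\,Q^{(N)}_{b,0}$, and let $\mathrm{Tr}\,\mathfrak D(b,0)$ be the set of all Dirichlet forms in the wide sense $q$ on $L^2(\partial X)$ with $q\ge q^{DN}_{b,0}$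 such that $q-q^{DN}_{b,0}$, with domain $D(q)$, is Markovian. **Statement.** For $Q\in\mathfrak D$ the following are equivalent: (i) there is a graph $(b_Q,0)$ such that $Q$ is an extension of $Q^{(D)}_{b_Q,0}$; (ii) there are a graph $(b_Q,0)$ with $D(Q)\subset D(Q^{(N)}_{b_Q,0})$ and a form $q\in\mathrm{Tr}\,\mathfrak D(b_Q,0)$ such that for all $f\in D(Q)$ one has $\gamma f\in D(q)$ and $$Q(f)=Q^{(N)}_{b_Q,0}(f)+q(\gamma f)-q^{DN}_{b_Q,0}(\gamma f).$$ More precisely, a graph satisfies the condition in (i) if and only if it satisfies the condition in (ii), there is at most one such graph, and in (ii) one can choose $q=\mathrm{Tr}\,Q$ (which belongs to $\mathrm{Tr}\,\mathfrak D(b_Q,0)$). If $\mathfrak D_0$ denotes the set of all $Q\in\mathfrak D$ satisfying (i) and (ii), then the map $$\mathfrak D_0\to\bigsqcup_{(b,0)\text{ graph}}\mathrm{Tr}\,\mathfrak D(b,0),\qquad Q\mapsto((b_Q,0),\mathrm{Tr}\,Q)$$ is a bijection. -/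

import Mathlib

open Set Filter Topology MeasureTheory
open scoped NNReal ENNReal

noncomputable section

namespace GraphForm

/-! ### Symmetric positive forms -/

/-- A symmetric positive form on a real vector space: a subspace `dom` (the domain) together with
a symmetric positive bilinear map on it. -/
structure Form (E : Type*) [AddCommGroup E] [Module ℝ E] where
  dom : Submodule ℝ E
  bilin : LinearMap.BilinForm ℝ dom
  symm : ∀ f g, bilin f g = bilin g f
  nonneg : ∀ f, 0 ≤ bilin f f

/-- The quadratic form `Q(f) = Q(f,f)` for `f ∈ D(Q)` and `Q(f) = ∞` otherwise. -/
def Form.val {E : Type*} [AddCommGroup E] [Module ℝ E] (Q : Form E) (f : E) : ℝ≥0∞ :=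
  open Classical in
  if h : f ∈ Q.dom then ENNReal.ofReal (Q.bilin ⟨f, h⟩ ⟨f, h⟩) else ⊤

/-- `Q` is an extension of `Q'`. -/
def Form.Extends {E : Type*} [AddCommGroup E] [Module ℝ E] (Q Q' : Form E) : Prop :=
  ∃ h : Q'.dom ≤ Q.dom, ∀ f g : Q'.dom,
    Q.bilin (Submodule.inclusion h f) (Submodule.inclusion h g) = Q'.bilin f g

/-- The restriction of a form to a smaller domain. -/
def Form.restrict {E : Type*} [AddCommGroup E] [Module ℝ E] (Q : Form E) (S : Submodule ℝ E)
    (h : S ≤ Q.dom) : Form E where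
  dom := S
  bilin := Q.bilin.compl₁₂ (Submodule.inclusion h) (Submodule.inclusion h)
  symm _ _ := Q.symm _ _
  nonneg _ := Q.nonneg _

section Normed

variable {E : Type*} [NormedAddCommGroup E] [NormedSpace ℝ E]

/-- `Q₁(f) = Q(f) + ‖f‖²`, the square of the form norm. -/
def Form.val₁ (Q : Form E) (f : E) : ℝ≥0∞ := Q.val f + ENNReal.ofReal (‖f‖ ^ 2)

/-- The form is closed: its domain is complete with respect to the form norm. -/
def Form.IsClosed (Q : Form E) : Prop :=
  ∀ u : ℕ → E, (∀ n, u n ∈ Q.dom) →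
    (∀ ε : ℝ≥0∞, 0 < ε → ∃ N, ∀ n ≥ N, ∀ k ≥ N, Q.val₁ (u n - u k) < ε) →
    ∃ f ∈ Q.dom, Tendsto (fun n => Q.val₁ (u n - f)) atTop (𝓝 0)

lemma Form.val_add_le (Q : Form E) (f g : E) : Q.val (f + g) ≤ 2 * Q.val f + 2 * Q.val g := by
  by_cases hf : f ∈ Q.dom
  · by_cases hg : g ∈ Q.dom
    · have hfg := Q.dom.add_mem hf hg
      rw [Form.val, Form.val, Form.val, dif_pos hf, dif_pos hg, dif_pos hfg]
      have h2 : (2 : ℝ≥0∞) = ENNReal.ofReal 2 := by simp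
      rw [h2, ← ENNReal.ofReal_mul (by norm_num), ← ENNReal.ofReal_mul (by norm_num),
        ← ENNReal.ofReal_add (mul_nonneg (by norm_num) (Q.nonneg _))
          (mul_nonneg (by norm_num) (Q.nonneg _))]
      apply ENNReal.ofReal_le_ofReal
      have h := Q.nonneg (⟨f, hf⟩ - ⟨g, hg⟩)
      have e : (⟨f + g, hfg⟩ : Q.dom) = ⟨f, hf⟩ + ⟨g, hg⟩ := rfl
      rw [e]
      simp only [map_add, map_sub, LinearMap.add_apply, LinearMap.sub_apply] at h ⊢
      linarith
    · simp [Form.val, hg]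
  · simp [Form.val, hf]

lemma Form.val_smul_le (Q : Form E) (a : ℝ) (f : E) (hf : f ∈ Q.dom) :
    Q.val (a • f) ≤ ENNReal.ofReal (a ^ 2) * Q.val f := by
  have haf := Q.dom.smul_mem a hf
  rw [Form.val, Form.val, dif_pos hf, dif_pos haf, ← ENNReal.ofReal_mul (sq_nonneg a)]
  apply ENNReal.ofReal_le_ofReal
  have e : (⟨a • f, haf⟩ : Q.dom) = a • ⟨f, hf⟩ := rfl
  rw [e]
  simp only [map_smul, LinearMap.smul_apply, smul_eq_mul]
  apply le_of_eq
  ring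

lemma Form.val₁_add_le (Q : Form E) (f g : E) :
    Q.val₁ (f + g) ≤ 2 * Q.val₁ f + 2 * Q.val₁ g := by
  have h1 := Q.val_add_le f g
  have h2 : ENNReal.ofReal (‖f + g‖ ^ 2) ≤
      2 * ENNReal.ofReal (‖f‖ ^ 2) + 2 * ENNReal.ofReal (‖g‖ ^ 2) := by
    have h2 : (2 : ℝ≥0∞) = ENNReal.ofReal 2 := by simp
    rw [h2, ← ENNReal.ofReal_mul (by norm_num), ← ENNReal.ofReal_mul (by norm_num),
        ← ENNReal.ofReal_add (by positivity) (by positivity)]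
    apply ENNReal.ofReal_le_ofReal
    have h3 : ‖f + g‖ ^ 2 ≤ (‖f‖ + ‖g‖) ^ 2 := by gcongr; exact norm_add_le f g
    nlinarith [sq_nonneg (‖f‖ - ‖g‖)]
  calc Q.val₁ (f + g) ≤ (2 * Q.val f + 2 * Q.val g) +
        (2 * ENNReal.ofReal (‖f‖ ^ 2) + 2 * ENNReal.ofReal (‖g‖ ^ 2)) := add_le_add h1 h2
    _ = _ := by simp only [Form.val₁]; ring

lemma Form.val₁_smul_le (Q : Form E) (a : ℝ) (f : E) (hf : f ∈ Q.dom) :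
    Q.val₁ (a • f) ≤ ENNReal.ofReal (a ^ 2) * Q.val₁ f := by
  have h1 := Q.val_smul_le a f hf
  have h2 : ENNReal.ofReal (‖a • f‖ ^ 2) = ENNReal.ofReal (a ^ 2) * ENNReal.ofReal (‖f‖ ^ 2) := by
    rw [← ENNReal.ofReal_mul (sq_nonneg a), norm_smul, mul_pow, Real.norm_eq_abs, sq_abs]
  rw [Form.val₁, Form.val₁, mul_add, h2]
  gcongr

/-- The elements of `D(Q)` that lie in the form norm closure of `S ∩ D(Q)`. -/
def Form.formClosure (Q : Form E) (S : Submodule ℝ E) : Submodule ℝ E where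
  carrier := {f | f ∈ Q.dom ∧ ∀ ε : ℝ≥0∞, 0 < ε → ∃ g ∈ S, g ∈ Q.dom ∧ Q.val₁ (f - g) < ε}
  add_mem' := by
    rintro f g ⟨hf, hf'⟩ ⟨hg, hg'⟩
    refine ⟨Q.dom.add_mem hf hg, fun ε hε => ?_⟩
    have hε4 : 0 < ε / 4 := ENNReal.div_pos hε.ne' (by simp)
    obtain ⟨u, huS, hu, hu'⟩ := hf' _ hε4
    obtain ⟨v, hvS, hv, hv'⟩ := hg' _ hε4
    refine ⟨u + v, S.add_mem huS hvS, Q.dom.add_mem hu hv, ?_⟩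
    have e : f + g - (u + v) = (f - u) + (g - v) := by abel
    rw [e]
    refine (Q.val₁_add_le _ _).trans_lt ?_
    calc 2 * Q.val₁ (f - u) + 2 * Q.val₁ (g - v) < 2 * (ε / 4) + 2 * (ε / 4) := by
          apply ENNReal.add_lt_add
          · exact (ENNReal.mul_lt_mul_iff_right (by simp) (by simp)).2 hu'
          · exact (ENNReal.mul_lt_mul_iff_right (by simp) (by simp)).2 hv'
      _ = ε := by
          rw [← add_mul]
          norm_num
          exact ENNReal.mul_div_cancel (by simp) (by simp)
  zero_mem' := ⟨Q.dom.zero_mem, fun ε hε => ⟨0, S.zero_mem, Q.dom.zero_mem, by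
    have h := Q.val_smul_le 0 0 Q.dom.zero_mem
    simp only [smul_zero, ne_eq, OfNat.ofNat_ne_zero, not_false_eq_true, zero_pow,
      ENNReal.ofReal_zero, zero_mul, nonpos_iff_eq_zero] at h
    simpa [Form.val₁, h] using hε⟩⟩
  smul_mem' := by
    rintro a f ⟨hf, hf'⟩
    refine ⟨Q.dom.smul_mem a hf, fun ε hε => ?_⟩
    have hA : 0 < ENNReal.ofReal (a ^ 2) + 1 := by positivity
    have hA' : ENNReal.ofReal (a ^ 2) + 1 ≠ ⊤ := by simp
    obtain ⟨u, huS, hu, hu'⟩ := hf' (ε / (ENNReal.ofReal (a ^ 2) + 1))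
      (ENNReal.div_pos hε.ne' hA')
    refine ⟨a • u, S.smul_mem a huS, Q.dom.smul_mem a hu, ?_⟩
    rw [← smul_sub]
    refine (Q.val₁_smul_le a _ (Q.dom.sub_mem hf hu)).trans_lt ?_
    calc ENNReal.ofReal (a ^ 2) * Q.val₁ (f - u)
        ≤ (ENNReal.ofReal (a ^ 2) + 1) * Q.val₁ (f - u) := by gcongr; exact le_self_add
      _ < (ENNReal.ofReal (a ^ 2) + 1) * (ε / (ENNReal.ofReal (a ^ 2) + 1)) :=
          (ENNReal.mul_lt_mul_iff_right hA.ne' hA').2 hu'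
      _ = ε := ENNReal.mul_div_cancel hA.ne' hA'

end Normed

/-! ### Dirichlet forms on `L²`-spaces -/

section Dirichlet

variable {α : Type*} [MeasurableSpace α] {μ : Measure α}

/-- A form on an `L²`-space is Markovian if `Q(C ∘ f) ≤ Q(f)` for all `f` and all normal
contractions `C`. -/
def Form.IsMarkovian (Q : Form (Lp ℝ 2 μ)) : Prop :=
  ∀ (C : ℝ → ℝ) (hC : LipschitzWith 1 C) (h0 : C 0 = 0) (f : Lp ℝ 2 μ),
    Q.val (hC.compLp h0 f) ≤ Q.val f

/-- Dirichlet forms in the wide sense: closed Markovian forms. -/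
def Form.IsWideDirichlet (Q : Form (Lp ℝ 2 μ)) : Prop := Q.IsClosed ∧ Q.IsMarkovian

/-- Dirichlet forms: densely defined closed Markovian forms. -/
def Form.IsDirichlet (Q : Form (Lp ℝ 2 μ)) : Prop :=
  Dense (Q.dom : Set (Lp ℝ 2 μ)) ∧ Q.IsClosed ∧ Q.IsMarkovian

end Dirichlet

/-! ### Graphs over a discrete measure space -/

/-- The graphs `(b,0)` over `X` (no killing), given by their edge weight `b`. -/
structure WGraph (X : Type*) where
  b : X → X → ℝ
  nonneg : ∀ x y, 0 ≤ b x y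
  symm : ∀ x y, b x y = b y x
  diag : ∀ x, b x x = 0
  summable : ∀ x, Summable (b x)

/-- Two vertices are connected if there is a finite path between them. -/
def WGraph.Connected {X : Type*} (G : WGraph X) (x y : X) : Prop :=
  Relation.ReflTransGen (fun u v => 0 < G.b u v) x y

/-- The summand of the energy form at a pair of vertices. -/
def energyTerm {X : Type*} (G : WGraph X) (f g : X → ℝ) (p : X × X) : ℝ :=
  G.b p.1 p.2 * ((f p.1 - f p.2) * (g p.1 - g p.2))

lemma summable_energyTerm {X : Type*} (G : WGraph X) {f g : X → ℝ} (hf : Summable (energyTerm G f f))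
    (hg : Summable (energyTerm G g g)) : Summable (energyTerm G f g) := by
  refine Summable.of_norm_bounded (hf.add hg) fun p => ?_
  rw [Real.norm_eq_abs, energyTerm, abs_mul, abs_of_nonneg (G.nonneg _ _)]
  simp only [energyTerm]
  rw [← mul_add]
  refine mul_le_mul_of_nonneg_left ?_ (G.nonneg _ _)
  rw [abs_le]
  constructor <;> nlinarith [sq_nonneg ((f p.1 - f p.2) + (g p.1 - g p.2)),
    sq_nonneg ((f p.1 - f p.2) - (g p.1 - g p.2)), sq_nonneg (f p.1 - f p.2),
    sq_nonneg (g p.1 - g p.2)]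

section Discrete

variable {X : Type*} [MeasurableSpace X]

/-- The measure on `X` with point masses `m x ∈ (0,∞)`. -/
def vertexMeasure (m : X → Ioi (0 : ℝ)) : Measure X :=
  Measure.sum fun x => ENNReal.ofReal (m x : ℝ) • Measure.dirac x

/-- The Hilbert space `ℓ²(X,m)`. -/
abbrev ell2 (m : X → Ioi (0 : ℝ)) : Type _ := Lp ℝ 2 (vertexMeasure m)

variable [DiscreteMeasurableSpace X]

lemma eq_of_ae_eq (m : X → Ioi (0 : ℝ)) {f g : X → ℝ} (h : f =ᵐ[vertexMeasure m] g) : f = g := by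
  funext x
  have h' : ∀ᵐ y ∂(ENNReal.ofReal (m x : ℝ) • Measure.dirac x), f y = g y :=
    h.filter_mono (ae_mono (Measure.le_sum _ x))
  have hm : ENNReal.ofReal (m x : ℝ) ≠ 0 := by
    have h0 : (0 : ℝ) < m x := (m x).2
    rw [Ne, ENNReal.ofReal_eq_zero, not_le]
    exact h0
  rw [Measure.ae_ennreal_smul_measure_iff hm, ae_dirac_eq] at h'
  exact h'

lemma ell2_add_apply {m : X → Ioi (0 : ℝ)} (f g : ell2 m) (x : X) : (f + g) x = f x + g x :=
  congrFun (eq_of_ae_eq m (Lp.coeFn_add f g)) x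

lemma ell2_smul_apply {m : X → Ioi (0 : ℝ)} (a : ℝ) (f : ell2 m) (x : X) : (a • f) x = a * f x :=
  congrFun (eq_of_ae_eq m (Lp.coeFn_smul a f)) x

lemma ell2_zero_apply {m : X → Ioi (0 : ℝ)} (x : X) : (0 : ell2 m) x = 0 :=
  congrFun (eq_of_ae_eq m (Lp.coeFn_zero ℝ 2 (vertexMeasure m))) x

/-- `C_c(X)`: the finitely supported functions, as a subspace of `ℓ²(X,m)`. -/
def finSupp (m : X → Ioi (0 : ℝ)) : Submodule ℝ (ell2 m) where
  carrier := {f | (Function.support (f : X → ℝ)).Finite}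
  add_mem' := by
    intro f g hf hg
    refine (hf.union hg).subset fun x hx => ?_
    by_contra hc
    simp only [mem_union, Function.mem_support, not_or, not_not] at hc
    exact hx (by rw [ell2_add_apply, hc.1, hc.2, add_zero])
  zero_mem' := by
    refine Set.finite_empty.subset fun x hx => hx (ell2_zero_apply x)
  smul_mem' := by
    intro a f hf
    refine hf.subset fun x hx hfx => hx ?_
    rw [ell2_smul_apply, hfx, mul_zero]

/-- `𝔇`: the Dirichlet forms on `ℓ²(X,m)` whose domain contains `C_c(X)`. -/
def discreteForms (m : X → Ioi (0 : ℝ)) : Set (Form (ell2 m)) :=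
  {Q | Q.IsDirichlet ∧ finSupp m ≤ Q.dom}

variable (m : X → Ioi (0 : ℝ)) (G : WGraph X)

/-- `D(Q^(N))`: the functions of finite energy in `ℓ²(X,m)`. -/
def neumannDom : Submodule ℝ (ell2 m) where
  carrier := {f | Summable (energyTerm G f f)}
  add_mem' := by
    intro f g hf hg
    have hfg := summable_energyTerm G hf hg
    refine ((hf.add hg).add (hfg.mul_left 2)).congr fun p => ?_
    simp only [energyTerm, ell2_add_apply]
    ring
  zero_mem' := by
    refine summable_zero.congr fun p => ?_
    simp only [energyTerm]
    rw [ell2_zero_apply, ell2_zero_apply]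
    ring
  smul_mem' := by
    intro a f hf
    refine (Summable.mul_left (a ^ 2) hf).congr fun p => ?_
    simp only [energyTerm, ell2_smul_apply]
    ring

/-- The Neumann form `Q^(N)`: the restriction of the energy form
`(f,g) ↦ 1/2 ∑ b(x,y)(f(x)-f(y))(g(x)-g(y))` to the functions of finite energy in `ℓ²(X,m)`. -/
def neumannForm : Form (ell2 m) where
  dom := neumannDom m G
  bilin := LinearMap.mk₂ ℝ (fun f g => (1 / 2) * ∑' p, energyTerm G (f : ell2 m) (g : ell2 m) p)
    (by
      intro f f' g
      rw [← mul_add, ← (summable_energyTerm G f.2 g.2).tsum_add (summable_energyTerm G f'.2 g.2)]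
      congr 2; funext p
      simp only [energyTerm, Submodule.coe_add, ell2_add_apply]; ring)
    (by
      intro a f g
      rw [smul_eq_mul, mul_left_comm a, ← tsum_mul_left (a := a)]
      congr 2; funext p
      simp only [energyTerm, Submodule.coe_smul, ell2_smul_apply]; ring)
    (by
      intro f g g'
      rw [← mul_add, ← (summable_energyTerm G f.2 g.2).tsum_add (summable_energyTerm G f.2 g'.2)]
      congr 2; funext p
      simp only [energyTerm, Submodule.coe_add, ell2_add_apply]; ring)
    (by
      intro a f g
      rw [smul_eq_mul, mul_left_comm a, ← tsum_mul_left (a := a)]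
      congr 2; funext p
      simp only [energyTerm, Submodule.coe_smul, ell2_smul_apply]; ring)
  symm f g := by
    simp only [LinearMap.mk₂_apply]
    congr 2; funext p
    simp only [energyTerm]; ring
  nonneg f := by
    simp only [LinearMap.mk₂_apply]
    refine mul_nonneg (by norm_num) (tsum_nonneg fun p => ?_)
    exact mul_nonneg (G.nonneg _ _) (mul_self_nonneg _)

/-- The form `Q^(D)`: the restriction of `Q^(N)` to the form norm closure of `C_c(X)`. -/
def dirichletForm : Form (ell2 m) :=
  (neumannForm m G).restrict ((neumannForm m G).formClosure (finSupp m)) fun _ h => h.1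

/-- `u` is `1`-harmonic: `u` belongs to the domain of the formal Laplacian `𝓛` and
`𝓛 u + u = 0`. -/
def IsHarmonic (u : X → ℝ) : Prop :=
  (∀ x, Summable fun y => G.b x y * |u y|) ∧
    ∀ x, (1 / (m x : ℝ)) * ∑' y, G.b x y * (u x - u y) + u x = 0

/-! ### The compactification, the harmonic boundary and the trace -/

/-- `D(Q^(N)) ∩ ℓ^∞(X)`. -/
def BddDom : Type _ :=
  {f : ell2 m // f ∈ (neumannForm m G).dom ∧ ∃ K : ℝ, ∀ x, |f x| ≤ K}

/-- The Royden compactification `X̂`: the closure of the image of `X` under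
`x ↦ (f(x))_f`, `f ∈ D(Q^(N)) ∩ ℓ^∞(X)`, in the product of copies of `ℝ`. -/
def Royden : Type _ :=
  closure (range fun (x : X) (f : BddDom m G) => (f.1 x : ℝ))

instance : TopologicalSpace (Royden m G) :=
  inferInstanceAs (TopologicalSpace (closure (range fun (x : X) (f : BddDom m G) => (f.1 x : ℝ))))

/-- The embedding of `X` into `X̂`. -/
def Royden.embed (x : X) : Royden m G :=
  ⟨fun f => f.1 x, subset_closure ⟨x, rfl⟩⟩

variable {m G} in
/-- The continuous extension to `X̂` of a function in `D(Q^(N)) ∩ ℓ^∞(X)`. -/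
def Royden.extend (f : BddDom m G) (ξ : Royden m G) : ℝ := ξ.1 f

/-- The `1`-harmonic boundary `∂X`. -/
def Boundary : Type _ :=
  {ξ : Royden m G // ξ ∉ range (Royden.embed m G) ∧
    ∀ f : BddDom m G, f.1 ∈ (dirichletForm m G).dom → Royden.extend f ξ = 0}

instance : TopologicalSpace (Boundary m G) :=
  inferInstanceAs (TopologicalSpace (Subtype _))

instance : MeasurableSpace (Boundary m G) := borel _

instance : BorelSpace (Boundary m G) := ⟨rfl⟩

variable {m} in
/-- The trace `γ f` of `f ∈ D(Q^(N))`: the restriction to `∂X` of the continuous extension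
`X̂ → [-∞,∞]` of `f`. -/
def trace (f : ell2 m) (ξ : Boundary m G) : EReal :=
  limUnder (comap (Royden.embed m G) (𝓝 ξ.1)) fun x => ((f x : ℝ) : EReal)

/-! ### Harmonic measures -/

/-- `μ` is a `1`-harmonic measure of the vertex `x`: a Radon measure on `∂X` of mass at most `1`
with `u(x) = ∫ φ dμ` whenever `φ` is the trace of a bounded function in `D(Q^(N))` and
`u ∈ D(Q^(N))` is its `1`-harmonic extension. The last condition is the normalization
`μ({∞}) = 0`; a point `∞` at which all functions in `D(Q^(N)) ∩ ℓ^∞(X)` vanish exists only if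
`1 ∉ D(Q^(N))`, and it is then unique. -/
def IsHarmonicMeasure (x : X) (μ : Measure (Boundary m G)) : Prop :=
  μ.Regular ∧ μ univ ≤ 1 ∧
  (∀ (f : BddDom m G) (u : ell2 m), u ∈ (neumannForm m G).dom → IsHarmonic m G u →
    trace G u = trace G f.1 → ∫ ξ, Royden.extend f ξ.1 ∂μ = u x) ∧
  ∀ ξ : Boundary m G, (∀ f : BddDom m G, Royden.extend f ξ.1 = 0) → μ {ξ} = 0

/-- The `1`-harmonic measure `μ_x`. -/
def harmonicMeasure (x : X) : Measure (Boundary m G) :=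
  open Classical in
  if h : ∃ μ, IsHarmonicMeasure m G x μ then h.choose else 0

/-- Weights for the reference measure `∑ w(x) μ_x` on `∂X`: they are summable, also after
division by `m`, and do not vanish identically on any connected component of the graph. If the
graph is connected, then the indicator function of any single vertex is admissible. -/
structure IsAdmissible (w : X → ℝ≥0) : Prop where
  summable : Summable w
  summable_div : Summable fun x => (w x : ℝ) / (m x : ℝ)
  meets : ∀ x, ∃ y, G.Connected x y ∧ 0 < w y

variable (w : X → ℝ≥0)

/-- The reference measure `μ = ∑ w(x) μ_x` on `∂X`. -/
def refMeasure : Measure (Boundary m G) :=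
  Measure.sum fun x => (w x : ℝ≥0∞) • harmonicMeasure m G x

/-- The space `L²(∂X)`. -/
abbrev BoundaryL2 : Type _ := Lp ℝ 2 (refMeasure m G w)

variable {m}

/-- `φ ∈ L²(∂X)` is the class of the trace of `f`. -/
def IsTrace (f : ell2 m) (φ : BoundaryL2 m G w) : Prop :=
  ∀ᵐ ξ ∂(refMeasure m G w), ((φ ξ : ℝ) : EReal) = trace G f ξ

/-- The `1`-harmonic extension `H φ` of `φ`. -/
def harmonicExt (φ : BoundaryL2 m G w) : ell2 m :=
  open Classical in
  if h : ∃ u : ell2 m, u ∈ (neumannForm m G).dom ∧ IsHarmonic m G u ∧ IsTrace G w u φ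
  then h.choose else 0

/-- The trace form `Tr Q`, as an `[0,∞]`-valued quadratic form on `L²(∂X)`: its domain is
`γ D(Q)`, and there `Tr Q (φ) = Q₁(H φ)`. -/
def traceForm (Q : Form (ell2 m)) (φ : BoundaryL2 m G w) : ℝ≥0∞ :=
  open Classical in
  if ∃ f ∈ Q.dom, IsTrace G w f φ then Q.val₁ (harmonicExt G w φ) else ⊤

variable (m)

/-- The Dirichlet-to-Neumann form `q^{DN} = Tr Q^(N)`. -/
def dnForm (φ : BoundaryL2 m G w) : ℝ≥0∞ := traceForm G w (neumannForm m G) φ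

/-- `Tr 𝔇(b,0)`: the Dirichlet forms in the wide sense `q` on `L²(∂X)` with `q ≥ q^{DN}` for which
`q - q^{DN}`, considered on the domain `D(q)`, is Markovian. -/
def traceForms : Set (Form (BoundaryL2 m G w)) :=
  {q | q.IsWideDirichlet ∧ (∀ φ, dnForm m G w φ ≤ q.val φ) ∧
    ∀ (C : ℝ → ℝ) (hC : LipschitzWith 1 C) (h0 : C 0 = 0), ∀ φ ∈ q.dom,
      hC.compLp h0 φ ∈ q.dom ∧
      (q.val (hC.compLp h0 φ)).toReal - (dnForm m G w (hC.compLp h0 φ)).toReal ≤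
        (q.val φ).toReal - (dnForm m G w φ).toReal}

variable {m}

/-- `D(Q) ⊆ D(Q^(N))`, and for all `f ∈ D(Q)` one has `γ f ∈ D(q)` and
`Q(f) = Q^(N)(f) + q(γ f) - q^{DN}(γ f)`. -/
def Represents (q : Form (BoundaryL2 m G w)) (Q : Form (ell2 m)) : Prop :=
  Q.dom ≤ (neumannForm m G).dom ∧
  ∀ f ∈ Q.dom, ∃ φ ∈ q.dom, IsTrace G w f φ ∧
    (Q.val f).toReal =
      ((neumannForm m G).val f).toReal + (q.val φ).toReal - (dnForm m G w φ).toReal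

end Discrete

end GraphForm

end

open GraphForm

noncomputable section

namespace GraphForm

set_option linter.unusedSectionVars false

/-! ### General facts on forms -/

section FormGeneral

variable {E : Type*} [AddCommGroup E] [Module ℝ E]

/-! The setting is the Hilbert space `D(Q^(N))` with inner product `Q^(N)(f,g) + ⟪f,g⟫`. It is the
orthogonal sum of `D(Q^(D))` and the `1`-harmonic functions (`isHarmonic_iff`); `harm` is the
projection to the latter. The trace `γ` is bounded from `D(Q^(N))` to `L²(∂X)`, and its kernel is
exactly `D(Q^(D))` (`traceOp_eq_zero_iff`). Hence `γ f` and `harm f` determine each other, and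
`q^{DN}(γ f) = ‖harm f‖²`.

From `Q` to its trace: if `Q` extends `Q^(D)`, then `Q(δ_x, δ_y) = -b(x,y)` for `x ≠ y`, so the
graph is unique. Let `L` be the operator of `Q`. On finitely supported functions the approximating
forms `s⁻¹ ⟪f - (1 + sL)⁻¹ f, f⟫` are graph energies with nonnegative weights and nonnegative
killing, and the weights converge to `b` as `s → 0`. Removing finitely many edges therefore leaves
the Markov inequality intact; in the limit `Q - Q^(N)` is Markovian on `D(Q)`
(`sub_energy_comp_le`), and the contraction `C = 0` gives `Q ≥ Q^(N)`. The nonnegative form `Q -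
Q^(N)` vanishes on `D(Q^(D))`, so it only sees `harm f`, and there it equals `Tr Q - q^{DN}` at `γ
f`. This is the representation formula. Since `γ` commutes with normal contractions, it also shows
that `Tr Q - q^{DN}` is Markovian.

Back from the boundary: if `q` represents `Q`, the correction term vanishes on functions with zero
trace, so `Q = Q^(N)` on `C_c(X)`, and closedness of `Q` yields the extension property
(`extends_of_represents`). For `q ∈ Tr 𝔇(b,0)` the form `Q^(N)(f) + q(γ f) - q^{DN}(γ f)` on `{f | γ
f ∈ D(q)}` is a Dirichlet form with trace `q` (`liftForm`, `traceForm_liftForm`), which is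
surjectivity. Injectivity holds because `D(Q)` contains the kernel of `γ`, so that `f ∈ D(Q)` is
decided by `γ f`, and the values follow from the representation formula.

The boundary theory rests on a maximum principle (`harm_le_of_trace_le`), which yields the harmonic
measures by Hahn–Banach and Riesz, and on the estimate `weight_mul_harm_sq_le`, which bounds `γ` in
`L²`. -/

lemma Form.val_of_mem (Q : Form E) (f : Q.dom) : Q.val f = ENNReal.ofReal (Q.bilin f f) := by
  rw [Form.val, dif_pos f.2]

lemma Form.toReal_val (Q : Form E) (f : Q.dom) : (Q.val f).toReal = Q.bilin f f := by
  rw [Q.val_of_mem, ENNReal.toReal_ofReal (Q.nonneg f)]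

lemma Form.val_of_notMem (Q : Form E) {f : E} (h : f ∉ Q.dom) : Q.val f = ⊤ := by
  rw [Form.val, dif_neg h]

lemma Form.mem_dom_iff (Q : Form E) {f : E} : f ∈ Q.dom ↔ Q.val f ≠ ⊤ := by
  constructor
  · intro h
    rw [Q.val_of_mem ⟨f, h⟩]
    exact ENNReal.ofReal_ne_top
  · intro h
    by_contra hc
    exact h (Q.val_of_notMem hc)

lemma Form.bilin_eq_polar (Q : Form E) (f g : Q.dom) :
    Q.bilin f g = (Q.bilin (f + g) (f + g) - Q.bilin (f - g) (f - g)) / 4 := by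
  simp only [map_add, map_sub, LinearMap.add_apply, LinearMap.sub_apply]
  rw [Q.symm g f]
  ring

/-- The domain is the set where the quadratic form is finite, and polarization recovers the bilinear
map. This allows comparing forms through their `[0,∞]`-valued quadratic forms only. -/
lemma Form.ext_of_val {Q Q' : Form E} (h : Q.val = Q'.val) : Q = Q' := by
  have hd : Q.dom = Q'.dom := by
    ext f
    rw [Q.mem_dom_iff, Q'.mem_dom_iff, h]
  have hv : ∀ (f : Q.dom) (f' : Q'.dom), (f : E) = f' → Q.bilin f f = Q'.bilin f' f' := by
    intro f f' hf
    rw [← Q.toReal_val, ← Q'.toReal_val, h, hf]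
  obtain ⟨d, B, hs, hn⟩ := Q
  obtain ⟨d', B', hs', hn'⟩ := Q'
  dsimp only at hd
  subst hd
  have : B = B' := by
    ext f g
    have e1 := Form.bilin_eq_polar ⟨d, B, hs, hn⟩ f g
    have e2 := Form.bilin_eq_polar ⟨d, B', hs', hn'⟩ f g
    dsimp only at e1 e2
    rw [e1, e2]
    have e3 := hv (f + g) (f + g) rfl
    have e4 := hv (f - g) (f - g) rfl
    dsimp only at e3 e4
    rw [e3, e4]
  subst this
  rfl

lemma Form.extends_of_val {Q Q' : Form E} (h : ∀ f ∈ Q'.dom, Q.val f = Q'.val f) :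
    Q.Extends Q' := by
  have hd : Q'.dom ≤ Q.dom := by
    intro f hf
    rw [Q.mem_dom_iff, h f hf]
    exact Q'.mem_dom_iff.1 hf
  refine ⟨hd, fun f g => ?_⟩
  have hv : ∀ f : Q'.dom, Q.bilin (Submodule.inclusion hd f) (Submodule.inclusion hd f)
      = Q'.bilin f f := by
    intro f
    rw [← Q.toReal_val, ← Q'.toReal_val, ← h f f.2]
    rfl
  rw [Q.bilin_eq_polar, Q'.bilin_eq_polar, ← map_add, ← map_sub, hv, hv]

lemma Form.Extends.val_eq {Q Q' : Form E} (h : Q.Extends Q') {f : E} (hf : f ∈ Q'.dom) :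
    Q.val f = Q'.val f := by
  obtain ⟨hd, hb⟩ := h
  have := hb ⟨f, hf⟩ ⟨f, hf⟩
  rw [Q.val_of_mem ⟨f, hd hf⟩, Q'.val_of_mem ⟨f, hf⟩, ← this]
  rfl

/-- The multiple `s Q` of a form. -/
@[reducible] def Form.scale (Q : Form E) (s : ℝ≥0) : Form E where
  dom := Q.dom
  bilin := (s : ℝ) • Q.bilin
  symm f g := by simp [Q.symm f g]
  nonneg f := by
    simp only [LinearMap.smul_apply, smul_eq_mul]
    exact mul_nonneg s.2 (Q.nonneg f)

end FormGeneral

/-! ### The Hilbert space of a closed form -/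

section FormSpace

variable {E : Type*} [NormedAddCommGroup E] [InnerProductSpace ℝ E]

/-- The domain of a form, equipped with the inner product `Q(f,g) + ⟪f,g⟫`. -/
def Form.Space (Q : Form E) : Type _ := Q.dom

instance (Q : Form E) : AddCommGroup Q.Space := inferInstanceAs (AddCommGroup Q.dom)
instance (Q : Form E) : Module ℝ Q.Space := inferInstanceAs (Module ℝ Q.dom)

/-- The form space is the domain as a vector space. -/
def Form.toDom (Q : Form E) : Q.Space ≃ₗ[ℝ] Q.dom := LinearEquiv.refl ℝ Q.dom

/-- The inner product `Q₁`. -/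
@[reducible] def Form.core (Q : Form E) : InnerProductSpace.Core ℝ Q.Space where
  inner f g := Q.bilin (Q.toDom f) (Q.toDom g) + inner ℝ (Q.toDom f : E) (Q.toDom g : E)
  conj_inner_symm f g := by
    simp only [conj_trivial]
    rw [Q.symm, real_inner_comm]
  re_inner_nonneg f := by
    simp only [RCLike.re_to_real]
    exact add_nonneg (Q.nonneg _) real_inner_self_nonneg
  add_left f g h := by
    simp only [map_add, LinearMap.add_apply, Submodule.coe_add, inner_add_left]
    ring
  smul_left f g r := by
    simp only [map_smul, LinearMap.smul_apply, Submodule.coe_smul, real_inner_smul_left,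
      smul_eq_mul, conj_trivial]
    ring
  definite f h := by
    have h1 := Q.nonneg (Q.toDom f)
    have h2 : 0 ≤ inner ℝ (Q.toDom f : E) (Q.toDom f : E) := real_inner_self_nonneg
    have h3 : inner ℝ (Q.toDom f : E) (Q.toDom f : E) = 0 := by linarith
    exact Q.toDom.injective (Subtype.ext (inner_self_eq_zero.1 h3))

instance (Q : Form E) : NormedAddCommGroup Q.Space := Q.core.toNormedAddCommGroup
instance (Q : Form E) : InnerProductSpace ℝ Q.Space := InnerProductSpace.ofCore Q.core.toCore

/-- The elements of the domain as elements of the form space. -/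
def Form.toSpace (Q : Form E) : Q.dom ≃ₗ[ℝ] Q.Space := Q.toDom.symm

lemma Form.inner_def (Q : Form E) (f g : Q.dom) :
    inner ℝ (Q.toSpace f) (Q.toSpace g) = Q.bilin f g + inner ℝ (f : E) (g : E) := rfl

lemma Form.norm_sq (Q : Form E) (f : Q.dom) :
    ‖Q.toSpace f‖ ^ 2 = Q.bilin f f + ‖(f : E)‖ ^ 2 := by
  rw [← real_inner_self_eq_norm_sq, Q.inner_def, real_inner_self_eq_norm_sq]

lemma Form.val₁_eq (Q : Form E) (f : Q.dom) :
    Q.val₁ f = ENNReal.ofReal (‖Q.toSpace f‖ ^ 2) := by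
  rw [Form.val₁, Q.val_of_mem, Q.norm_sq, ENNReal.ofReal_add (Q.nonneg f) (by positivity)]

/-- The inclusion of the form space in the ambient Hilbert space. -/
def Form.incl (Q : Form E) : Q.Space →L[ℝ] E :=
  LinearMap.mkContinuous (Q.dom.subtype ∘ₗ Q.toDom.toLinearMap) 1 (by
    intro f
    have h := Q.norm_sq (Q.toDom f)
    have h' := Q.nonneg (Q.toDom f)
    rw [one_mul]
    refine abs_le_of_sq_le_sq' ?_ (norm_nonneg _) |>.2
    change ‖(Q.toDom f : E)‖ ^ 2 ≤ ‖Q.toSpace (Q.toDom f)‖ ^ 2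
    linarith)

lemma Form.incl_toSpace (Q : Form E) (f : Q.dom) : Q.incl (Q.toSpace f) = f := rfl

lemma Form.incl_mem (Q : Form E) (f : Q.Space) : Q.incl f ∈ Q.dom := (Q.toDom f).2

lemma Form.incl_injective (Q : Form E) : Function.Injective Q.incl :=
  Subtype.val_injective.comp Q.toDom.injective

lemma Form.norm_incl_le (Q : Form E) (f : Q.Space) : ‖Q.incl f‖ ≤ ‖f‖ := by
  have := Q.incl.le_opNorm f
  have h : ‖Q.incl‖ ≤ 1 := LinearMap.mkContinuous_norm_le _ zero_le_one _
  nlinarith [norm_nonneg f]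

/-- Trades the sequential definition with values in `[0,∞]` for completeness of an inner product
space, so that adjoints, projections and weak limits become available. -/
lemma Form.isClosed_iff (Q : Form E) : Q.IsClosed ↔ CompleteSpace Q.Space := by
  have key : ∀ f g : Q.Space, Q.val₁ (Q.incl f - Q.incl g) = ENNReal.ofReal (dist f g ^ 2) := by
    intro f g
    rw [← map_sub, dist_eq_norm]
    exact Q.val₁_eq _
  constructor
  · intro h
    refine Metric.complete_of_cauchySeq_tendsto fun u hu => ?_
    obtain ⟨f, hf, hlim⟩ := h (fun n => Q.incl (u n)) (fun n => Q.incl_mem _) (by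
      intro ε hε
      by_cases hε' : ε = ⊤
      · exact ⟨0, fun n _ k _ => by rw [key, hε']; exact ENNReal.ofReal_lt_top⟩
      obtain ⟨N, hN⟩ := Metric.cauchySeq_iff.1 hu (√ε.toReal)
        (Real.sqrt_pos.2 (ENNReal.toReal_pos hε.ne' hε'))
      refine ⟨N, fun n hn k hk => ?_⟩
      rw [key, ENNReal.ofReal_lt_iff_lt_toReal (sq_nonneg _) hε', ← Real.lt_sqrt dist_nonneg]
      exact hN n hn k hk)
    refine ⟨Q.toSpace ⟨f, hf⟩, ?_⟩
    have e : (fun n => Q.val₁ (Q.incl (u n) - f)) =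
        fun n => ENNReal.ofReal (dist (u n) (Q.toSpace ⟨f, hf⟩) ^ 2) :=
      funext fun n => key (u n) (Q.toSpace ⟨f, hf⟩)
    rw [e] at hlim
    have h2 := (ENNReal.tendsto_toReal ENNReal.zero_ne_top).comp hlim
    rw [tendsto_iff_dist_tendsto_zero]
    have h3 := h2.sqrt
    simp only [Function.comp_def, ENNReal.toReal_zero, Real.sqrt_zero] at h3
    refine h3.congr fun n => ?_
    rw [ENNReal.toReal_ofReal (sq_nonneg _), Real.sqrt_sq dist_nonneg]
  · intro h u hu hc
    set v : ℕ → Q.Space := fun n => Q.toSpace ⟨u n, hu n⟩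
    have hv : CauchySeq v := by
      rw [Metric.cauchySeq_iff]
      intro ε hε
      obtain ⟨N, hN⟩ := hc (ENNReal.ofReal (ε ^ 2)) (ENNReal.ofReal_pos.2 (by positivity))
      refine ⟨N, fun n hn k hk => ?_⟩
      have h1 := hN n hn k hk
      have h2 := key (v n) (v k)
      change Q.val₁ (u n - u k) = _ at h2
      rw [h2, ENNReal.ofReal_lt_ofReal_iff (by positivity)] at h1
      exact lt_of_pow_lt_pow_left₀ 2 hε.le h1
    obtain ⟨f, hf⟩ := cauchySeq_tendsto_of_complete hv
    refine ⟨Q.incl f, Q.incl_mem f, ?_⟩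
    have e : (fun n => Q.val₁ (u n - Q.incl f)) = fun n => ENNReal.ofReal (dist (v n) f ^ 2) :=
      funext fun n => key (v n) f
    rw [e]
    rw [tendsto_iff_dist_tendsto_zero] at hf
    have := ENNReal.tendsto_ofReal (hf.pow 2)
    simpa using this

/-- The form norms of `Q` and `s Q` are equivalent. The scaled forms are needed because `(1 + s
L)⁻¹` is the resolvent `Form.resolvent` of `s Q`. -/
lemma Form.IsClosed.scale {Q : Form E} (h : Q.IsClosed) {s : ℝ≥0} (hs : 0 < s) :
    (Q.scale s).IsClosed := by
  have hs' : (0 : ℝ) < s := hs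
  have hQ := Q.isClosed_iff.1 h
  rw [Form.isClosed_iff]
  have hn : ∀ f : Q.dom, ‖(Q.scale s).toSpace f‖ ^ 2 = s * Q.bilin f f + ‖(f : E)‖ ^ 2 :=
    fun f => (Q.scale s).norm_sq f
  refine Metric.complete_of_cauchySeq_tendsto fun u hu => ?_
  let v : ℕ → Q.Space := fun n => Q.toSpace ((Q.scale s).toDom (u n))
  have b1 : ∀ f : Q.dom, ‖Q.toSpace f‖ ^ 2 ≤ (1 + 1 / s) * ‖(Q.scale s).toSpace f‖ ^ 2 := by
    intro f
    rw [hn, Form.norm_sq]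
    have := Q.nonneg f
    have e : (1 + 1 / (s : ℝ)) * (s * Q.bilin f f + ‖(f : E)‖ ^ 2) =
      s * Q.bilin f f + Q.bilin f f + ‖(f : E)‖ ^ 2 + 1 / s * ‖(f : E)‖ ^ 2 := by
      field_simp; ring
    rw [e]
    have : 0 ≤ 1 / (s : ℝ) * ‖(f : E)‖ ^ 2 := by positivity
    have : 0 ≤ s * Q.bilin f f := by positivity
    linarith
  have b2 : ∀ f : Q.dom, ‖(Q.scale s).toSpace f‖ ^ 2 ≤ (1 + s) * ‖Q.toSpace f‖ ^ 2 := by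
    intro f
    rw [hn, Form.norm_sq]
    have := Q.nonneg f
    nlinarith [sq_nonneg ‖(f : E)‖]
  have b1' : ∀ f : Q.dom, ‖Q.toSpace f‖ ≤ √(1 + 1 / s) * ‖(Q.scale s).toSpace f‖ := by
    intro f
    refine abs_le_of_sq_le_sq' ?_ (by positivity) |>.2
    rw [mul_pow, Real.sq_sqrt (by positivity)]
    exact b1 f
  have b2' : ∀ f : Q.dom, ‖(Q.scale s).toSpace f‖ ≤ √(1 + s) * ‖Q.toSpace f‖ := by
    intro f
    refine abs_le_of_sq_le_sq' ?_ (by positivity) |>.2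
    rw [mul_pow, Real.sq_sqrt (by positivity)]
    exact b2 f
  have hv : CauchySeq v := by
    rw [Metric.cauchySeq_iff] at hu ⊢
    intro ε hε
    have hp : 0 < √(1 + 1 / (s : ℝ)) := by positivity
    obtain ⟨N, hN⟩ := hu (ε / √(1 + 1 / s)) (by positivity)
    refine ⟨N, fun n hn k hk => ?_⟩
    have h1 := hN n hn k hk
    rw [dist_eq_norm, lt_div_iff₀ hp] at h1
    rw [dist_eq_norm]
    refine (b1' (Q.toDom (v n - v k))).trans_lt ?_
    rw [mul_comm]
    exact h1
  obtain ⟨f, hf⟩ := cauchySeq_tendsto_of_complete hv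
  refine ⟨(Q.scale s).toSpace (Q.toDom f), ?_⟩
  rw [tendsto_iff_norm_sub_tendsto_zero] at hf ⊢
  refine squeeze_zero (fun n => norm_nonneg _) (fun n => b2' (Q.toDom (v n - f))) ?_
  have := hf.const_mul (√(1 + (s : ℝ)))
  rwa [mul_zero] at this

end FormSpace

/-! ### Weak convergence in a Hilbert space continuously embedded in another one -/

section Weak

variable {H E : Type*} [NormedAddCommGroup H] [InnerProductSpace ℝ H] [CompleteSpace H]
  [NormedAddCommGroup E] [InnerProductSpace ℝ E] [CompleteSpace E]

/-- Against vectors `ι* e` the convergence is that of `⟪ι (u n), e⟫`. Such vectors are dense,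
because the orthogonal complement of the range of `ι*` is the kernel of `ι`, and boundedness of the
sequence extends the convergence to all `g`. -/
lemma tendsto_inner_of_bounded {ι : H →L[ℝ] E} (hι : Function.Injective ι) {u : ℕ → H} {f : H}
    {K : ℝ} (hK : ∀ n, ‖u n‖ ≤ K) (hu : Tendsto (fun n => ι (u n)) atTop (𝓝 (ι f))) (g : H) :
    Tendsto (fun n => inner ℝ (u n) g) atTop (𝓝 (inner ℝ f g)) := by
  have hd : Dense ((ContinuousLinearMap.adjoint ι).range : Set H) := by
    rw [Submodule.dense_iff_topologicalClosure_eq_top, Submodule.topologicalClosure_eq_top_iff,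
      ContinuousLinearMap.orthogonal_range, ContinuousLinearMap.adjoint_adjoint]
    exact LinearMap.ker_eq_bot.2 hι
  rw [Metric.tendsto_atTop]
  intro ε hε
  have hK0 : 0 ≤ K := (norm_nonneg _).trans (hK 0)
  -- Since `‖u n - f‖ ≤ K + ‖f‖`, replacing `g` by this approximation costs less than `ε / 2`.
  obtain ⟨g', hg', e, rfl⟩ := Metric.dense_iff.1 hd g (ε / (2 * (K + ‖f‖ + 1))) (by positivity)
  rw [Metric.mem_ball, dist_comm, dist_eq_norm, lt_div_iff₀ (by positivity)] at hg'
  obtain ⟨N, hN⟩ := Metric.tendsto_atTop.1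
    (hu.inner (tendsto_const_nhds (x := e)) (𝕜 := ℝ)) (ε / 2) (by positivity)
  refine ⟨N, fun n hn => ?_⟩
  have h1 := hN n hn
  set g' := ContinuousLinearMap.adjoint ι e with hg'def
  rw [Real.dist_eq] at h1 ⊢
  have e1 : inner ℝ (ι (u n)) e = inner ℝ (u n) g' :=
    (ContinuousLinearMap.adjoint_inner_right ι (u n) e).symm
  have e2 : inner ℝ (ι f) e = inner ℝ f g' :=
    (ContinuousLinearMap.adjoint_inner_right ι f e).symm
  rw [e1, e2, ← inner_sub_left] at h1
  rw [← inner_sub_left]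
  have e3 : inner ℝ (u n - f) g = inner ℝ (u n - f) g' + inner ℝ (u n - f) (g - g') := by
    rw [← inner_add_right]; congr 1; abel
  rw [e3]
  have h4 : |inner ℝ (u n - f) (g - g')| ≤ (K + ‖f‖ + 1) * ‖g - g'‖ := by
    refine (abs_real_inner_le_norm _ _).trans ?_
    gcongr
    have := norm_sub_le (u n) f
    linarith [hK n]
  have hg'' : ‖g - g'‖ * (2 * (K + ‖f‖ + 1)) < ε := hg'
  calc _ ≤ |inner ℝ (u n - f) g'| + |inner ℝ (u n - f) (g - g')| := abs_add_le _ _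
    _ < ε := by linarith

/-- A closed subspace is its own double orthogonal complement, hence weakly closed. For form domains
this means that a form-norm bound plus convergence in the ambient space suffices to stay in a closed
subspace. -/
lemma mem_of_bounded_of_tendsto {ι : H →L[ℝ] E} (hι : Function.Injective ι) {u : ℕ → H} {f : H}
    {K : ℝ} (hK : ∀ n, ‖u n‖ ≤ K) (hu : Tendsto (fun n => ι (u n)) atTop (𝓝 (ι f)))
    {S : Submodule ℝ H} (hS : IsClosed (S : Set H)) (hmem : ∀ n, u n ∈ S) : f ∈ S := by
  have : CompleteSpace S := hS.completeSpace_coe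
  rw [← Submodule.orthogonal_orthogonal S, Submodule.mem_orthogonal']
  intro g hg
  have h := tendsto_inner_of_bounded hι hK hu g
  have h0 : (fun n => inner ℝ (u n) g) = fun _ => (0 : ℝ) := by
    funext n
    exact (Submodule.mem_orthogonal S g).1 hg _ (hmem n)
  rw [h0] at h
  exact (tendsto_nhds_unique h tendsto_const_nhds)

end Weak

/-! ### The space `ℓ²(X,m)` -/

section Ell2

variable {X : Type*} [MeasurableSpace X] [DiscreteMeasurableSpace X] {m : X → Ioi (0 : ℝ)}

lemma weight_pos (m : X → Ioi (0 : ℝ)) (x : X) : (0 : ℝ) < m x := (m x).2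

lemma ell2_ext {f g : ell2 m} (h : ∀ x, f x = g x) : f = g := Lp.ext (Eventually.of_forall h)

lemma ell2_neg_apply (f : ell2 m) (x : X) : (-f) x = -f x :=
  congrFun (eq_of_ae_eq m (Lp.coeFn_neg f)) x

lemma ell2_sub_apply (f g : ell2 m) (x : X) : (f - g) x = f x - g x :=
  congrFun (eq_of_ae_eq m (Lp.coeFn_sub f g)) x

lemma ell2_comp_apply {C : ℝ → ℝ} (hC : LipschitzWith 1 C) (h0 : C 0 = 0) (f : ell2 m) (x : X) :
    (hC.compLp h0 f : ell2 m) x = C (f x) :=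
  congrFun (eq_of_ae_eq m (hC.coeFn_compLp h0 f)) x

lemma lintegral_vertexMeasure (m : X → Ioi (0 : ℝ)) (F : X → ℝ≥0∞) :
    ∫⁻ x, F x ∂(vertexMeasure m) = ∑' x, ENNReal.ofReal (m x) * F x := by
  rw [vertexMeasure, lintegral_sum_measure]
  congr 1; funext x
  rw [lintegral_smul_measure, lintegral_dirac, smul_eq_mul]

lemma memLp_of_summable {f : X → ℝ} (hf : Summable fun x => (m x : ℝ) * f x ^ 2) :
    MemLp f 2 (vertexMeasure m) := by
  refine ⟨(Measurable.of_discrete (f := f)).aestronglyMeasurable, ?_⟩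
  rw [eLpNorm_lt_top_iff_lintegral_rpow_enorm_lt_top (by norm_num) (by norm_num),
    lintegral_vertexMeasure]
  have e : ∀ x, ENNReal.ofReal (m x) * ‖f x‖ₑ ^ (ENNReal.toReal 2) =
      ENNReal.ofReal ((m x : ℝ) * f x ^ 2) := by
    intro x
    rw [ENNReal.ofReal_mul (weight_pos m x).le, Real.enorm_eq_ofReal_abs]
    congr 1
    rw [ENNReal.ofReal_rpow_of_nonneg (abs_nonneg _) (by simp)]
    simp
  simp only [e]
  rw [← ENNReal.ofReal_tsum_of_nonneg (fun x => mul_nonneg (weight_pos m x).le (sq_nonneg _)) hf]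
  exact ENNReal.ofReal_lt_top

lemma exists_ell2 {f : X → ℝ} (hf : Summable fun x => (m x : ℝ) * f x ^ 2) :
    ∃ u : ell2 m, ∀ x, u x = f x :=
  ⟨(memLp_of_summable hf).toLp f,
    fun x => congrFun (eq_of_ae_eq m (memLp_of_summable hf).coeFn_toLp) x⟩

lemma hasSum_inner (f g : ell2 m) : HasSum (fun x => (m x : ℝ) * (f x * g x)) (inner ℝ f g) := by
  rw [L2.inner_def]
  have hi : Integrable (fun a => inner ℝ (f a) (g a)) (vertexMeasure m) := L2.integrable_inner f g
  have := hasSum_integral_measure (μ := fun x => ENNReal.ofReal (m x : ℝ) • Measure.dirac x) hi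
  refine this.congr_fun ?_
  intro x
  rw [integral_smul_measure, integral_dirac, ENNReal.toReal_ofReal (weight_pos m x).le]
  simp [mul_comm]

lemma hasSum_norm_sq (f : ell2 m) : HasSum (fun x => (m x : ℝ) * f x ^ 2) (‖f‖ ^ 2) := by
  have := hasSum_inner f f
  rw [real_inner_self_eq_norm_sq] at this
  simpa [sq] using this

lemma weight_mul_sq_le (f : ell2 m) (x : X) : (m x : ℝ) * f x ^ 2 ≤ ‖f‖ ^ 2 :=
  le_hasSum (hasSum_norm_sq f) x fun y _ => mul_nonneg (weight_pos m y).le (sq_nonneg _)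

lemma tendsto_apply {ι : Type*} {l : Filter ι} {u : ι → ell2 m} {f : ell2 m}
    (h : Tendsto u l (𝓝 f)) (x : X) : Tendsto (fun i => u i x) l (𝓝 (f x)) := by
  rw [tendsto_iff_norm_sub_tendsto_zero] at h ⊢
  have h2 : Tendsto (fun i => (√(m x))⁻¹ * ‖u i - f‖) l (𝓝 0) := by
    simpa using h.const_mul (√(m x))⁻¹
  refine squeeze_zero (fun _ => norm_nonneg _) (fun i => ?_) h2
  have hp : 0 < √(m x : ℝ) := Real.sqrt_pos.2 (weight_pos m x)
  rw [← div_eq_inv_mul, le_div_iff₀ hp, Real.norm_eq_abs]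
  refine abs_le_of_sq_le_sq' ?_ (norm_nonneg _) |>.2
  rw [mul_pow, Real.sq_sqrt (weight_pos m x).le, sq_abs, mul_comm]
  have := weight_mul_sq_le (u i - f) x
  rwa [ell2_sub_apply] at this

lemma exists_ell2_of_le {f : X → ℝ} (g : ell2 m) (K : ℝ) (h : ∀ x, |f x| ≤ K * |g x|) :
    ∃ u : ell2 m, ∀ x, u x = f x := by
  refine exists_ell2 (Summable.of_nonneg_of_le
    (fun x => mul_nonneg (weight_pos m x).le (sq_nonneg _)) (fun x => ?_)
    ((hasSum_norm_sq g).summable.mul_left (K ^ 2)))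
  have h1 : f x ^ 2 ≤ K ^ 2 * g x ^ 2 := by
    rw [← sq_abs (f x), ← sq_abs (g x), ← mul_pow]
    exact pow_le_pow_left₀ (abs_nonneg _) (h x) 2
  have := mul_le_mul_of_nonneg_left h1 (weight_pos m x).le
  linarith

lemma norm_sq_le_of_abs_le {f g : ell2 m} (h : ∀ x, |f x| ≤ |g x|) : ‖f‖ ^ 2 ≤ ‖g‖ ^ 2 :=
  hasSum_le (fun x => mul_le_mul_of_nonneg_left (sq_le_sq.2 (h x)) (weight_pos m x).le)
    (hasSum_norm_sq f) (hasSum_norm_sq g)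

lemma ell2_tendsto_of_dominated {ι : Type*} {l : Filter ι} {u : ι → ell2 m} {f g : ell2 m}
    (hg : ∀ i x, |u i x| ≤ |g x|) (hf : ∀ x, |f x| ≤ |g x|)
    (hlim : ∀ x, Tendsto (fun i => u i x) l (𝓝 (f x))) : Tendsto u l (𝓝 f) := by
  rw [tendsto_iff_norm_sub_tendsto_zero]
  have h2 : Tendsto (fun i => ‖u i - f‖ ^ 2) l (𝓝 0) := by
    have h3 : Tendsto (fun i => ∑' x, (m x : ℝ) * (u i x - f x) ^ 2) l (𝓝 (∑' _ : X, (0 : ℝ))) := by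
      refine tendsto_tsum_of_dominated_convergence
        (bound := fun x => 4 * ((m x : ℝ) * g x ^ 2)) ((hasSum_norm_sq g).summable.mul_left 4)
        (fun x => ?_) (Eventually.of_forall fun i x => ?_)
      · have := (((hlim x).sub_const (f x)).pow 2).const_mul (m x : ℝ)
        simpa using this
      · rw [Real.norm_eq_abs, abs_of_nonneg (mul_nonneg (weight_pos m x).le (sq_nonneg _))]
        have h4 : (u i x - f x) ^ 2 ≤ 4 * g x ^ 2 := by
          have h5 : |u i x - f x| ≤ 2 * |g x| := by
            have := abs_sub (u i x) (f x)
            linarith [hg i x, hf x]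
          rw [← sq_abs, ← sq_abs (g x)]
          nlinarith [abs_nonneg (u i x - f x)]
        nlinarith [weight_pos m x]
    rw [tsum_zero] at h3
    refine h3.congr fun i => ?_
    rw [← (hasSum_norm_sq (u i - f)).tsum_eq]
    congr 1; funext x
    rw [ell2_sub_apply]
  have h4 := h2.sqrt
  simpa [Real.sqrt_sq] using h4

open Classical in
lemma exists_delta (m : X → Ioi (0 : ℝ)) (x : X) :
    ∃ u : ell2 m, ∀ y, u y = if y = x then 1 else 0 :=
  exists_ell2 (summable_of_ne_finset_zero (s := {x}) fun y hy => by
    simp [Finset.mem_singleton] at hy; simp [hy])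

/-- The indicator function of a vertex. -/
def delta (m : X → Ioi (0 : ℝ)) (x : X) : ell2 m := (exists_delta m x).choose

open Classical in
lemma delta_apply (x y : X) : delta m x y = if y = x then 1 else 0 :=
  (exists_delta m x).choose_spec y

@[simp] lemma delta_self (x : X) : delta m x x = 1 := by simp [delta_apply]

lemma delta_of_ne {x y : X} (h : y ≠ x) : delta m x y = 0 := by simp [delta_apply, h]

lemma delta_mem_finSupp (x : X) : delta m x ∈ finSupp m := by
  refine (Set.finite_singleton x).subset fun y hy => ?_
  by_contra hc
  exact hy (delta_of_ne hc)

lemma inner_delta (f : ell2 m) (x : X) : inner ℝ f (delta m x) = m x * f x := by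
  refine (hasSum_inner f (delta m x)).unique ?_
  have := hasSum_single (f := fun y => (m y : ℝ) * (f y * delta m x y)) x fun y hy => by
    simp [delta_of_ne hy]
  simpa using this

open Classical in
lemma exists_cut (f : ell2 m) (s : Set X) : ∃ u : ell2 m, ∀ y, u y = if y ∈ s then f y else 0 :=
  exists_ell2_of_le f 1 fun x => by split_ifs <;> simp

/-- The product of a function with the indicator function of a set. -/
def cut (f : ell2 m) (s : Set X) : ell2 m := (exists_cut f s).choose

open Classical in
lemma cut_apply (f : ell2 m) (s : Set X) (y : X) : cut f s y = if y ∈ s then f y else 0 :=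
  (exists_cut f s).choose_spec y

lemma tendsto_cut (f : ell2 m) :
    Tendsto (fun s : Finset X => cut f (s : Set X)) atTop (𝓝 f) := by
  refine ell2_tendsto_of_dominated (g := f) (fun s x => ?_) (fun x => le_rfl) (fun x => ?_)
  · rw [cut_apply]; split_ifs <;> simp
  · refine tendsto_const_nhds.congr' ?_
    filter_upwards [eventually_ge_atTop {x}] with s hs
    rw [cut_apply, if_pos]
    exact hs (Finset.mem_singleton_self x)

lemma cut_mem_finSupp (f : ell2 m) (s : Finset X) : cut f (s : Set X) ∈ finSupp m := by
  refine s.finite_toSet.subset fun y hy => ?_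
  by_contra hc
  exact hy (by rw [cut_apply, if_neg hc])

lemma dense_finSupp (m : X → Ioi (0 : ℝ)) : Dense (finSupp m : Set (ell2 m)) := fun f =>
  mem_closure_of_tendsto (tendsto_cut f) (Eventually.of_forall fun s => cut_mem_finSupp f s)

lemma eq_sum_delta {f : ell2 m} {s : Finset X} (hs : ∀ x ∉ s, f x = 0) :
    f = ∑ x ∈ s, f x • delta m x := by
  classical
  have hsum : ∀ (t : Finset X) (y : X), (∑ x ∈ t, f x • delta m x : ell2 m) y =
      ∑ x ∈ t, f x * delta m x y := by
    intro t y
    induction t using Finset.induction_on with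
    | empty => rw [Finset.sum_empty, Finset.sum_empty, ell2_zero_apply]
    | insert a t ha ih => rw [Finset.sum_insert ha, Finset.sum_insert ha, ell2_add_apply, ih,
        ell2_smul_apply]
  refine ell2_ext fun y => ?_
  rw [hsum]
  by_cases hy : y ∈ s
  · rw [Finset.sum_eq_single y (fun x _ hx => by rw [delta_of_ne (Ne.symm hx), mul_zero])
      (fun h => absurd hy h), delta_self, mul_one]
  · rw [hs y hy, Finset.sum_eq_zero]
    intro x hx
    rw [delta_of_ne (by rintro rfl; exact hy hx), mul_zero]

end Ell2

/-! ### The Neumann form -/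

section Neumann

variable {X : Type*} [MeasurableSpace X] [DiscreteMeasurableSpace X] {m : X → Ioi (0 : ℝ)}
  {G : WGraph X}

/-- The Hilbert space `D(Q^(N))`. -/
abbrev NSpace (m : X → Ioi (0 : ℝ)) (G : WGraph X) : Type _ := (neumannForm m G).Space

/-- The function in `ℓ²(X,m)` underlying an element of `D(Q^(N))`. -/
abbrev fn : NSpace m G →L[ℝ] ell2 m := (neumannForm m G).incl

/-- The energy `½ ∑ b(x,y)(f(x)-f(y))²`. -/
def energy (G : WGraph X) (f : X → ℝ) : ℝ := 1 / 2 * ∑' p, energyTerm G f f p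

lemma fn_ext {f g : NSpace m G} (h : ∀ x, fn f x = fn g x) : f = g :=
  (neumannForm m G).incl_injective (ell2_ext h)

lemma fn_add (f g : NSpace m G) (x : X) : fn (f + g) x = fn f x + fn g x := by
  rw [map_add, ell2_add_apply]

lemma fn_sub (f g : NSpace m G) (x : X) : fn (f - g) x = fn f x - fn g x := by
  rw [map_sub, ell2_sub_apply]

lemma fn_neg (f : NSpace m G) (x : X) : fn (-f) x = -fn f x := by
  rw [map_neg, ell2_neg_apply]

lemma fn_smul (a : ℝ) (f : NSpace m G) (x : X) : fn (a • f) x = a * fn f x := by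
  rw [map_smul, ell2_smul_apply]

lemma fn_zero (x : X) : fn (0 : NSpace m G) x = 0 := by
  rw [map_zero, ell2_zero_apply]

lemma energyTerm_self_nonneg (f : X → ℝ) (p : X × X) : 0 ≤ energyTerm G f f p :=
  mul_nonneg (G.nonneg _ _) (mul_self_nonneg _)

lemma energy_nonneg (f : X → ℝ) : 0 ≤ energy G f :=
  mul_nonneg (by norm_num) (tsum_nonneg fun p => energyTerm_self_nonneg f p)

lemma summable_energy (f : NSpace m G) : Summable (energyTerm G (fn f) (fn f)) :=
  (neumannForm m G).incl_mem f

lemma neumann_inner (f g : NSpace m G) :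
    inner ℝ f g = 1 / 2 * ∑' p, energyTerm G (fn f) (fn g) p + inner ℝ (fn f) (fn g) := rfl

lemma neumann_norm_sq (f : NSpace m G) : ‖f‖ ^ 2 = energy G (fn f) + ‖fn f‖ ^ 2 :=
  (neumannForm m G).norm_sq ((neumannForm m G).toDom f)

lemma exists_fn_eq {f : ell2 m} (h : f ∈ (neumannForm m G).dom) : ∃ u : NSpace m G, fn u = f :=
  ⟨(neumannForm m G).toSpace ⟨f, h⟩, rfl⟩

lemma energyTerm_le_of_sq_le {f g h : X → ℝ} {c d : ℝ}
    (H : ∀ x y, (f x - f y) ^ 2 ≤ c * (g x - g y) ^ 2 + d * (h x - h y) ^ 2) (p : X × X) :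
    energyTerm G f f p ≤ c * energyTerm G g g p + d * energyTerm G h h p := by
  have := mul_le_mul_of_nonneg_left (H p.1 p.2) (G.nonneg p.1 p.2)
  simp only [energyTerm]
  nlinarith

lemma energy_le_of_sq_le {f : ell2 m} {g h : NSpace m G} {c d : ℝ}
    (H : ∀ x y, (f x - f y) ^ 2 ≤ c * (fn g x - fn g y) ^ 2 + d * (fn h x - fn h y) ^ 2) :
    f ∈ (neumannForm m G).dom ∧ energy G f ≤ c * energy G (fn g) + d * energy G (fn h) := by
  have hs : Summable fun p => c * energyTerm G (fn g) (fn g) p + d * energyTerm G (fn h) (fn h) p :=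
    ((summable_energy g).mul_left c).add ((summable_energy h).mul_left d)
  have hf : Summable (energyTerm G f f) := Summable.of_nonneg_of_le
    (fun p => energyTerm_self_nonneg f p) (fun p => energyTerm_le_of_sq_le H p) hs
  refine ⟨hf, ?_⟩
  have h1 := hf.tsum_le_tsum (fun p => energyTerm_le_of_sq_le H p) hs
  rw [((summable_energy g).mul_left c).tsum_add ((summable_energy h).mul_left d), tsum_mul_left,
    tsum_mul_left] at h1
  simp only [energy]
  linarith

/-- The common source of new elements of `D(Q^(N))`: domination of values gives square summability,
domination of squared differences gives finite energy. -/
lemma exists_nspace {φ : X → ℝ} (g h : NSpace m G) {c d K : ℝ} (hb : ∀ x, |φ x| ≤ K * |fn g x|)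
    (H : ∀ x y, (φ x - φ y) ^ 2 ≤ c * (fn g x - fn g y) ^ 2 + d * (fn h x - fn h y) ^ 2) :
    ∃ u : NSpace m G, ∀ x, fn u x = φ x := by
  obtain ⟨f, hf⟩ := exists_ell2_of_le (fn g) K hb
  simp only [← hf] at H
  obtain ⟨u, hu⟩ := exists_fn_eq (energy_le_of_sq_le H).1
  exact ⟨u, fun x => by rw [hu, hf]⟩

lemma norm_sq_le_of_sq_le {u g h : NSpace m G} {c d : ℝ} (hc : 0 ≤ c) (hd : 0 ≤ d)
    (hb : ∀ x, |fn u x| ≤ |fn g x|)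
    (H : ∀ x y, (fn u x - fn u y) ^ 2 ≤ c * (fn g x - fn g y) ^ 2 + d * (fn h x - fn h y) ^ 2) :
    ‖u‖ ^ 2 ≤ (1 + c) * ‖g‖ ^ 2 + d * ‖h‖ ^ 2 := by
  have h1 := (energy_le_of_sq_le H).2
  have h2 := norm_sq_le_of_abs_le hb
  rw [neumann_norm_sq, neumann_norm_sq, neumann_norm_sq]
  have := energy_nonneg (G := G) (fn g)
  have := mul_nonneg hc (sq_nonneg ‖fn g‖)
  have := mul_nonneg hd (sq_nonneg ‖fn h‖)
  linarith

lemma abs_le_of_lipschitz {C : ℝ → ℝ} (hC : LipschitzWith 1 C) (h0 : C 0 = 0) (t : ℝ) :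
    |C t| ≤ |t| := by
  have := hC.dist_le_mul t 0
  simpa [Real.dist_eq, h0] using this

lemma sq_sub_le_of_lipschitz {C : ℝ → ℝ} (hC : LipschitzWith 1 C) (s t : ℝ) :
    (C s - C t) ^ 2 ≤ (s - t) ^ 2 := by
  have := hC.dist_le_mul s t
  rw [sq_le_sq]
  simpa [Real.dist_eq] using this

lemma exists_ncomp {C : ℝ → ℝ} (hC : LipschitzWith 1 C) (h0 : C 0 = 0) (f : NSpace m G) :
    ∃ u : NSpace m G, fn u = hC.compLp h0 (fn f) ∧ ‖u‖ ≤ ‖f‖ ∧ energy G (fn u) ≤ energy G (fn f) := by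
  have H : ∀ x y, ((hC.compLp h0 (fn f) : ell2 m) x - (hC.compLp h0 (fn f) : ell2 m) y) ^ 2 ≤
      1 * (fn f x - fn f y) ^ 2 + 0 * (fn f x - fn f y) ^ 2 := by
    intro x y
    rw [ell2_comp_apply, ell2_comp_apply, one_mul, zero_mul, add_zero]
    exact sq_sub_le_of_lipschitz hC _ _
  obtain ⟨h1, h2⟩ := energy_le_of_sq_le H
  obtain ⟨u, hu⟩ := exists_fn_eq h1
  rw [one_mul, zero_mul, add_zero] at h2
  have h3 : ‖fn u‖ ^ 2 ≤ ‖fn f‖ ^ 2 := norm_sq_le_of_abs_le fun x => by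
    rw [hu, ell2_comp_apply]; exact abs_le_of_lipschitz hC h0 _
  have h4 : energy G (fn u) ≤ energy G (fn f) := by rw [hu]; exact h2
  refine ⟨u, hu, ?_, h4⟩
  refine abs_le_of_sq_le_sq' ?_ (norm_nonneg _) |>.2
  rw [neumann_norm_sq, neumann_norm_sq]
  linarith

/-- The composition of `f ∈ D(Q^(N))` with a normal contraction. -/
def ncomp {C : ℝ → ℝ} (hC : LipschitzWith 1 C) (h0 : C 0 = 0) (f : NSpace m G) : NSpace m G :=
  (exists_ncomp hC h0 f).choose

section

variable {C : ℝ → ℝ} (hC : LipschitzWith 1 C) (h0 : C 0 = 0) (f : NSpace m G)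

lemma fn_ncomp : fn (ncomp hC h0 f) = hC.compLp h0 (fn f) := (exists_ncomp hC h0 f).choose_spec.1

lemma fn_ncomp_apply (x : X) : fn (ncomp hC h0 f) x = C (fn f x) := by
  rw [fn_ncomp, ell2_comp_apply]

lemma norm_ncomp_le : ‖ncomp hC h0 f‖ ≤ ‖f‖ := (exists_ncomp hC h0 f).choose_spec.2.1

lemma energy_ncomp_le : energy G (fn (ncomp hC h0 f)) ≤ energy G (fn f) :=
  (exists_ncomp hC h0 f).choose_spec.2.2

lemma mul_comp_ge_sq {C : ℝ → ℝ} (hC : LipschitzWith 1 C) (hm : Monotone C) (s t : ℝ) :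
    (C s - C t) * (C s - C t) ≤ (s - t) * (C s - C t) := by
  have h := sq_sub_le_of_lipschitz hC s t
  rw [sq_le_sq] at h
  rcases le_total t s with hst | hst
  · have h1 := hm hst
    rw [abs_of_nonneg (by linarith), abs_of_nonneg (by linarith)] at h
    exact mul_le_mul_of_nonneg_right h (by linarith)
  · have h1 := hm hst
    rw [abs_of_nonpos (by linarith), abs_of_nonpos (by linarith)] at h
    nlinarith

/-- For monotone `C` the inequality `(C s - C t)² ≤ (s - t)(C s - C t)` can be summed over edges and
vertices. If `f` is orthogonal to `C ∘ f`, it forces `C ∘ f = 0`; the maximum principle is proved in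
this way. -/
lemma norm_sq_ncomp_le_inner (hm : Monotone C) :
    ‖ncomp hC h0 f‖ ^ 2 ≤ inner ℝ f (ncomp hC h0 f) := by
  set u := ncomp hC h0 f with hu
  have hux : ∀ x, fn u x = C (fn f x) := fn_ncomp_apply hC h0 f
  rw [← real_inner_self_eq_norm_sq, neumann_inner, neumann_inner]
  have h1 : ∑' p, energyTerm G (fn u) (fn u) p ≤ ∑' p, energyTerm G (fn f) (fn u) p := by
    refine (summable_energy u).tsum_le_tsum (fun p => ?_)
      (summable_energyTerm G (summable_energy f) (summable_energy u))
    refine mul_le_mul_of_nonneg_left ?_ (G.nonneg _ _)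
    rw [hux, hux]
    exact mul_comp_ge_sq hC hm _ _
  have h2 : inner ℝ (fn u) (fn u) ≤ inner ℝ (fn f) (fn u) := by
    refine hasSum_le (fun x => ?_) (hasSum_inner (fn u) (fn u)) (hasSum_inner (fn f) (fn u))
    refine mul_le_mul_of_nonneg_left ?_ (weight_pos m x).le
    rw [hux]
    simpa [h0] using mul_comp_ge_sq hC hm (fn f x) 0
  linarith

end

lemma exists_mul {f g : NSpace m G} {K : ℝ} (hf : ∀ x, |fn f x| ≤ K) (hg : ∀ x, |fn g x| ≤ K) :
    ∃ u : NSpace m G, ∀ x, fn u x = fn f x * fn g x := by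
  refine exists_nspace f g (c := 2 * K ^ 2) (d := 2 * K ^ 2) (K := K) (fun x => ?_) (fun x y => ?_)
  · rw [abs_mul, mul_comm]
    exact mul_le_mul_of_nonneg_right (hg x) (abs_nonneg _)
  · have e : fn f x * fn g x - fn f y * fn g y =
        fn g x * (fn f x - fn f y) + fn f y * (fn g x - fn g y) := by ring
    have h1 : fn g x ^ 2 ≤ K ^ 2 := by rw [← sq_abs]; exact pow_le_pow_left₀ (abs_nonneg _) (hg x) 2
    have h2 : fn f y ^ 2 ≤ K ^ 2 := by rw [← sq_abs]; exact pow_le_pow_left₀ (abs_nonneg _) (hf y) 2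
    have h3 := mul_le_mul_of_nonneg_right h1 (sq_nonneg (fn f x - fn f y))
    have h4 := mul_le_mul_of_nonneg_right h2 (sq_nonneg (fn g x - fn g y))
    rw [e]
    have h5 := sq_nonneg (fn g x * (fn f x - fn f y) - fn f y * (fn g x - fn g y))
    nlinarith

/-- Lower semicontinuity of the energy: a Cauchy sequence converges in `ℓ²`, hence pointwise, and
each finite partial sum for `u n - f` is a limit of partial sums for `u n - u k`, which are
uniformly small. -/
instance : CompleteSpace (NSpace m G) := by
  refine Metric.complete_of_cauchySeq_tendsto fun u hu => ?_
  have hu' : CauchySeq fun n => fn (u n) := by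
    rw [Metric.cauchySeq_iff] at hu ⊢
    intro ε hε
    obtain ⟨N, hN⟩ := hu ε hε
    refine ⟨N, fun n hn k hk => ?_⟩
    refine lt_of_le_of_lt ?_ (hN n hn k hk)
    rw [dist_eq_norm, dist_eq_norm, ← map_sub]
    exact Form.norm_incl_le _ _
  obtain ⟨f, hf⟩ := cauchySeq_tendsto_of_complete hu'
  have key : ∀ ε : ℝ, 0 < ε → ∃ N, ∀ n ≥ N, ∃ v : NSpace m G, fn v = fn (u n) - f ∧
      ‖v‖ ^ 2 ≤ 2 * ε ^ 2 := by
    intro ε hε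
    obtain ⟨N, hN⟩ := Metric.cauchySeq_iff.1 hu ε hε
    refine ⟨N, fun n hn => ?_⟩
    have hb : ∀ k ≥ N, energy G (fn (u n - u k)) ≤ ε ^ 2 ∧ ‖fn (u n) - fn (u k)‖ ≤ ε := by
      intro k hk
      have h1 := hN n hn k hk
      rw [dist_eq_norm] at h1
      have h2 := neumann_norm_sq (u n - u k)
      have h3 : ‖u n - u k‖ ^ 2 ≤ ε ^ 2 := pow_le_pow_left₀ (norm_nonneg _) h1.le 2
      refine ⟨by nlinarith [sq_nonneg ‖fn (u n - u k)‖], ?_⟩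
      rw [← map_sub]
      exact (Form.norm_incl_le _ _).trans h1.le
    have hfin : ∀ s : Finset (X × X), ∑ p ∈ s, energyTerm G (fn (u n) - f : ell2 m)
        (fn (u n) - f : ell2 m) p ≤ 2 * ε ^ 2 := by
      intro s
      have hlim : Tendsto (fun k => ∑ p ∈ s, energyTerm G (fn (u n - u k)) (fn (u n - u k)) p)
          atTop (𝓝 (∑ p ∈ s, energyTerm G (fn (u n) - f : ell2 m) (fn (u n) - f : ell2 m) p)) := by
        refine tendsto_finsetSum _ fun p _ => ?_
        have h1 : ∀ x, Tendsto (fun k => fn (u n - u k) x) atTop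
            (𝓝 ((fn (u n) - f : ell2 m) x)) := by
          intro x
          simp only [fn_sub, ell2_sub_apply]
          exact tendsto_const_nhds.sub (tendsto_apply hf x)
        exact (((h1 p.1).sub (h1 p.2)).mul ((h1 p.1).sub (h1 p.2))).const_mul _
      refine le_of_tendsto hlim ?_
      filter_upwards [eventually_ge_atTop N] with k hk
      have h1 := (hb k hk).1
      have h2 := (summable_energy (u n - u k)).sum_le_tsum s
        fun p _ => energyTerm_self_nonneg _ p
      rw [energy] at h1
      linarith
    have hs : Summable (energyTerm G (fn (u n) - f : ell2 m) (fn (u n) - f : ell2 m)) :=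
      summable_of_sum_le (fun p => energyTerm_self_nonneg _ p) hfin
    have hl : ‖fn (u n) - f‖ ≤ ε := by
      refine le_of_tendsto (tendsto_const_nhds.sub hf).norm ?_
      filter_upwards [eventually_ge_atTop N] with k hk
      exact (hb k hk).2
    obtain ⟨v, hv⟩ := exists_fn_eq (G := G) (f := fn (u n) - f) hs
    refine ⟨v, hv, ?_⟩
    rw [neumann_norm_sq, hv, energy]
    have h1 := hs.tsum_le_of_sum_le hfin
    have h2 : ‖fn (u n) - f‖ ^ 2 ≤ ε ^ 2 := pow_le_pow_left₀ (norm_nonneg _) hl 2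
    linarith
  -- A single index suffices to see that the `ℓ²`-limit has finite energy: it is the difference of
  -- `u N` and an element of `D(Q^(N))`.
  obtain ⟨N, hN⟩ := key 1 one_pos
  obtain ⟨v, hv, -⟩ := hN N le_rfl
  have hfv : fn (u N - v) = f := by rw [map_sub, hv]; abel
  refine ⟨u N - v, ?_⟩
  rw [Metric.tendsto_atTop]
  intro ε hε
  obtain ⟨K, hK⟩ := key (ε / 2) (by positivity)
  refine ⟨K, fun n hn => ?_⟩
  obtain ⟨z, hz, hz'⟩ := hK n hn
  have e : u n - (u N - v) = z := (neumannForm m G).incl_injective (by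
    change fn (u n - (u N - v)) = fn z
    rw [map_sub, hfv, hz])
  rw [dist_eq_norm, e]
  refine lt_of_pow_lt_pow_left₀ 2 hε.le ?_
  nlinarith

end Neumann

/-! ### The Dirichlet subspace and its orthogonal complement, the harmonic functions -/

section DirichletSubspace

variable {X : Type*} [MeasurableSpace X] [DiscreteMeasurableSpace X] {m : X → Ioi (0 : ℝ)}
  {G : WGraph X}

open Classical in
-- Only pairs containing `x` contribute, and every edge at `x` occurs in both orientations. The
-- resulting factor `2` cancels the `1/2` of the energy.
lemma hasSum_energyTerm_delta {u : X → ℝ} {x : X} {s : ℝ}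
    (hs : HasSum (fun y => G.b x y * (u x - u y)) s) :
    HasSum (energyTerm G u (delta m x)) (2 * s) := by
  have h1 : HasSum (fun p : X × X => if p.1 = x then G.b x p.2 * (u x - u p.2) else 0) s := by
    refine (Function.Injective.hasSum_iff (g := fun y => (x, y))
      (fun a b h => (Prod.ext_iff.1 h).2) ?_).1 ?_
    · rintro ⟨a, b⟩ hp
      refine if_neg ?_
      rintro rfl
      exact hp ⟨b, rfl⟩
    · simpa [Function.comp_def] using hs
  have h2 : HasSum (fun p : X × X => if p.2 = x then G.b x p.1 * (u x - u p.1) else 0) s := by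
    refine (Function.Injective.hasSum_iff (g := fun y => (y, x))
      (fun a b h => (Prod.ext_iff.1 h).1) ?_).1 ?_
    · rintro ⟨a, b⟩ hp
      refine if_neg ?_
      rintro rfl
      exact hp ⟨a, rfl⟩
    · simpa [Function.comp_def] using hs
  rw [two_mul]
  refine (h1.add h2).congr_fun ?_
  rintro ⟨a, b⟩
  simp only [energyTerm, delta_apply]
  by_cases ha : a = x <;> by_cases hb : b = x
  · simp [ha, hb]
  · simp [ha, hb]
  · simp only [ha, hb, if_true, if_false, G.symm a x]; ring
  · simp [ha, hb]

lemma delta_mem_neumannDom (x : X) : delta m x ∈ (neumannForm m G).dom := by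
  classical
  refine (hasSum_energyTerm_delta (s := ∑' y, G.b x y * (delta m x x - delta m x y)) ?_).summable
  refine (Summable.of_nonneg_of_le (fun y => ?_) (fun y => ?_) (G.summable x)).hasSum
  · refine mul_nonneg (G.nonneg _ _) ?_
    simp only [delta_apply]; split_ifs <;> simp
  · refine mul_le_of_le_one_right (G.nonneg _ _) ?_
    simp only [delta_apply]; split_ifs <;> simp

lemma mem_of_delta_mem {D : Submodule ℝ (ell2 m)} (h : ∀ x, delta m x ∈ D) : finSupp m ≤ D := by
  intro f hf
  have hf' : (Function.support (f : X → ℝ)).Finite := hf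
  rw [eq_sum_delta (f := f) (s := hf'.toFinset) fun x hx => by simpa using hx]
  exact D.sum_mem fun x _ => D.smul_mem _ (h x)

lemma finSupp_le_neumannDom : finSupp m ≤ (neumannForm m G).dom :=
  mem_of_delta_mem delta_mem_neumannDom

variable (m G) in
/-- `D(Q^(D))` as a closed subspace of the Hilbert space `D(Q^(N))`. -/
def dirSub : Submodule ℝ (NSpace m G) :=
  ((finSupp m).comap (fn (m := m) (G := G) : NSpace m G →ₗ[ℝ] ell2 m)).topologicalClosure

lemma isClosed_dirSub : IsClosed (dirSub m G : Set (NSpace m G)) :=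
  Submodule.isClosed_topologicalClosure _

instance : CompleteSpace (dirSub m G) := isClosed_dirSub.completeSpace_coe

lemma mem_dirSub_of_finSupp {f : NSpace m G} (h : fn f ∈ finSupp m) : f ∈ dirSub m G :=
  Submodule.le_topologicalClosure _ h

lemma mem_dirSub_iff {f : NSpace m G} : f ∈ dirSub m G ↔ fn f ∈ (dirichletForm m G).dom := by
  have key : ∀ g : NSpace m G, (neumannForm m G).val₁ (fn f - fn g) =
      ENNReal.ofReal (dist f g ^ 2) := by
    intro g
    rw [← map_sub, dist_eq_norm]
    exact (neumannForm m G).val₁_eq ((neumannForm m G).toDom (f - g))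
  change f ∈ closure _ ↔ fn f ∈ (neumannForm m G).dom ∧ _
  rw [Metric.mem_closure_iff]
  constructor
  · intro h
    refine ⟨Form.incl_mem _ f, fun ε hε => ?_⟩
    by_cases hε' : ε = ⊤
    · exact ⟨0, Submodule.zero_mem _, Submodule.zero_mem _, by
        have := key 0
        rw [map_zero] at this
        rw [this, hε']; exact ENNReal.ofReal_lt_top⟩
    obtain ⟨g, hg, hd⟩ := h (√ε.toReal) (Real.sqrt_pos.2 (ENNReal.toReal_pos hε.ne' hε'))
    refine ⟨fn g, hg, Form.incl_mem _ g, ?_⟩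
    rw [key, ENNReal.ofReal_lt_iff_lt_toReal (sq_nonneg _) hε', ← Real.lt_sqrt dist_nonneg]
    exact hd
  · rintro ⟨-, h⟩ ε hε
    obtain ⟨g, hg, hg', hlt⟩ := h (ENNReal.ofReal (ε ^ 2)) (ENNReal.ofReal_pos.2 (by positivity))
    obtain ⟨v, rfl⟩ := exists_fn_eq hg'
    refine ⟨v, hg, ?_⟩
    rw [key, ENNReal.ofReal_lt_ofReal_iff (by positivity)] at hlt
    exact lt_of_pow_lt_pow_left₀ 2 hε.le hlt

lemma summable_row_sq (u : NSpace m G) (x : X) :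
    Summable fun y => G.b x y * (fn u x - fn u y) ^ 2 := by
  have := (summable_energy u).comp_injective (i := fun y => (x, y))
    fun a b h => (Prod.ext_iff.1 h).2
  simpa [Function.comp_def, energyTerm, sq] using this

lemma summable_row_abs (u : NSpace m G) (x : X) :
    Summable fun y => G.b x y * |fn u x - fn u y| := by
  refine Summable.of_nonneg_of_le (fun y => mul_nonneg (G.nonneg _ _) (abs_nonneg _)) (fun y => ?_)
    ((G.summable x).add (summable_row_sq u x))
  rw [← mul_one_add]
  refine mul_le_mul_of_nonneg_left ?_ (G.nonneg _ _)
  rw [← sq_abs]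
  nlinarith [sq_nonneg (|fn u x - fn u y| - 1), abs_nonneg (fn u x - fn u y)]

lemma summable_row (u : NSpace m G) (x : X) :
    Summable fun y => G.b x y * (fn u x - fn u y) := by
  refine (summable_row_abs u x).of_norm_bounded fun y => ?_
  rw [Real.norm_eq_abs, abs_mul, abs_of_nonneg (G.nonneg _ _)]

lemma summable_row_mul_abs (u : NSpace m G) (x : X) :
    Summable fun y => G.b x y * |fn u y| := by
  refine Summable.of_nonneg_of_le (fun y => mul_nonneg (G.nonneg _ _) (abs_nonneg _)) (fun y => ?_)
    (((G.summable x).mul_right |fn u x|).add (summable_row_abs u x))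
  rw [← mul_add]
  refine mul_le_mul_of_nonneg_left ?_ (G.nonneg _ _)
  have := abs_sub_abs_le_abs_sub (fn u y) (fn u x)
  rw [abs_sub_comm] at this
  linarith

/-- The indicator function of a vertex as an element of `D(Q^(N))`. -/
def ndelta (m : X → Ioi (0 : ℝ)) (G : WGraph X) (x : X) : NSpace m G :=
  (neumannForm m G).toSpace ⟨delta m x, delta_mem_neumannDom x⟩

lemma fn_ndelta (x : X) : fn (ndelta m G x) = delta m x := rfl

lemma ndelta_mem_dirSub (x : X) : ndelta m G x ∈ dirSub m G :=
  mem_dirSub_of_finSupp (delta_mem_finSupp x)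

lemma inner_ndelta (u : NSpace m G) (x : X) :
    inner ℝ u (ndelta m G x) = ∑' y, G.b x y * (fn u x - fn u y) + m x * fn u x := by
  rw [neumann_inner, fn_ndelta, inner_delta,
    (hasSum_energyTerm_delta (summable_row u x).hasSum).tsum_eq]
  ring

lemma mem_dirSub_orthogonal_iff {u : NSpace m G} :
    u ∈ (dirSub m G)ᗮ ↔ ∀ x, inner ℝ u (ndelta m G x) = 0 := by
  constructor
  · intro h x
    exact Submodule.inner_left_of_mem_orthogonal (ndelta_mem_dirSub x) h
  · intro h
    rw [dirSub, Submodule.orthogonal_closure, Submodule.mem_orthogonal']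
    intro g hg
    have hf' : (Function.support (fn g : X → ℝ)).Finite := hg
    have e : g = ∑ x ∈ hf'.toFinset, fn g x • ndelta m G x := by
      apply (neumannForm m G).incl_injective
      have := eq_sum_delta (f := fn g) (s := hf'.toFinset) fun x hx => by simpa using hx
      rw [map_sum]
      simp only [map_smul]
      exact this
    rw [e, inner_sum]
    refine Finset.sum_eq_zero fun x _ => ?_
    rw [real_inner_smul_right, h, mul_zero]

/-- The inner product of `u` with the indicator of `x` is `m x` times the value at `x` of `𝓛 u + u`,
and these indicators span a dense subspace of `D(Q^(D))`. The summability required of a harmonic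
function is automatic at finite energy. -/
lemma isHarmonic_iff {u : NSpace m G} : IsHarmonic m G (fn u) ↔ u ∈ (dirSub m G)ᗮ := by
  rw [mem_dirSub_orthogonal_iff]
  have e : ∀ x, (1 / (m x : ℝ)) * ∑' y, G.b x y * (fn u x - fn u y) + fn u x = 0 ↔
      inner ℝ u (ndelta m G x) = 0 := by
    intro x
    rw [inner_ndelta]
    have hm := weight_pos m x
    rw [← mul_right_inj' hm.ne', mul_zero]
    field_simp
  constructor
  · intro h x
    exact (e x).1 (h.2 x)
  · intro h
    exact ⟨summable_row_mul_abs u, fun x => (e x).2 (h x)⟩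

/-- The harmonic part of `f ∈ D(Q^(N))`: its orthogonal projection to the complement of
`D(Q^(D))`. -/
def harm : NSpace m G →L[ℝ] NSpace m G := (dirSub m G)ᗮ.starProjection

lemma harm_mem (f : NSpace m G) : harm f ∈ (dirSub m G)ᗮ := Submodule.starProjection_apply_mem _ f

lemma sub_harm_mem (f : NSpace m G) : f - harm f ∈ dirSub m G := by
  have := Submodule.sub_starProjection_mem_orthogonal (K := (dirSub m G)ᗮ) f
  rwa [Submodule.orthogonal_orthogonal] at this

lemma harm_eq {f u : NSpace m G} (hu : u ∈ (dirSub m G)ᗮ) (h : f - u ∈ dirSub m G) :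
    harm f = u := by
  have h1 : harm f - u ∈ (dirSub m G)ᗮ := Submodule.sub_mem _ (harm_mem f) hu
  have h2 : harm f - u ∈ dirSub m G := by
    have := Submodule.sub_mem _ h (sub_harm_mem f)
    simpa using this
  have := Submodule.inner_right_of_mem_orthogonal h2 h1
  exact sub_eq_zero.1 (inner_self_eq_zero.1 this)

lemma harm_eq_self {u : NSpace m G} (hu : u ∈ (dirSub m G)ᗮ) : harm u = u :=
  harm_eq hu (by simp)

lemma harm_eq_zero_iff {f : NSpace m G} : harm f = 0 ↔ f ∈ dirSub m G := by
  constructor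
  · intro h
    simpa [h] using sub_harm_mem f
  · intro h
    exact harm_eq (Submodule.zero_mem _) (by simpa using h)

lemma norm_harm_le (f : NSpace m G) : ‖harm f‖ ≤ ‖f‖ := Submodule.norm_starProjection_apply_le _ f

lemma mem_dirSub_of_bounded {u : ℕ → NSpace m G} {f : NSpace m G} {K : ℝ} (hK : ∀ n, ‖u n‖ ≤ K)
    (hmem : ∀ n, u n ∈ dirSub m G) (hu : Tendsto (fun n => fn (u n)) atTop (𝓝 (fn f))) :
    f ∈ dirSub m G :=
  mem_of_bounded_of_tendsto (neumannForm m G).incl_injective hK hu isClosed_dirSub hmem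

lemma sq_clamp_sub_clamp_le (t t' s s' : ℝ) :
    (max (-|s|) (min t |s|) - max (-|s'|) (min t' |s'|)) ^ 2 ≤
      1 * (t - t') ^ 2 + 1 * (s - s') ^ 2 := by
  have h1 := abs_max_sub_max_le_max (-|s|) (min t |s|) (-|s'|) (min t' |s'|)
  have h2 := abs_min_sub_min_le_max t |s| t' |s'|
  have h3 := abs_abs_sub_abs_le s s'
  have h4 : |(-|s|) - (-|s'|)| ≤ |s - s'| := by
    rw [neg_sub_neg, abs_sub_comm]; exact h3
  have h5 : |max (-|s|) (min t |s|) - max (-|s'|) (min t' |s'|)| ≤ max |t - t'| |s - s'| :=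
    h1.trans (max_le (h4.trans (le_max_right _ _))
      (h2.trans (max_le (le_max_left _ _) (h3.trans (le_max_right _ _)))))
  rw [← sq_abs, ← sq_abs (t - t'), ← sq_abs (s - s'), one_mul, one_mul]
  rcases le_max_iff.1 h5 with h | h
  · nlinarith [pow_le_pow_left₀ (abs_nonneg _) h 2, sq_nonneg |s - s'|]
  · nlinarith [pow_le_pow_left₀ (abs_nonneg _) h 2, sq_nonneg |t - t'|]

lemma abs_clamp_le (t s : ℝ) : |max (-|s|) (min t |s|)| ≤ |t| := by
  rcases le_total t |s| with h | h
  · rw [min_eq_left h]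
    rcases le_total (-|s|) t with h' | h'
    · rw [max_eq_right h']
    · rw [max_eq_left h', abs_neg, abs_abs]
      have := neg_abs_le t
      have h2 : t ≤ 0 := h'.trans (by simp)
      rw [abs_of_nonpos h2]; linarith
  · rw [min_eq_right h, max_eq_right (by linarith [abs_nonneg s]), abs_abs]
    exact h.trans (le_abs_self t)

/-- `D(Q^(D))` is an order ideal in `D(Q^(N))`. -/
lemma mem_dirSub_of_abs_le {f g : NSpace m G} (hg : g ∈ dirSub m G)
    (h : ∀ x, |fn f x| ≤ |fn g x|) : f ∈ dirSub m G := by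
  obtain ⟨u, hu, hlim⟩ := mem_closure_iff_seq_limit.1 (show g ∈ closure _ from hg)
  -- With finitely supported `u n → g`, the function `f` is clamped to the band `±|u n|`. The result
  -- is finitely supported, its norm is controlled by those of `f` and `u n`, and it converges
  -- pointwise to `f` clamped to `±|g|`, which is `f` itself. A bounded sequence is enough by weak
  -- closedness.
  have hex : ∀ n, ∃ v : NSpace m G, ∀ x, fn v x = max (-|fn (u n) x|) (min (fn f x) |fn (u n) x|) :=
    fun n => exists_nspace f (u n) (K := 1) (c := 1) (d := 1)
      (fun x => by rw [one_mul]; exact abs_clamp_le _ _)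
      (fun x y => sq_clamp_sub_clamp_le _ _ _ _)
  choose v hv using hex
  obtain ⟨K, hK⟩ := hlim.norm.bddAbove_range
  have hK' : ∀ n, ‖u n‖ ≤ K := fun n => hK ⟨n, rfl⟩
  refine mem_dirSub_of_bounded (u := v) (K := √(2 * ‖f‖ ^ 2 + K ^ 2)) (fun n => ?_) (fun n => ?_) ?_
  · refine Real.le_sqrt_of_sq_le ?_
    have h1 := norm_sq_le_of_sq_le (u := v n) (g := f) (h := u n) (c := 1) (d := 1) zero_le_one
      zero_le_one (fun x => by rw [hv]; exact abs_clamp_le _ _)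
      (fun x y => by rw [hv, hv]; exact sq_clamp_sub_clamp_le _ _ _ _)
    have h2 := pow_le_pow_left₀ (norm_nonneg _) (hK' n) 2
    linarith
  · refine mem_dirSub_of_finSupp ?_
    have hun : (Function.support (fn (u n) : X → ℝ)).Finite := hu n
    refine hun.subset fun x hx => ?_
    by_contra hc
    have hc' : fn (u n) x = 0 := by simpa using hc
    refine hx ?_
    rw [hv, hc']
    rcases le_total (fn f x) 0 with h | h <;> simp [h]
  · refine ell2_tendsto_of_dominated (g := fn f) (fun n x => ?_) (fun x => le_rfl) (fun x => ?_)
    · rw [hv]; exact abs_clamp_le _ _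
    · have h1 : Tendsto (fun n => fn (u n) x) atTop (𝓝 (fn g x)) :=
        tendsto_apply ((fn (m := m) (G := G)).continuous.continuousAt.tendsto.comp hlim) x
      have h2 : Tendsto (fun n => max (-|fn (u n) x|) (min (fn f x) |fn (u n) x|)) atTop
          (𝓝 (max (-|fn g x|) (min (fn f x) |fn g x|))) :=
        h1.abs.neg.max (tendsto_const_nhds.min h1.abs)
      have h3 := abs_le.1 (h x)
      rw [min_eq_left h3.2, max_eq_right h3.1] at h2
      exact h2.congr fun n => (hv n x).symm

lemma ncomp_mem_dirSub {C : ℝ → ℝ} (hC : LipschitzWith 1 C) (h0 : C 0 = 0) {f : NSpace m G}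
    (hf : f ∈ dirSub m G) : ncomp hC h0 f ∈ dirSub m G :=
  mem_dirSub_of_abs_le hf fun x => by rw [fn_ncomp_apply]; exact abs_le_of_lipschitz hC h0 _

end DirichletSubspace

/-! ### Dirichlet forms extending `Q^(D)` -/

lemma Form.IsMarkovian.comp_mem {α : Type*} [MeasurableSpace α] {μ : Measure α}
    {Q : Form (Lp ℝ 2 μ)} (h : Q.IsMarkovian) {C : ℝ → ℝ} (hC : LipschitzWith 1 C) (h0 : C 0 = 0)
    (f : Q.dom) : hC.compLp h0 (f : Lp ℝ 2 μ) ∈ Q.dom := by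
  rw [Q.mem_dom_iff]
  exact ((h C hC h0 f).trans_lt (lt_top_iff_ne_top.2 (Q.mem_dom_iff.1 f.2))).ne

/-- The composition of a function in the domain of a Markovian form with a normal contraction. -/
def Form.IsMarkovian.comp {α : Type*} [MeasurableSpace α] {μ : Measure α}
    {Q : Form (Lp ℝ 2 μ)} (h : Q.IsMarkovian) {C : ℝ → ℝ} (hC : LipschitzWith 1 C) (h0 : C 0 = 0)
    (f : Q.dom) : Q.dom := ⟨hC.compLp h0 (f : Lp ℝ 2 μ), h.comp_mem hC h0 f⟩

lemma Form.IsMarkovian.bilin_comp_le {α : Type*} [MeasurableSpace α] {μ : Measure α}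
    {Q : Form (Lp ℝ 2 μ)} (h : Q.IsMarkovian) {C : ℝ → ℝ} (hC : LipschitzWith 1 C) (h0 : C 0 = 0)
    (f : Q.dom) : Q.bilin (h.comp hC h0 f) (h.comp hC h0 f) ≤ Q.bilin f f := by
  have : Q.val (h.comp hC h0 f) ≤ Q.val f := h C hC h0 f
  rw [Q.val_of_mem f, Q.val_of_mem (h.comp hC h0 f)] at this
  exact (ENNReal.ofReal_le_ofReal_iff (Q.nonneg f)).1 this

lemma Form.IsMarkovian.scale {α : Type*} [MeasurableSpace α] {μ : Measure α}
    {Q : Form (Lp ℝ 2 μ)} (h : Q.IsMarkovian) (s : ℝ≥0) : (Q.scale s).IsMarkovian := by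
  intro C hC h0 f
  by_cases hf : f ∈ Q.dom
  · rw [(Q.scale s).val_of_mem ⟨f, hf⟩, (Q.scale s).val_of_mem ⟨_, h.comp_mem hC h0 ⟨f, hf⟩⟩]
    refine ENNReal.ofReal_le_ofReal ?_
    exact mul_le_mul_of_nonneg_left (h.bilin_comp_le hC h0 ⟨f, hf⟩) s.2
  · rw [(Q.scale s).val_of_notMem hf]
    exact le_top

/-! ### Resolvents of Markovian forms and their kernels. -/

section Resolvent

variable {X : Type*} [MeasurableSpace X] [DiscreteMeasurableSpace X] {m : X → Ioi (0 : ℝ)}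

/-- The resolvent `(1 + L)⁻¹` of the operator `L` associated with a closed form. -/
def Form.resolvent (R : Form (ell2 m)) [CompleteSpace R.Space] : ell2 m →L[ℝ] ell2 m :=
  R.incl ∘L ContinuousLinearMap.adjoint R.incl

variable (R : Form (ell2 m)) [CompleteSpace R.Space]

lemma Form.resolvent_mem (f : ell2 m) : R.resolvent f ∈ R.dom := R.incl_mem _

lemma Form.inner_resolvent_comm (f g : ell2 m) :
    inner ℝ (R.resolvent f) g = inner ℝ f (R.resolvent g) := by
  rw [Form.resolvent, ContinuousLinearMap.comp_apply, ContinuousLinearMap.comp_apply,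
    ← ContinuousLinearMap.adjoint_inner_left, ← ContinuousLinearMap.adjoint_inner_right]

lemma Form.bilin_resolvent (f : ell2 m) (g : R.dom) :
    R.bilin ⟨R.resolvent f, R.resolvent_mem f⟩ g = inner ℝ (f - R.resolvent f) (g : ell2 m) := by
  have h1 := R.inner_def ⟨R.resolvent f, R.resolvent_mem f⟩ g
  have h2 : inner ℝ (R.toSpace ⟨R.resolvent f, R.resolvent_mem f⟩) (R.toSpace g) =
      inner ℝ f (g : ell2 m) := ContinuousLinearMap.adjoint_inner_left R.incl (R.toSpace g) f
  rw [inner_sub_left]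
  dsimp only at h1
  linarith

variable {R}

/-- The resolvent of `f` is the unique minimizer of `u ↦ R(u) + ‖u - f‖²`. If `C` fixes the values
of `f`, composing the minimizer with `C` increases neither term, so it gives the minimizer again. -/
lemma Form.IsMarkovian.comp_resolvent (hR : R.IsMarkovian) {C : ℝ → ℝ} (hC : LipschitzWith 1 C)
    (h0 : C 0 = 0) {f : ell2 m} (hf : ∀ x, C (f x) = f x) :
    (hC.compLp h0 (R.resolvent f) : ell2 m) = R.resolvent f := by
  set v : R.dom := ⟨R.resolvent f, R.resolvent_mem f⟩ with hv
  set u : R.dom := hR.comp hC h0 v with hu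
  have h1 : R.bilin u u ≤ R.bilin v v := hR.bilin_comp_le hC h0 v
  have h2 : ‖(u : ell2 m) - f‖ ^ 2 ≤ ‖(v : ell2 m) - f‖ ^ 2 := by
    refine norm_sq_le_of_abs_le fun x => ?_
    rw [ell2_sub_apply, ell2_sub_apply]
    have e : (u : ell2 m) x = C ((v : ell2 m) x) := ell2_comp_apply hC h0 (v : ell2 m) x
    rw [e]
    nth_rewrite 1 [← hf x]
    exact sq_le_sq.1 (sq_sub_le_of_lipschitz hC _ _)
  have h3 := R.bilin_resolvent f u
  have h4 := R.bilin_resolvent f v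
  have h5 : R.bilin (u - v) (u - v) = R.bilin u u - 2 * R.bilin v u + R.bilin v v := by
    simp only [map_sub, LinearMap.sub_apply]
    rw [R.symm u v]; ring
  have h6 := R.nonneg (u - v)
  have e1 : inner ℝ (f - R.resolvent f) (u : ell2 m) =
      inner ℝ f (u : ell2 m) - inner ℝ (v : ell2 m) (u : ell2 m) := inner_sub_left _ _ _
  have e2 : inner ℝ (f - R.resolvent f) (v : ell2 m) =
      inner ℝ f (v : ell2 m) - ‖(v : ell2 m)‖ ^ 2 := by
    rw [inner_sub_left, ← real_inner_self_eq_norm_sq]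
  have h3' : R.bilin v u = _ := h3
  have h4' : R.bilin v v = _ := h4
  rw [e1] at h3'
  rw [e2] at h4'
  rw [@norm_sub_sq_real, @norm_sub_sq_real, real_inner_comm f, real_inner_comm f] at h2
  have h7 : ‖(u : ell2 m) - v‖ ^ 2 ≤ 0 := by
    rw [@norm_sub_sq_real, real_inner_comm (v : ell2 m)]
    linarith
  have h8 : ‖(u : ell2 m) - v‖ = 0 := by
    have := norm_nonneg ((u : ell2 m) - v)
    nlinarith
  exact sub_eq_zero.1 (norm_eq_zero.1 h8)

lemma lipschitz_unitClamp : LipschitzWith 1 fun t : ℝ => max 0 (min t 1) := by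
  refine LipschitzWith.of_dist_le_mul fun s t => ?_
  rw [Real.dist_eq, Real.dist_eq, NNReal.coe_one, one_mul]
  refine (abs_max_sub_max_le_max _ _ _ _).trans (max_le (by simp) ?_)
  exact (abs_min_sub_min_le_max _ _ _ _).trans (max_le le_rfl (by simp))

lemma Form.IsMarkovian.resolvent_mem_Icc (hR : R.IsMarkovian) {f : ell2 m}
    (hf : ∀ x, f x ∈ Icc (0 : ℝ) 1) (x : X) : R.resolvent f x ∈ Icc (0 : ℝ) 1 := by
  have h := hR.comp_resolvent lipschitz_unitClamp (by simp) (f := f) fun x => by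
    rw [min_eq_left (hf x).2, max_eq_right (hf x).1]
  rw [← h, ell2_comp_apply]
  exact ⟨le_max_left _ _, max_le zero_le_one (min_le_right _ _)⟩

variable (R) in
/-- The kernel of the resolvent. -/
def Form.kernel (x y : X) : ℝ := inner ℝ (R.resolvent (delta m x)) (delta m y)

lemma Form.kernel_symm (x y : X) : R.kernel x y = R.kernel y x := by
  rw [Form.kernel, Form.kernel, R.inner_resolvent_comm, real_inner_comm]

lemma Form.IsMarkovian.kernel_nonneg (hR : R.IsMarkovian) (x y : X) : 0 ≤ R.kernel x y := by
  classical
  rw [Form.kernel, inner_delta]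
  refine mul_nonneg (weight_pos m y).le (hR.resolvent_mem_Icc (fun z => ?_) y).1
  rw [delta_apply]
  split_ifs <;> simp

/-- By symmetry the sum is `m x` times the value at `x` of the resolvent of the indicator of `s`,
which is at most `1`. This is the nonnegativity of the killing term below. -/
lemma Form.IsMarkovian.sum_kernel_le (hR : R.IsMarkovian) (x : X) (s : Finset X) :
    ∑ y ∈ s, R.kernel x y ≤ m x := by
  classical
  obtain ⟨e, he⟩ : ∃ e : ell2 m, ∀ y, e y = if y ∈ s then 1 else 0 :=
    exists_ell2 (summable_of_ne_finset_zero (s := s) fun y hy => by simp [hy])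
  have h1 : ∑ y ∈ s, R.kernel x y = inner ℝ (R.resolvent (delta m x)) e := by
    rw [eq_sum_delta (f := e) (s := s) fun y hy => by simp [he, hy], inner_sum]
    refine Finset.sum_congr rfl fun y hy => ?_
    rw [he, if_pos hy, one_smul, Form.kernel]
  rw [h1, R.inner_resolvent_comm, real_inner_comm, inner_delta]
  refine mul_le_of_le_one_right (weight_pos m x).le (hR.resolvent_mem_Icc (fun z => ?_) x).2
  rw [he]
  split_ifs <;> simp

/-- Beurling–Deny decomposition of the approximating form: a graph energy with weights `R.kernel`
plus a killing term, obtained from `2ab = a² + b² - (a - b)²` and the symmetry of the kernel. -/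
lemma Form.inner_sub_resolvent_of_finite {f : ell2 m} {s : Finset X} (hs : ∀ x ∉ s, f x = 0) :
    inner ℝ (f - R.resolvent f) f =
      1 / 2 * ∑ p ∈ s ×ˢ s, R.kernel p.1 p.2 * (f p.1 - f p.2) ^ 2 +
        ∑ x ∈ s, (m x - ∑ y ∈ s, R.kernel x y) * f x ^ 2 := by
  have e := eq_sum_delta hs
  have h1 : inner ℝ f f = ∑ x ∈ s, m x * f x ^ 2 := by
    nth_rewrite 2 [e]
    rw [inner_sum]
    refine Finset.sum_congr rfl fun x _ => ?_
    rw [real_inner_smul_right, inner_delta]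
    ring
  have h2 : inner ℝ (R.resolvent f) f = ∑ x ∈ s, ∑ y ∈ s, R.kernel x y * (f x * f y) := by
    nth_rewrite 1 [e]
    rw [map_sum, sum_inner]
    refine Finset.sum_congr rfl fun x _ => ?_
    nth_rewrite 2 [e]
    rw [inner_sum]
    refine Finset.sum_congr rfl fun y _ => ?_
    rw [map_smul, real_inner_smul_left, real_inner_smul_right, Form.kernel]
    ring
  rw [inner_sub_left, h1, h2, Finset.sum_product]
  have h3 : ∑ x ∈ s, ∑ y ∈ s, R.kernel x y * (f x - f y) ^ 2 =
      2 * ∑ x ∈ s, (∑ y ∈ s, R.kernel x y) * f x ^ 2 -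
        2 * ∑ x ∈ s, ∑ y ∈ s, R.kernel x y * (f x * f y) := by
    have h4 : ∑ x ∈ s, ∑ y ∈ s, R.kernel x y * f y ^ 2 =
        ∑ x ∈ s, (∑ y ∈ s, R.kernel x y) * f x ^ 2 := by
      rw [Finset.sum_comm]
      refine Finset.sum_congr rfl fun x _ => ?_
      rw [Finset.sum_mul]
      exact Finset.sum_congr rfl fun y _ => by rw [R.kernel_symm]
    have h5 : ∀ x ∈ s, ∑ y ∈ s, R.kernel x y * (f x - f y) ^ 2 =
        (∑ y ∈ s, R.kernel x y) * f x ^ 2 + ∑ y ∈ s, R.kernel x y * f y ^ 2 -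
          2 * ∑ y ∈ s, R.kernel x y * (f x * f y) := by
      intro x _
      rw [Finset.sum_mul, Finset.mul_sum, ← Finset.sum_add_distrib, ← Finset.sum_sub_distrib]
      exact Finset.sum_congr rfl fun y _ => by ring
    rw [Finset.sum_congr rfl h5, Finset.sum_sub_distrib, Finset.sum_add_distrib, h4,
      ← Finset.mul_sum]
    ring
  rw [h3]
  simp only [sub_mul, Finset.sum_sub_distrib]
  ring

/-- For finitely supported functions the edges outside `t` and the killing term have nonnegative
coefficients, and each such contribution decreases under a contraction. The general case follows by
cutting off `f`, since both sides are continuous on `ℓ²`. -/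
lemma Form.IsMarkovian.inner_sub_resolvent_comp_le (hR : R.IsMarkovian) {C : ℝ → ℝ}
    (hC : LipschitzWith 1 C) (h0 : C 0 = 0) (f : ell2 m) (t : Finset (X × X)) :
    inner ℝ ((hC.compLp h0 f : ell2 m) - R.resolvent (hC.compLp h0 f)) (hC.compLp h0 f : ell2 m) -
        1 / 2 * ∑ p ∈ t, R.kernel p.1 p.2 * (C (f p.1) - C (f p.2)) ^ 2 ≤
      inner ℝ (f - R.resolvent f) f -
        1 / 2 * ∑ p ∈ t, R.kernel p.1 p.2 * (f p.1 - f p.2) ^ 2 := by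
  classical
  have hcont : Continuous fun g : ell2 m => inner ℝ (g - R.resolvent g) g := by fun_prop
  have hCcont : Continuous fun g : ell2 m => (hC.compLp h0 g : ell2 m) :=
    hC.continuous_compLp h0
  refine le_of_tendsto_of_tendsto (b := (atTop : Filter (Finset X)))
    (((((hcont.comp hCcont).tendsto f).comp (tendsto_cut f)).sub_const _))
    ((((hcont.tendsto f).comp (tendsto_cut f)).sub_const _)) ?_
  filter_upwards [eventually_ge_atTop (t.image Prod.fst ∪ t.image Prod.snd)] with s hs
  have ht : t ⊆ s ×ˢ s := by
    intro p hp
    exact Finset.mem_product.2 ⟨hs (Finset.mem_union_left _ (Finset.mem_image_of_mem _ hp)),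
      hs (Finset.mem_union_right _ (Finset.mem_image_of_mem _ hp))⟩
  set g := cut f (s : Set X) with hg
  have hgx : ∀ x ∈ s, g x = f x := fun x hx => by rw [hg, cut_apply, if_pos (by simpa using hx)]
  have hg0 : ∀ x ∉ s, g x = 0 := fun x hx => by rw [hg, cut_apply, if_neg (by simpa using hx)]
  have hC0 : ∀ x ∉ s, (hC.compLp h0 g : ell2 m) x = 0 := fun x hx => by
    rw [ell2_comp_apply, hg0 x hx, h0]
  simp only [Function.comp_apply]
  rw [R.inner_sub_resolvent_of_finite hg0, R.inner_sub_resolvent_of_finite hC0]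
  have h1 : ∑ x ∈ s, (m x - ∑ y ∈ s, R.kernel x y) * (hC.compLp h0 g : ell2 m) x ^ 2 ≤
      ∑ x ∈ s, (m x - ∑ y ∈ s, R.kernel x y) * g x ^ 2 := by
    refine Finset.sum_le_sum fun x _ => ?_
    refine mul_le_mul_of_nonneg_left ?_ (sub_nonneg.2 (hR.sum_kernel_le x s))
    rw [ell2_comp_apply]
    exact sq_le_sq.2 (abs_le_of_lipschitz hC h0 _)
  have h2 : ∑ p ∈ t, R.kernel p.1 p.2 * ((f p.1 - f p.2) ^ 2 - (C (f p.1) - C (f p.2)) ^ 2) ≤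
      ∑ p ∈ s ×ˢ s, R.kernel p.1 p.2 * ((f p.1 - f p.2) ^ 2 - (C (f p.1) - C (f p.2)) ^ 2) := by
    refine Finset.sum_le_sum_of_subset_of_nonneg ht fun p _ _ => ?_
    exact mul_nonneg (hR.kernel_nonneg _ _) (sub_nonneg.2 (sq_sub_le_of_lipschitz hC _ _))
  have h3 : ∑ p ∈ s ×ˢ s, R.kernel p.1 p.2 * (g p.1 - g p.2) ^ 2 =
      ∑ p ∈ s ×ˢ s, R.kernel p.1 p.2 * (f p.1 - f p.2) ^ 2 := by
    refine Finset.sum_congr rfl fun p hp => ?_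
    rw [Finset.mem_product] at hp
    rw [hgx _ hp.1, hgx _ hp.2]
  have h4 : ∑ p ∈ s ×ˢ s, R.kernel p.1 p.2 *
      ((hC.compLp h0 g : ell2 m) p.1 - (hC.compLp h0 g : ell2 m) p.2) ^ 2 =
      ∑ p ∈ s ×ˢ s, R.kernel p.1 p.2 * (C (f p.1) - C (f p.2)) ^ 2 := by
    refine Finset.sum_congr rfl fun p hp => ?_
    rw [Finset.mem_product] at hp
    rw [ell2_comp_apply, ell2_comp_apply, hgx _ hp.1, hgx _ hp.2]
  rw [h3, h4]
  simp only [mul_sub, Finset.sum_sub_distrib] at h2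
  linarith

end Resolvent

/-! ### Approximation of a form by its resolvents, and the Markov property of `Q - Q^(N)`. -/

section Approximation

variable {X : Type*} [MeasurableSpace X] [DiscreteMeasurableSpace X] {m : X → Ioi (0 : ℝ)}
  {Q : Form (ell2 m)}

/-- The parameters `1/(n+1)` of the resolvents used in the approximation of a form. -/
def approxParam (n : ℕ) : ℝ≥0 := 1 / (n + 1)

lemma approxParam_pos (n : ℕ) : 0 < approxParam n := by unfold approxParam; positivity

lemma tendsto_approxParam : Tendsto (fun n => (approxParam n : ℝ)) atTop (𝓝 0) := by
  simpa [approxParam] using tendsto_one_div_add_atTop_nhds_zero_nat (𝕜 := ℝ)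

lemma approxParam_le_one (n : ℕ) : (approxParam n : ℝ) ≤ 1 := by
  simp only [approxParam, NNReal.coe_div, NNReal.coe_one, NNReal.coe_add, NNReal.coe_natCast]
  rw [div_le_one (by positivity)]
  have : (0 : ℝ) ≤ n := Nat.cast_nonneg n
  linarith

/-- The forms `Q^{(s)}(f,g) = s⁻¹ ⟪f - (1 + s L)⁻¹ f, g⟫` converge to `Q`. -/
lemma Form.IsClosed.tendsto_approx (hQ : Q.IsClosed) (f g : Q.dom) :
    Tendsto (fun n => (approxParam n : ℝ)⁻¹ *
      haveI := ((Q.scale (approxParam n)).isClosed_iff).1 (hQ.scale (approxParam_pos n))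
      inner ℝ ((f : ell2 m) - (Q.scale (approxParam n)).resolvent f) (g : ell2 m))
      atTop (𝓝 (Q.bilin f g)) := by
  have hc : ∀ n, CompleteSpace (Q.scale (approxParam n)).Space :=
    fun n => ((Q.scale (approxParam n)).isClosed_iff).1 (hQ.scale (approxParam_pos n))
  have hQc : CompleteSpace Q.Space := Q.isClosed_iff.1 hQ
  set P : ℕ → Q.dom := fun n => ⟨(Q.scale (approxParam n)).resolvent f,
    (Q.scale (approxParam n)).resolvent_mem f⟩ with hP
  have hs : ∀ n, (0 : ℝ) < approxParam n := fun n => approxParam_pos n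
  have key : ∀ n (h : Q.dom), inner ℝ ((f : ell2 m) - P n) (h : ell2 m) =
      approxParam n * Q.bilin (P n) h :=
    fun n h => ((Q.scale (approxParam n)).bilin_resolvent f h).symm
  -- Testing the resolvent equation with `f - P n` gives `Q(P n) ≤ Q(P n, f)`, hence `Q(P n) ≤
  -- Q(f)`, and convergence `P n → f` in `ℓ²` at rate `√s`. Together these give weak convergence in
  -- the form space.
  have hdiff : ∀ n, ‖(f : ell2 m) - P n‖ ^ 2 =
      approxParam n * (Q.bilin (P n) f - Q.bilin (P n) (P n)) := by
    intro n
    rw [mul_sub, ← key, ← key, ← inner_sub_right, real_inner_self_eq_norm_sq]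
  have hCS : ∀ n, 2 * Q.bilin (P n) f ≤ Q.bilin (P n) (P n) + Q.bilin f f := by
    intro n
    have := Q.nonneg (P n - f)
    simp only [map_sub, LinearMap.sub_apply] at this
    rw [Q.symm f (P n)] at this
    linarith
  have hb : ∀ n, Q.bilin (P n) (P n) ≤ Q.bilin f f := by
    intro n
    have h1 : 0 ≤ Q.bilin (P n) f - Q.bilin (P n) (P n) := by
      have := hdiff n
      by_contra hc
      push Not at hc
      have := mul_neg_of_pos_of_neg (hs n) hc
      nlinarith [sq_nonneg ‖(f : ell2 m) - P n‖]
    linarith [hCS n]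
  have hd : ∀ n, ‖(f : ell2 m) - P n‖ ^ 2 ≤ approxParam n * Q.bilin f f := by
    intro n
    rw [hdiff]
    refine mul_le_mul_of_nonneg_left ?_ (hs n).le
    linarith [hCS n, hb n, Q.nonneg (P n)]
  have hlim : Tendsto (fun n => ((P n : Q.dom) : ell2 m)) atTop (𝓝 (f : ell2 m)) := by
    rw [tendsto_iff_norm_sub_tendsto_zero]
    have h1 : Tendsto (fun n => √(approxParam n * Q.bilin f f)) atTop (𝓝 0) := by
      simpa using (tendsto_approxParam.mul_const (Q.bilin f f)).sqrt
    refine squeeze_zero (fun _ => norm_nonneg _) (fun n => ?_) h1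
    rw [norm_sub_rev]
    exact Real.le_sqrt_of_sq_le (hd n)
  have hbound : ∀ n, ‖Q.toSpace (P n)‖ ≤
      √(Q.bilin f f + (2 * ‖(f : ell2 m)‖ ^ 2 + 2 * Q.bilin f f)) := by
    intro n
    refine Real.le_sqrt_of_sq_le ?_
    rw [Q.norm_sq]
    refine add_le_add (hb n) ?_
    have h1 : ‖((P n : Q.dom) : ell2 m)‖ ≤ ‖(f : ell2 m)‖ + ‖(f : ell2 m) - P n‖ := by
      have := norm_sub_le (f : ell2 m) ((f : ell2 m) - P n)
      simpa using this
    have h2 : ‖(f : ell2 m) - P n‖ ^ 2 ≤ Q.bilin f f :=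
      (hd n).trans (mul_le_of_le_one_left (Q.nonneg f) (approxParam_le_one n))
    nlinarith [sq_nonneg (‖(f : ell2 m)‖ - ‖(f : ell2 m) - P n‖),
      norm_nonneg ((P n : Q.dom) : ell2 m)]
  have hw := tendsto_inner_of_bounded Q.incl_injective hbound (f := Q.toSpace f) hlim (Q.toSpace g)
  have hi : Tendsto (fun n => inner ℝ ((P n : Q.dom) : ell2 m) (g : ell2 m)) atTop
      (𝓝 (inner ℝ (f : ell2 m) (g : ell2 m))) := hlim.inner tendsto_const_nhds
  have := hw.sub hi
  simp only [Q.inner_def, add_sub_cancel_right] at this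
  refine this.congr fun n => ?_
  have := key n g
  change inner ℝ ((f : ell2 m) - (Q.scale (approxParam n)).resolvent f) (g : ell2 m) = _ at this
  rw [this, inv_mul_cancel_left₀ (hs n).ne']

variable {G : WGraph X}

lemma dirichletForm_bilin (f g : (dirichletForm m G).dom) :
    (dirichletForm m G).bilin f g = 1 / 2 * ∑' p, energyTerm G (f : ell2 m) (g : ell2 m) p := rfl

lemma delta_mem_dirichletDom (x : X) : delta m x ∈ (dirichletForm m G).dom := by
  rw [← fn_ndelta (G := G)]
  exact (mem_dirSub_iff (f := ndelta m G x)).1 (ndelta_mem_dirSub x)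

/-- The off-diagonal entries of `Q` are the edge weights. This determines the graph and identifies
the limits of the rescaled resolvent kernels. -/
lemma bilin_delta_of_extends (h : Q.Extends (dirichletForm m G)) (hd : finSupp m ≤ Q.dom)
    {x y : X} (hxy : x ≠ y) :
    Q.bilin ⟨delta m x, hd (delta_mem_finSupp x)⟩ ⟨delta m y, hd (delta_mem_finSupp y)⟩ =
      -G.b x y := by
  obtain ⟨hle, hb⟩ := h
  have h1 : Q.bilin ⟨delta m y, hd (delta_mem_finSupp y)⟩ ⟨delta m x, hd (delta_mem_finSupp x)⟩ =
      (dirichletForm m G).bilin ⟨_, delta_mem_dirichletDom y⟩ ⟨_, delta_mem_dirichletDom x⟩ :=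
    hb ⟨_, delta_mem_dirichletDom y⟩ ⟨_, delta_mem_dirichletDom x⟩
  rw [dirichletForm_bilin] at h1
  have hs : HasSum (fun z => G.b x z * (delta m y x - delta m y z)) (-G.b x y) := by
    have := hasSum_single (f := fun z => G.b x z * (delta m y x - delta m y z)) y fun z hz => by
      rw [delta_of_ne hz, delta_of_ne hxy]; ring
    have e : G.b x y * (delta m y x - delta m y y) = -G.b x y := by
      rw [delta_of_ne hxy, delta_self]; ring
    rwa [e] at this
  rw [Q.symm, h1, (hasSum_energyTerm_delta hs).tsum_eq]
  ring

lemma graph_unique {G' : WGraph X} (hd : finSupp m ≤ Q.dom) (h : Q.Extends (dirichletForm m G))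
    (h' : Q.Extends (dirichletForm m G')) : G = G' := by
  have hb : G.b = G'.b := by
    funext x y
    by_cases hxy : x = y
    · rw [hxy, G.diag, G'.diag]
    · have := (bilin_delta_of_extends h hd hxy).symm.trans (bilin_delta_of_extends h' hd hxy)
      linarith
  cases G; cases G'; cases hb; rfl

/-- The difference of a Dirichlet form extending `Q^(D)` and finite parts of the energy is
Markovian. -/
lemma sub_sum_energyTerm_comp_le (hQ : Q.IsClosed) (hM : Q.IsMarkovian) (hd : finSupp m ≤ Q.dom)
    (h : Q.Extends (dirichletForm m G)) {C : ℝ → ℝ} (hC : LipschitzWith 1 C) (h0 : C 0 = 0)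
    (f : Q.dom) (t : Finset (X × X)) :
    Q.bilin (hM.comp hC h0 f) (hM.comp hC h0 f) -
        1 / 2 * ∑ p ∈ t, energyTerm G (fun x => C ((f : ell2 m) x)) (fun x => C ((f : ell2 m) x)) p ≤
      Q.bilin f f - 1 / 2 * ∑ p ∈ t, energyTerm G (f : ell2 m) (f : ell2 m) p := by
  have hc : ∀ n, CompleteSpace (Q.scale (approxParam n)).Space :=
    fun n => ((Q.scale (approxParam n)).isClosed_iff).1 (hQ.scale (approxParam_pos n))
  -- For `x ≠ y` the indicators are orthogonal in `ℓ²`, so the approximating form at this pair is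
  -- `-s⁻¹` times the kernel.
  have hker : ∀ x y, x ≠ y → Tendsto
      (fun n => (approxParam n : ℝ)⁻¹ * (Q.scale (approxParam n)).kernel x y) atTop
      (𝓝 (G.b x y)) := by
    intro x y hxy
    have h1 := (hQ.tendsto_approx ⟨delta m x, hd (delta_mem_finSupp x)⟩
      ⟨delta m y, hd (delta_mem_finSupp y)⟩).neg
    rw [bilin_delta_of_extends h hd hxy, neg_neg] at h1
    refine h1.congr fun n => ?_
    dsimp only
    rw [inner_sub_left, inner_delta, delta_of_ne (Ne.symm hxy), Form.kernel]
    ring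
  have hsum : ∀ u : X → ℝ, Tendsto (fun n => (approxParam n : ℝ)⁻¹ *
      (1 / 2 * ∑ p ∈ t, (Q.scale (approxParam n)).kernel p.1 p.2 * (u p.1 - u p.2) ^ 2)) atTop
      (𝓝 (1 / 2 * ∑ p ∈ t, energyTerm G u u p)) := by
    intro u
    have : Tendsto (fun n => 1 / 2 * ∑ p ∈ t, ((approxParam n : ℝ)⁻¹ *
        (Q.scale (approxParam n)).kernel p.1 p.2) * (u p.1 - u p.2) ^ 2) atTop
        (𝓝 (1 / 2 * ∑ p ∈ t, energyTerm G u u p)) := by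
      refine (tendsto_finsetSum _ fun p _ => ?_).const_mul _
      -- The kernel need not converge on the diagonal after rescaling, but the difference of `u`
      -- vanishes there.
      by_cases hp : p.1 = p.2
      · simp [energyTerm, hp]
      · have := (hker _ _ hp).mul_const ((u p.1 - u p.2) ^ 2)
        simpa [energyTerm, sq] using this
    refine this.congr fun n => ?_
    rw [mul_left_comm, Finset.mul_sum (a := (approxParam n : ℝ)⁻¹)]
    simp only [mul_assoc]
  refine le_of_tendsto_of_tendsto' ((hQ.tendsto_approx _ _).sub (hsum _))
    ((hQ.tendsto_approx _ _).sub (hsum _)) fun n => ?_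
  rw [← mul_sub, ← mul_sub]
  exact mul_le_mul_of_nonneg_left
    ((hM.scale (approxParam n)).inner_sub_resolvent_comp_le hC h0 (f : ell2 m) t)
    (inv_nonneg.2 (approxParam n).2)

/-- The contraction `C = 0` in the preceding inequality: its left-hand side is then nonnegative. -/
lemma sum_energyTerm_le_of_extends (hQ : Q.IsClosed) (hM : Q.IsMarkovian) (hd : finSupp m ≤ Q.dom)
    (h : Q.Extends (dirichletForm m G)) (f : Q.dom) (t : Finset (X × X)) :
    ∑ p ∈ t, energyTerm G (f : ell2 m) (f : ell2 m) p ≤ 2 * Q.bilin f f := by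
  have h1 := sub_sum_energyTerm_comp_le hQ hM hd h (C := fun _ => 0)
    (LipschitzWith.const' 0) rfl f t
  have h2 := Q.nonneg (hM.comp (C := fun _ => 0) (LipschitzWith.const' 0) rfl f)
  simp only [energyTerm, sub_self, mul_zero, Finset.sum_const_zero] at h1 ⊢
  linarith

lemma dom_le_neumann_of_extends (hQ : Q.IsClosed) (hM : Q.IsMarkovian) (hd : finSupp m ≤ Q.dom)
    (h : Q.Extends (dirichletForm m G)) : Q.dom ≤ (neumannForm m G).dom := fun f hf =>
  summable_of_sum_le (fun p => energyTerm_self_nonneg _ p)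
    (sum_energyTerm_le_of_extends hQ hM hd h ⟨f, hf⟩)

lemma energy_le_of_extends (hQ : Q.IsClosed) (hM : Q.IsMarkovian) (hd : finSupp m ≤ Q.dom)
    (h : Q.Extends (dirichletForm m G)) (f : Q.dom) :
    energy G (f : ell2 m) ≤ Q.bilin f f := by
  have h1 : ∑' p, energyTerm G (f : ell2 m) (f : ell2 m) p ≤ 2 * Q.bilin f f :=
    Summable.tsum_le_of_sum_le (dom_le_neumann_of_extends hQ hM hd h f.2)
      (sum_energyTerm_le_of_extends hQ hM hd h f)
  rw [energy]
  linarith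

/-- `Q - Q^(N)` is Markovian on `D(Q)` if `Q` is a Dirichlet form extending `Q^(D)`. -/
lemma sub_energy_comp_le (hQ : Q.IsClosed) (hM : Q.IsMarkovian) (hd : finSupp m ≤ Q.dom)
    (h : Q.Extends (dirichletForm m G)) {C : ℝ → ℝ} (hC : LipschitzWith 1 C) (h0 : C 0 = 0)
    (f : Q.dom) :
    Q.bilin (hM.comp hC h0 f) (hM.comp hC h0 f) - energy G (hC.compLp h0 (f : ell2 m) : ell2 m) ≤
      Q.bilin f f - energy G (f : ell2 m) := by
  have hs : ∀ f : Q.dom, Summable (energyTerm G (f : ell2 m) (f : ell2 m)) := fun f =>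
    dom_le_neumann_of_extends hQ hM hd h f.2
  refine le_of_tendsto_of_tendsto'
    (tendsto_const_nhds.sub ((hs (hM.comp hC h0 f)).hasSum.const_mul (1 / 2)))
    (tendsto_const_nhds.sub ((hs f).hasSum.const_mul (1 / 2))) fun t => ?_
  have h1 := sub_sum_energyTerm_comp_le hQ hM hd h hC h0 f t
  have e : ((hM.comp hC h0 f : Q.dom) : ell2 m) = (hC.compLp h0 (f : ell2 m) : ell2 m) := rfl
  have e' : (fun x => C ((f : ell2 m) x)) = ((hM.comp hC h0 f : Q.dom) : ell2 m) := by
    funext x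
    rw [e, ell2_comp_apply]
  rw [e'] at h1
  exact h1

end Approximation

/-! ### The Royden compactification and the trace -/

section RoydenSpace

variable {X : Type*} [MeasurableSpace X] [DiscreteMeasurableSpace X] {m : X → Ioi (0 : ℝ)}
  {G : WGraph X}

instance : T2Space (Royden m G) :=
  inferInstanceAs (T2Space (closure (range fun (x : X) (f : BddDom m G) => (f.1 x : ℝ))))

instance : CompactSpace (Royden m G) := by
  have h : IsCompact (closure (range fun (x : X) (f : BddDom m G) => (f.1 x : ℝ))) := by
    choose K hK using fun f : BddDom m G => f.2.2
    refine IsCompact.of_isClosed_subset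
      (isCompact_univ_pi fun f => isCompact_Icc (a := -K f) (b := K f)) isClosed_closure ?_
    refine closure_minimal ?_ (isClosed_set_pi fun f _ => isClosed_Icc)
    rintro _ ⟨x, rfl⟩ f -
    exact abs_le.1 (hK f x)
  exact isCompact_iff_compactSpace.1 h

lemma continuous_extend (f : BddDom m G) : Continuous (Royden.extend f) :=
  (continuous_apply f).comp continuous_subtype_val

lemma extend_embed (f : BddDom m G) (x : X) : Royden.extend f (Royden.embed m G x) = f.1 x := rfl

lemma denseRange_embed : DenseRange (Royden.embed m G) := by
  intro ξ
  have hi : IsInducing (fun ξ : Royden m G => (ξ.1 : BddDom m G → ℝ)) := ⟨rfl⟩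
  rw [hi.closure_eq_preimage_closure_image, mem_preimage, ← range_comp]
  exact ξ.2

/-- The trace on `X` of the neighbourhood filter of a point of `X̂`. -/
def vertexFilter (ξ : Royden m G) : Filter X := comap (Royden.embed m G) (𝓝 ξ)

instance (ξ : Royden m G) : (vertexFilter ξ).NeBot :=
  comap_neBot fun _ ht => by
    obtain ⟨_, hy, x, rfl⟩ := mem_closure_iff_nhds.1 (denseRange_embed ξ) _ ht
    exact ⟨x, hy⟩

lemma tendsto_extend (f : BddDom m G) (ξ : Royden m G) :
    Tendsto (fun x => f.1 x) (vertexFilter ξ) (𝓝 (Royden.extend f ξ)) :=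
  ((continuous_extend f).tendsto ξ).comp tendsto_comap

/-- A bounded function in `D(Q^(N))` as an element of `BddDom`. -/
def mkBdd (f : NSpace m G) (h : ∃ K : ℝ, ∀ x, |fn f x| ≤ K) : BddDom m G :=
  ⟨fn f, (neumannForm m G).incl_mem f, h⟩

lemma mkBdd_val (f : NSpace m G) (h : ∃ K : ℝ, ∀ x, |fn f x| ≤ K) : (mkBdd f h).1 = fn f := rfl

/-- A bounded function in `D(Q^(N))` as an element of the Hilbert space. -/
def ofBdd (f : BddDom m G) : NSpace m G := (neumannForm m G).toSpace ⟨f.1, f.2.1⟩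

lemma fn_ofBdd (f : BddDom m G) : fn (ofBdd f) = f.1 := rfl

/-! ### Some normal contractions -/

lemma lipschitz_clamp (K : ℝ) : LipschitzWith 1 fun t : ℝ => max (-K) (min t K) := by
  refine LipschitzWith.of_dist_le_mul fun s t => ?_
  rw [Real.dist_eq, Real.dist_eq, NNReal.coe_one, one_mul]
  refine (abs_max_sub_max_le_max _ _ _ _).trans (max_le (by simp) ?_)
  exact (abs_min_sub_min_le_max _ _ _ _).trans (max_le le_rfl (by simp))

lemma clamp_zero {K : ℝ} (hK : 0 ≤ K) : max (-K) (min 0 K) = 0 := by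
  rw [min_eq_left hK, max_eq_right (by linarith)]

lemma clamp_eq_self {K t : ℝ} (h : |t| ≤ K) : max (-K) (min t K) = t := by
  rw [min_eq_left (abs_le.1 h).2, max_eq_right (abs_le.1 h).1]

lemma abs_clamp_le_bound {K : ℝ} (hK : 0 ≤ K) (t : ℝ) : |max (-K) (min t K)| ≤ K :=
  abs_le.2 ⟨le_max_left _ _, max_le (by linarith) (min_le_right _ _)⟩

lemma eq_of_abs_clamp_lt {K t : ℝ} (h : |max (-K) (min t K)| < K) : max (-K) (min t K) = t := by
  have h' := abs_lt.1 h
  have h1 : min t K < K := (le_max_right _ _).trans_lt h'.2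
  have h2 : min t K = t := min_eq_left (by by_contra hc; rw [min_eq_right (by linarith)] at h1; linarith)
  rw [h2] at h' ⊢
  refine max_eq_right ?_
  by_contra hc
  rw [max_eq_left (by linarith)] at h'
  linarith [h'.1]

lemma lipschitz_threshold (ε : ℝ) : LipschitzWith 1 fun t : ℝ => max (min 0 (t + ε)) (t - ε) := by
  refine LipschitzWith.of_dist_le_mul fun s t => ?_
  rw [Real.dist_eq, Real.dist_eq, NNReal.coe_one, one_mul]
  refine (abs_max_sub_max_le_max _ _ _ _).trans (max_le ?_ (by simp))
  exact (abs_min_sub_min_le_max _ _ _ _).trans (max_le (by simp) (by simp))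

lemma threshold_eq_zero {ε t : ℝ} (h : |t| ≤ ε) : max (min 0 (t + ε)) (t - ε) = 0 := by
  have := abs_le.1 h
  rw [min_eq_left (by linarith), max_eq_left (by linarith)]

lemma abs_threshold_sub_le {ε : ℝ} (hε : 0 ≤ ε) (t : ℝ) :
    |max (min 0 (t + ε)) (t - ε) - t| ≤ ε := by
  rw [abs_le]
  constructor
  · linarith [le_max_right (min 0 (t + ε)) (t - ε)]
  · have : max (min 0 (t + ε)) (t - ε) ≤ t + ε := max_le (min_le_right _ _) (by linarith)
    linarith

lemma lipschitz_excess (c : ℝ) : LipschitzWith 1 fun t : ℝ => max (t - c) 0 := by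
  refine LipschitzWith.of_dist_le_mul fun s t => ?_
  rw [Real.dist_eq, Real.dist_eq, NNReal.coe_one, one_mul]
  exact (abs_max_sub_max_le_max _ _ _ _).trans (max_le (by simp) (by simp))

/-- The truncation of `f ∈ D(Q^(N))` at the levels `±K`. -/
def ntrunc (K : ℝ≥0) (f : NSpace m G) : NSpace m G :=
  ncomp (lipschitz_clamp K) (clamp_zero K.2) f

lemma fn_ntrunc (K : ℝ≥0) (f : NSpace m G) (x : X) :
    fn (ntrunc K f) x = max (-(K : ℝ)) (min (fn f x) K) := fn_ncomp_apply _ _ _ _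

lemma ntrunc_bdd (K : ℝ≥0) (f : NSpace m G) : ∃ C : ℝ, ∀ x, |fn (ntrunc K f) x| ≤ C :=
  ⟨K, fun x => by rw [fn_ntrunc]; exact abs_clamp_le_bound K.2 _⟩

/-! ### The trace -/

/-- Infinitely many oscillations across two real levels would persist in a truncation above both
levels. That truncation is bounded, so it extends continuously to `X̂` and has a limit. -/
lemma exists_tendsto_ereal (f : NSpace m G) (ξ : Royden m G) :
    ∃ c : EReal, Tendsto (fun x => ((fn f x : ℝ) : EReal)) (vertexFilter ξ) (𝓝 c) := by
  refine tendsto_of_no_upcrossings dense_univ ?_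
  rintro a - b - hab ⟨h1, h2⟩
  obtain ⟨a', haa, hab'⟩ := EReal.lt_iff_exists_real_btwn.1 hab
  obtain ⟨b', hab'', hbb⟩ := EReal.lt_iff_exists_real_btwn.1 hab'
  have hlt : a' < b' := EReal.coe_lt_coe_iff.1 hab''
  set K : ℝ≥0 := ⟨max |a'| |b'|, le_max_of_le_left (abs_nonneg _)⟩ with hK
  have hlim := tendsto_extend (mkBdd (ntrunc K f) (ntrunc_bdd K f)) ξ
  set c := Royden.extend (mkBdd (ntrunc K f) (ntrunc_bdd K f)) ξ
  have hKa : |a'| ≤ K := le_max_left _ _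
  have hKb : |b'| ≤ K := le_max_right _ _
  have hca : c ≤ a' := by
    refine le_of_tendsto_of_frequently hlim (h1.mono fun x hx => ?_)
    have hx' : fn f x ≤ a' := (EReal.coe_lt_coe_iff.1 (hx.trans haa)).le
    rw [mkBdd_val, fn_ntrunc]
    exact max_le (by linarith [(abs_le.1 hKa).1]) ((min_le_left _ _).trans hx')
  have hcb : b' ≤ c := by
    refine ge_of_tendsto_of_frequently hlim (h2.mono fun x hx => ?_)
    have hx' : b' ≤ fn f x := (EReal.coe_lt_coe_iff.1 (hbb.trans hx)).le
    rw [mkBdd_val, fn_ntrunc]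
    exact le_max_of_le_right (le_min hx' (abs_le.1 hKb).2)
  linarith

lemma tendsto_trace (f : NSpace m G) (ξ : Boundary m G) :
    Tendsto (fun x => ((fn f x : ℝ) : EReal)) (vertexFilter ξ.1) (𝓝 (trace G (fn f) ξ)) :=
  tendsto_nhds_limUnder (exists_tendsto_ereal f ξ.1)

lemma trace_eq_of_tendsto {f : NSpace m G} {ξ : Boundary m G} {c : EReal}
    (h : Tendsto (fun x => ((fn f x : ℝ) : EReal)) (vertexFilter ξ.1) (𝓝 c)) :
    trace G (fn f) ξ = c := tendsto_nhds_unique (tendsto_trace f ξ) h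

lemma trace_eq_coe_iff {f : NSpace m G} {ξ : Boundary m G} {c : ℝ} :
    trace G (fn f) ξ = c ↔ Tendsto (fun x => fn f x) (vertexFilter ξ.1) (𝓝 c) := by
  constructor
  · intro h
    have := tendsto_trace f ξ
    rw [h] at this
    exact EReal.tendsto_coe.1 this
  · intro h
    exact trace_eq_of_tendsto (EReal.tendsto_coe.2 h)

lemma trace_mkBdd (f : NSpace m G) (h : ∃ K : ℝ, ∀ x, |fn f x| ≤ K) (ξ : Boundary m G) :
    trace G (fn f) ξ = (Royden.extend (mkBdd f h) ξ.1 : ℝ) :=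
  trace_eq_coe_iff.2 (tendsto_extend (mkBdd f h) ξ.1)

lemma trace_bdd (f : BddDom m G) (ξ : Boundary m G) :
    trace G f.1 ξ = (Royden.extend f ξ.1 : ℝ) := trace_mkBdd (ofBdd f) f.2.2 ξ

lemma extend_eq_of_tendsto {f : BddDom m G} {ξ : Royden m G} {c : ℝ}
    (h : Tendsto (fun x => f.1 x) (vertexFilter ξ) (𝓝 c)) : Royden.extend f ξ = c :=
  tendsto_nhds_unique (tendsto_extend f ξ) h

lemma tendsto_of_tendsto_clamp {l : Filter X} {f : X → ℝ} {K c : ℝ}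
    (h : Tendsto (fun x => max (-K) (min (f x) K)) l (𝓝 c)) (hc : |c| < K) :
    Tendsto f l (𝓝 c) := by
  refine h.congr' ?_
  filter_upwards [h.abs.eventually (gt_mem_nhds hc)] with x hx
  exact eq_of_abs_clamp_lt hx

/-- The definition of `∂X` only speaks about bounded functions. Truncation at height `1` keeps `f`
in `D(Q^(D))` and does not affect whether the limit is `0`. -/
lemma tendsto_zero_of_mem_dirSub {f : NSpace m G} (hf : f ∈ dirSub m G) (ξ : Boundary m G) :
    Tendsto (fun x => fn f x) (vertexFilter ξ.1) (𝓝 0) := by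
  have h1 : ntrunc 1 f ∈ dirSub m G := ncomp_mem_dirSub _ _ hf
  have h2 := tendsto_extend (mkBdd (ntrunc 1 f) (ntrunc_bdd 1 f)) ξ.1
  have h3 : (mkBdd (ntrunc 1 f) (ntrunc_bdd 1 f)).1 ∈ (dirichletForm m G).dom := by
    rw [mkBdd_val]
    exact mem_dirSub_iff.1 h1
  rw [ξ.2.2 _ h3] at h2
  refine tendsto_of_tendsto_clamp (K := 1) (h2.congr fun x => ?_) (by simp)
  rw [mkBdd_val, fn_ntrunc, NNReal.coe_one]

/-- The difference has the finite limit `0`, so addition in `EReal` is continuous at the relevant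
point even where the traces are infinite. -/
lemma trace_eq_of_sub_mem {f g : NSpace m G} (h : f - g ∈ dirSub m G) :
    trace G (fn f) = trace G (fn g) := by
  funext ξ
  refine trace_eq_of_tendsto ?_
  have h1 := tendsto_trace g ξ
  have h2 : Tendsto (fun x => ((fn (f - g) x : ℝ) : EReal)) (vertexFilter ξ.1) (𝓝 ((0 : ℝ) : EReal)) :=
    EReal.tendsto_coe.2 (tendsto_zero_of_mem_dirSub h ξ)
  have h3 : Tendsto (fun p : EReal × EReal => p.1 + p.2)
      (𝓝 (trace G (fn g) ξ, ((0 : ℝ) : EReal))) (𝓝 (trace G (fn g) ξ + ((0 : ℝ) : EReal))) :=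
    EReal.continuousAt_add (by simp) (by simp)
  have h4 := h3.comp (h1.prodMk_nhds h2)
  rw [EReal.coe_zero, add_zero] at h4
  refine h4.congr fun x => ?_
  simp only [Function.comp_apply]
  rw [← EReal.coe_add, fn_sub]
  congr 1
  ring

lemma trace_harm (f : NSpace m G) : trace G (fn (harm f)) = trace G (fn f) :=
  (trace_eq_of_sub_mem (sub_harm_mem f)).symm

/-- Each point of `K` has a neighbourhood on which some `|f|` with `f ∈ D(Q^(D))` is bounded below;
at vertices an indicator function serves. Compactness allows adding finitely many multiples of such
functions. -/
lemma exists_dirSub_ge_one {K : Set (Royden m G)} (hK : IsCompact K)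
    (hd : ∀ ξ ∈ K, ξ ∈ range (Royden.embed m G) ∨
      ∃ f : BddDom m G, f.1 ∈ (dirichletForm m G).dom ∧ Royden.extend f ξ ≠ 0) :
    ∃ g ∈ dirSub m G, ∀ x, 0 ≤ fn g x ∧ (Royden.embed m G x ∈ K → 1 ≤ fn g x) := by
  refine hK.induction_on (p := fun S => ∃ g ∈ dirSub m G, ∀ x, 0 ≤ fn g x ∧
    (Royden.embed m G x ∈ S → 1 ≤ fn g x)) ?_ ?_ ?_ ?_
  · exact ⟨0, Submodule.zero_mem _, fun x => ⟨by rw [fn_zero], fun h => h.elim⟩⟩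
  · rintro s t hst ⟨g, hg, h⟩
    exact ⟨g, hg, fun x => ⟨(h x).1, fun hx => (h x).2 (hst hx)⟩⟩
  · rintro s t ⟨g, hg, h⟩ ⟨g', hg', h'⟩
    refine ⟨g + g', Submodule.add_mem _ hg hg', fun x => ?_⟩
    rw [fn_add]
    refine ⟨add_nonneg (h x).1 (h' x).1, ?_⟩
    rintro (hx | hx)
    · linarith [(h x).2 hx, (h' x).1]
    · linarith [(h' x).2 hx, (h x).1]
  · intro ξ hξ
    have hex : ∃ f : BddDom m G, f.1 ∈ (dirichletForm m G).dom ∧ Royden.extend f ξ ≠ 0 := by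
      rcases hd ξ hξ with ⟨x, rfl⟩ | h
      · have hb : ∃ K : ℝ, ∀ y, |fn (ndelta m G x) y| ≤ K := by
          refine ⟨1, fun y => ?_⟩
          classical
          rw [fn_ndelta, delta_apply]
          split_ifs <;> simp
        refine ⟨mkBdd (ndelta m G x) hb, mem_dirSub_iff.1 (ndelta_mem_dirSub x), ?_⟩
        rw [extend_embed, mkBdd_val, fn_ndelta, delta_self]
        exact one_ne_zero
      · exact h
    obtain ⟨f, hf, hne⟩ := hex
    set c := |Royden.extend f ξ| with hc
    have hc0 : 0 < c := abs_pos.2 hne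
    set U : Set (Royden m G) := {η | c / 2 < |Royden.extend f η|} with hU
    have hUo : IsOpen U := isOpen_lt continuous_const (continuous_extend f).abs
    refine ⟨U, mem_nhdsWithin_of_mem_nhds (hUo.mem_nhds (by change c / 2 < c; linarith)),
      ?_⟩
    have hfd : ofBdd f ∈ dirSub m G := mem_dirSub_iff.2 hf
    refine ⟨(2 / c) • ncomp lipschitzWith_one_norm norm_zero (ofBdd f),
      Submodule.smul_mem _ _ (ncomp_mem_dirSub _ _ hfd), fun x => ?_⟩
    rw [fn_smul, fn_ncomp_apply]
    refine ⟨by positivity, fun hx => ?_⟩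
    have hx' : c / 2 < |f.1 x| := hx
    rw [fn_ofBdd, Real.norm_eq_abs, div_mul_eq_mul_div, le_div_iff₀ hc0]
    linarith

/-- The functions in `D(Q^(N))` with vanishing trace are those in `D(Q^(D))`. -/
lemma mem_dirSub_of_tendsto_zero {f : NSpace m G}
    (h : ∀ ξ : Boundary m G, Tendsto (fun x => fn f x) (vertexFilter ξ.1) (𝓝 0)) :
    f ∈ dirSub m G := by
  set ε : ℕ → ℝ := fun n => 1 / ((n : ℝ) + 1) with hε
  have hε0 : ∀ n, 0 < ε n := fun n => by simp only [hε]; positivity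
  have hε1 : ∀ n, ε n ≤ 1 := fun n => by
    simp only [hε]
    rw [div_le_one (by positivity)]
    linarith [(Nat.cast_nonneg n : (0 : ℝ) ≤ n)]
  have hεlim : Tendsto ε atTop (𝓝 0) := tendsto_one_div_add_atTop_nhds_zero_nat
  -- `f` is moved towards `0` by `ε n` and cut off at height `n`: the result vanishes where `|f| ≤ ε
  -- n`, is bounded by `n`, and its norm is at most `‖f‖`.
  set u : ℕ → NSpace m G := fun n =>
    ntrunc n (ncomp (lipschitz_threshold (ε n)) (threshold_eq_zero (by simpa using (hε0 n).le)) f)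
    with hu
  have hux : ∀ n x, fn (u n) x =
      max (-(n : ℝ)) (min (max (min 0 (fn f x + ε n)) (fn f x - ε n)) n) := fun n x => by
    simp only [hu]
    rw [fn_ntrunc, fn_ncomp_apply, NNReal.coe_natCast]
  have hule : ∀ n x, |fn (u n) x| ≤ |fn f x| := fun n x => by
    simp only [hu]
    rw [fn_ntrunc, fn_ncomp_apply]
    exact (abs_le_of_lipschitz (lipschitz_clamp _) (clamp_zero (NNReal.coe_nonneg _)) _).trans
      (abs_le_of_lipschitz (lipschitz_threshold (ε n))
        (threshold_eq_zero (by simpa using (hε0 n).le)) _)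
  refine mem_dirSub_of_bounded (u := u) (K := ‖f‖)
    (fun n => (norm_ncomp_le _ _ _).trans (norm_ncomp_le _ _ _)) (fun n => ?_) ?_
  · set F := mkBdd (ntrunc 1 f) (ntrunc_bdd 1 f)
    -- A compact set disjoint from `∂X` that contains all vertices with `|f| ≥ ε n`; truncation at
    -- `1` detects them because `ε n ≤ 1`. On it some `g ∈ D(Q^(D))` is at least `1`, so `|u n| ≤ n
    -- g` and the ideal property applies.
    set K : Set (Royden m G) := {ξ | ε n ≤ |Royden.extend F ξ|} with hK
    have hKc : IsCompact K := (isClosed_le continuous_const (continuous_extend F).abs).isCompact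
    obtain ⟨g, hg, hg'⟩ := exists_dirSub_ge_one hKc (by
      intro ξ hξ
      by_contra hc
      push Not at hc
      have hb := h ⟨ξ, hc.1, hc.2⟩
      have h1 : Royden.extend F ξ = 0 := by
        refine extend_eq_of_tendsto ?_
        have h2 := ((lipschitz_clamp 1).continuous.tendsto 0).comp hb
        simp only [clamp_zero zero_le_one] at h2
        refine h2.congr fun x => ?_
        rw [mkBdd_val, fn_ntrunc]; rfl
      have h3 : ε n ≤ |Royden.extend F ξ| := hξ
      rw [h1, abs_zero] at h3
      linarith [hε0 n])
    refine mem_dirSub_of_abs_le (g := (n : ℝ) • g) (Submodule.smul_mem _ _ hg) fun x => ?_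
    have hn : (0 : ℝ) ≤ n := Nat.cast_nonneg n
    rw [fn_smul, abs_of_nonneg (mul_nonneg hn (hg' x).1)]
    by_cases hx : |fn f x| ≤ ε n
    · rw [hux, threshold_eq_zero hx, clamp_zero hn, abs_zero]
      exact mul_nonneg hn (hg' x).1
    · have h1 : 1 ≤ fn g x := by
        refine (hg' x).2 ?_
        change ε n ≤ |Royden.extend F (Royden.embed m G x)|
        rw [extend_embed, mkBdd_val, fn_ntrunc, NNReal.coe_one]
        by_contra hc
        push Not at hc
        rw [eq_of_abs_clamp_lt (hc.trans_le (hε1 n))] at hc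
        exact hx hc.le
      have h2 : |fn (u n) x| ≤ n := by rw [hux]; exact abs_clamp_le_bound hn _
      nlinarith
  · refine ell2_tendsto_of_dominated (g := fn f) hule (fun x => le_rfl) fun x => ?_
    have h1 : Tendsto (fun n => max (min 0 (fn f x + ε n)) (fn f x - ε n)) atTop (𝓝 (fn f x)) := by
      rw [tendsto_iff_norm_sub_tendsto_zero]
      exact squeeze_zero (fun _ => norm_nonneg _)
        (fun n => abs_threshold_sub_le (hε0 n).le _) hεlim
    refine h1.congr' ?_
    obtain ⟨N, hN⟩ := exists_nat_ge (|fn f x|)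
    filter_upwards [eventually_ge_atTop N] with n hn
    rw [hux, clamp_eq_self]
    have h2 := abs_le_of_lipschitz (lipschitz_threshold (ε n))
        (threshold_eq_zero (by simpa using (hε0 n).le)) (fn f x)
    exact h2.trans (hN.trans (Nat.cast_le.2 hn))

/-- The maximum principle. -/
lemma harm_le_of_trace_le {f : NSpace m G} {c : ℝ} (hc : 0 ≤ c)
    (h : ∀ ξ : Boundary m G, trace G (fn f) ξ ≤ c) (x : X) : fn (harm f) x ≤ c := by
  have h0 : max ((0 : ℝ) - c) 0 = 0 := max_eq_right (by linarith)
  -- The excess of `harm f` over `c` tends to `0` at `∂X`, so it lies in `D(Q^(D))` and is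
  -- orthogonal to `harm f`. As a monotone contraction of `harm f` it must then vanish.
  set v := ncomp (lipschitz_excess c) h0 (harm f) with hv
  have hvm : v ∈ dirSub m G := by
    refine mem_dirSub_of_tendsto_zero fun ξ => ?_
    have h1 := tendsto_trace (harm f) ξ
    rw [trace_harm] at h1
    rw [Metric.tendsto_nhds]
    intro δ hδ
    have h2 : trace G (fn f) ξ < ((c + δ : ℝ) : EReal) :=
      (h ξ).trans_lt (EReal.coe_lt_coe_iff.2 (by linarith))
    filter_upwards [h1.eventually (gt_mem_nhds h2)] with y hy
    have hy' := EReal.coe_lt_coe_iff.1 hy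
    rw [hv, fn_ncomp_apply, Real.dist_eq, sub_zero, abs_of_nonneg (le_max_right _ _)]
    exact max_lt (by linarith) hδ
  have hmono : Monotone fun t : ℝ => max (t - c) 0 := fun s t hst =>
    max_le_max (by linarith) le_rfl
  have h1 := norm_sq_ncomp_le_inner (lipschitz_excess c) h0 (harm f) hmono
  rw [Submodule.inner_left_of_mem_orthogonal hvm (harm_mem f)] at h1
  have h2 : v = 0 := by
    rw [← norm_eq_zero]
    nlinarith [norm_nonneg v]
  have h3 := fn_ncomp_apply (lipschitz_excess c) h0 (harm f) x
  rw [← hv, h2, fn_zero] at h3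
  have h4 := le_max_left (fn (harm f) x - c) 0
  linarith

lemma abs_harm_le_of_abs_le {f : NSpace m G} {K : ℝ} (hK : 0 ≤ K) (h : ∀ x, |fn f x| ≤ K) (x : X) :
    |fn (harm f) x| ≤ K := by
  have key : ∀ f : NSpace m G, (∀ x, |fn f x| ≤ K) → fn (harm f) x ≤ K := by
    intro f h
    refine harm_le_of_trace_le hK (fun ξ => ?_) x
    refine le_of_tendsto' (tendsto_trace f ξ) fun y => ?_
    exact EReal.coe_le_coe_iff.2 ((le_abs_self _).trans (h y))
  rw [abs_le]
  refine ⟨?_, key f h⟩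
  have := key (-f) fun x => by rw [fn_neg, abs_neg]; exact h x
  rw [map_neg, fn_neg] at this
  linarith

end RoydenSpace

/-! ### Harmonic measures -/

section HarmonicMeasure

variable {X : Type*} [MeasurableSpace X] [DiscreteMeasurableSpace X] {m : X → Ioi (0 : ℝ)}
  {G : WGraph X}

instance : T2Space (Boundary m G) := inferInstanceAs (T2Space (Subtype _))

lemma boundary_eq : {ξ : Royden m G | ξ ∉ range (Royden.embed m G) ∧
    ∀ f : BddDom m G, f.1 ∈ (dirichletForm m G).dom → Royden.extend f ξ = 0} =
    ⋂ f : BddDom m G, ⋂ _ : f.1 ∈ (dirichletForm m G).dom, {ξ | Royden.extend f ξ = 0} := by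
  ext ξ
  simp only [mem_iInter]
  constructor
  · exact fun h => h.2
  · refine fun h => ⟨?_, h⟩
    rintro ⟨x, rfl⟩
    have hb : ∃ K : ℝ, ∀ y, |fn (ndelta m G x) y| ≤ K := by
      refine ⟨1, fun y => ?_⟩
      classical
      rw [fn_ndelta, delta_apply]
      split_ifs <;> simp
    have h1 := h (mkBdd (ndelta m G x) hb) (delta_mem_dirichletDom x)
    have h2 : delta m x x = 0 := h1
    rw [delta_self] at h2
    exact one_ne_zero h2

instance : CompactSpace (Boundary m G) := by
  have h : IsClosed {ξ : Royden m G | ξ ∉ range (Royden.embed m G) ∧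
      ∀ f : BddDom m G, f.1 ∈ (dirichletForm m G).dom → Royden.extend f ξ = 0} := by
    rw [boundary_eq]
    exact isClosed_iInter fun f => isClosed_iInter fun _ =>
      isClosed_eq (continuous_extend f) continuous_const
  exact isCompact_iff_compactSpace.1 h.isCompact

lemma continuous_extend_boundary (f : BddDom m G) :
    Continuous fun ξ : Boundary m G => Royden.extend f ξ.1 :=
  (continuous_extend f).comp continuous_subtype_val

variable (m G) in
/-- The bounded functions in `D(Q^(N))`, as a subspace. -/
def bddSub : Submodule ℝ (NSpace m G) where
  carrier := {f | ∃ K : ℝ, ∀ x, |fn f x| ≤ K}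
  add_mem' := by
    rintro f g ⟨K, hK⟩ ⟨L, hL⟩
    refine ⟨K + L, fun x => ?_⟩
    rw [fn_add]
    exact (abs_add_le _ _).trans (add_le_add (hK x) (hL x))
  zero_mem' := ⟨0, fun x => by rw [fn_zero, abs_zero]⟩
  smul_mem' := by
    rintro a f ⟨K, hK⟩
    refine ⟨|a| * K, fun x => ?_⟩
    rw [fn_smul, abs_mul]
    exact mul_le_mul_of_nonneg_left (hK x) (abs_nonneg a)

variable (m G) in
/-- The trace of bounded functions in `D(Q^(N))`, as a continuous function on `∂X`. -/
def bddTrace : bddSub m G →ₗ[ℝ] CompactlySupportedContinuousMap (Boundary m G) ℝ where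
  toFun f := CompactlySupportedContinuousMap.continuousMapEquiv
    ⟨fun ξ => Royden.extend (mkBdd f.1 f.2) ξ.1, continuous_extend_boundary _⟩
  map_add' f g := by
    ext ξ
    refine extend_eq_of_tendsto ?_
    have h := (tendsto_extend (mkBdd f.1 f.2) ξ.1).add (tendsto_extend (mkBdd g.1 g.2) ξ.1)
    refine h.congr fun x => ?_
    exact (fn_add f.1 g.1 x).symm
  map_smul' a f := by
    ext ξ
    refine extend_eq_of_tendsto ?_
    have h := (tendsto_extend (mkBdd f.1 f.2) ξ.1).const_mul a
    refine h.congr fun x => ?_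
    exact (fn_smul a f.1 x).symm

lemma bddTrace_apply (f : bddSub m G) (ξ : Boundary m G) :
    bddTrace m G f ξ = Royden.extend (mkBdd f.1 f.2) ξ.1 := rfl

lemma bddAbove_range_max (φ : CompactlySupportedContinuousMap (Boundary m G) ℝ) :
    BddAbove (range fun ξ => max (φ ξ) 0) :=
  (isCompact_range (φ.continuous.max continuous_const)).bddAbove

/-- Finiteness of the trace at every boundary point makes the limits subtractable. No reference
measure enters, so this is available for constructing the harmonic measures. -/
lemma harm_eq_of_trace_eq {f g : NSpace m G}
    (hf : ∀ ξ : Boundary m G, ∃ c : ℝ, trace G (fn f) ξ = c)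
    (h : trace G (fn f) = trace G (fn g)) : harm f = harm g := by
  rw [← sub_eq_zero, ← map_sub, harm_eq_zero_iff]
  refine mem_dirSub_of_tendsto_zero fun ξ => ?_
  obtain ⟨c, hc⟩ := hf ξ
  have h1 := trace_eq_coe_iff.1 hc
  rw [h] at hc
  have h2 := h1.sub (trace_eq_coe_iff.1 hc)
  rw [sub_self] at h2
  exact h2.congr fun x => (fn_sub f g x).symm

variable (m G) in
-- On traces of bounded functions, `γ f ↦ harm f (x)` is dominated by the supremum of the positive
-- part, by the maximum principle. A Hahn–Banach extension to all continuous functions keeps this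
-- bound, which makes it positive of mass at most `1`; the Riesz theorem gives the measure.
lemma exists_harmonicMeasure (x : X) : ∃ μ, IsHarmonicMeasure m G x μ := by
  have : Module.Free ℝ (bddTrace m G).range := Module.Free.of_divisionRing ℝ (bddTrace m G).range
  -- A linear choice of functions with prescribed trace. The choice is immaterial, since the
  -- harmonic part depends on the trace only.
  obtain ⟨s, hs⟩ := LinearMap.exists_rightInverse_of_surjective (bddTrace m G).rangeRestrict
    (LinearMap.range_rangeRestrict _)
  have hs' : ∀ φ, bddTrace m G (s φ) = φ.1 := fun φ =>
    congrArg Subtype.val (LinearMap.congr_fun hs φ)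
  let ev : bddSub m G →ₗ[ℝ] ℝ :=
    { toFun := fun f => fn (harm f.1) x
      map_add' := fun f g => by rw [Submodule.coe_add, map_add, fn_add]
      map_smul' := fun a f => by rw [Submodule.coe_smul, map_smul, fn_smul]; rfl }
  let F : CompactlySupportedContinuousMap (Boundary m G) ℝ →ₗ.[ℝ] ℝ :=
    ⟨(bddTrace m G).range, ev ∘ₗ s⟩
  have hFapp : ∀ φ : F.domain, F φ = fn (harm (s φ).1) x := fun φ => rfl
  obtain ⟨g, hg, hgle⟩ := exists_extension_of_le_sublinear F (fun φ => ⨆ ξ, max (φ ξ) 0)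
    (by
      intro c hc φ
      rw [Real.mul_iSup_of_nonneg hc.le]
      refine congrArg _ (funext fun ξ => ?_)
      rw [CompactlySupportedContinuousMap.coe_smul, Pi.smul_apply, smul_eq_mul,
        mul_max_of_nonneg _ _ hc.le, mul_zero])
    (by
      intro φ ψ
      have h1 := fun ξ => le_ciSup (bddAbove_range_max φ) ξ
      have h2 := fun ξ => le_ciSup (bddAbove_range_max ψ) ξ
      have n1 : 0 ≤ ⨆ ξ, max (φ ξ) 0 := Real.iSup_nonneg fun ξ => le_max_right _ _
      have n2 : 0 ≤ ⨆ ξ, max (ψ ξ) 0 := Real.iSup_nonneg fun ξ => le_max_right _ _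
      refine Real.iSup_le (fun ξ => max_le ?_ (add_nonneg n1 n2)) (add_nonneg n1 n2)
      rw [CompactlySupportedContinuousMap.coe_add, Pi.add_apply]
      exact add_le_add ((le_max_left _ _).trans (h1 ξ)) ((le_max_left _ _).trans (h2 ξ)))
    (by
      intro φ
      rw [hFapp]
      refine harm_le_of_trace_le (Real.iSup_nonneg fun ξ => le_max_right _ _) (fun ξ => ?_) x
      rw [trace_mkBdd (s φ).1 (s φ).2, ← bddTrace_apply, hs']
      exact EReal.coe_le_coe_iff.2
        ((le_max_left _ _).trans (le_ciSup (bddAbove_range_max φ.1) ξ)))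
  have hgpos : ∀ φ, 0 ≤ φ → 0 ≤ g φ := by
    intro φ hφ
    have h1 := hgle (-φ)
    have h2 : (⨆ ξ, max ((-φ) ξ) 0) ≤ 0 := by
      refine Real.iSup_le (fun ξ => max_le ?_ le_rfl) le_rfl
      rw [CompactlySupportedContinuousMap.coe_neg, Pi.neg_apply]
      have := hφ ξ
      simpa using this
    rw [map_neg] at h1
    linarith
  set Λ := PositiveLinearMap.mk₀ g hgpos with hΛ
  set ν := RealRMK.rieszMeasure Λ with hν
  have hrepr : ∀ φ, ∫ ξ, φ ξ ∂ν = g φ := fun φ => RealRMK.integral_rieszMeasure Λ φ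
  have hone : ν univ ≤ 1 := by
    set one : CompactlySupportedContinuousMap (Boundary m G) ℝ :=
      CompactlySupportedContinuousMap.continuousMapEquiv (1 : C(Boundary m G, ℝ)) with hone
    have h1 := hrepr one
    have h2 : ∀ ξ, one ξ = 1 := fun ξ => rfl
    simp only [h2, integral_const, smul_eq_mul, mul_one] at h1
    have h3 : g one ≤ 1 := by
      refine (hgle one).trans (Real.iSup_le (fun ξ => ?_) zero_le_one)
      rw [h2]; simp
    rw [← h1] at h3
    rw [← ENNReal.ofReal_one, ← ENNReal.ofReal_toReal (measure_ne_top ν univ)]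
    exact ENNReal.ofReal_le_ofReal h3
  -- Every integrand vanishes on `Z`, so removing `Z` changes no integral and enforces the
  -- normalization at the point `∞`.
  set Z : Set (Boundary m G) := {ξ | ∀ f : BddDom m G, Royden.extend f ξ.1 = 0} with hZ
  refine ⟨ν.restrict Zᶜ, Measure.Regular.restrict_of_measure_ne_top (measure_ne_top _ _), ?_, ?_, ?_⟩
  · rw [Measure.restrict_apply_univ]
    exact (measure_mono (subset_univ _)).trans hone
  · intro f u hu hharm htr
    have h0 : ∀ ξ ∉ Zᶜ, Royden.extend f ξ.1 = 0 := fun ξ hξ => (notMem_compl_iff.1 hξ) f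
    rw [setIntegral_eq_integral_of_forall_compl_eq_zero h0]
    obtain ⟨u, rfl⟩ := exists_fn_eq hu
    let f' : bddSub m G := ⟨ofBdd f, f.2.2⟩
    have h1 : ∫ ξ, Royden.extend f ξ.1 ∂ν = g (bddTrace m G f') := hrepr (bddTrace m G f')
    have h2 := hg ⟨bddTrace m G f', LinearMap.mem_range_self _ _⟩
    rw [hFapp] at h2
    rw [h1, h2]
    set w := s ⟨bddTrace m G f', LinearMap.mem_range_self _ _⟩
    have h3 : bddTrace m G w = bddTrace m G f' := hs' _
    have h4 : trace G (fn w.1) = trace G (fn u) := by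
      rw [htr]
      funext ξ
      rw [trace_bdd, trace_mkBdd w.1 w.2, ← bddTrace_apply, h3]
      rfl
    rw [harm_eq_of_trace_eq (fun ξ => ⟨_, trace_mkBdd w.1 w.2 ξ⟩) h4,
      harm_eq_self (isHarmonic_iff.1 hharm)]
  · intro ξ hξ
    rw [Measure.restrict_apply (measurableSet_singleton ξ)]
    have : {ξ} ∩ Zᶜ = ∅ := by
      rw [singleton_inter_eq_empty]
      exact fun h => h hξ
    rw [this, measure_empty]

lemma isHarmonicMeasure (x : X) : IsHarmonicMeasure m G x (harmonicMeasure m G x) := by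
  rw [harmonicMeasure, dif_pos (exists_harmonicMeasure m G x)]
  exact (exists_harmonicMeasure m G x).choose_spec

instance (x : X) : IsFiniteMeasure (harmonicMeasure m G x) :=
  ⟨(isHarmonicMeasure x).2.1.trans_lt ENNReal.one_lt_top⟩

lemma integral_extend (f : BddDom m G) (x : X) :
    ∫ ξ, Royden.extend f ξ.1 ∂(harmonicMeasure m G x) = fn (harm (ofBdd f)) x :=
  (isHarmonicMeasure x).2.2.1 f (fn (harm (ofBdd f))) (Form.incl_mem _ _)
    (isHarmonic_iff.2 (harm_mem _)) (trace_harm (ofBdd f))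

/-! ### The `L²`-estimate for the trace -/

/-- The harmonic part of the square of a bounded harmonic function is controlled by the form
norm. -/
lemma weight_mul_harm_sq_le {u v : NSpace m G} (hu : u ∈ (dirSub m G)ᗮ) {K : ℝ}
    (hK : ∀ x, |fn u x| ≤ K) (hv : ∀ x, fn v x = fn u x * fn u x) (x : X) :
    m x * fn (harm v) x ≤ 3 * ‖u‖ ^ 2 := by
  have hn := neumann_norm_sq u
  have he := energy_nonneg (G := G) (fn u)
  have hux := weight_mul_sq_le (fn u) x
  set d := harm v - v with hd
  have hdm : d ∈ dirSub m G := by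
    rw [hd, ← neg_sub]
    exact Submodule.neg_mem _ (sub_harm_mem v)
  have hhx : fn (harm v) x = fn d x + fn u x ^ 2 := by
    rw [hd, fn_sub, hv]; ring
  rw [hhx, mul_add]
  set c := fn d x with hc
  -- With `d = harm v - u²` and `c = d(x)`, the quantity to bound is `m x (c + u(x)²)`. The second
  -- summand is at most `‖u‖²`, so only `c > 0` needs work; the claim there is `m x c ≤ 2 ‖u‖²`.
  rcases le_or_gt c 0 with hc0 | hc0
  · have := mul_nonpos_of_nonneg_of_nonpos (weight_pos m x).le hc0
    linarith [sq_nonneg ‖fn u‖]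
  have hL : LipschitzWith 1 fun t : ℝ => max 0 (min t c) := by
    refine LipschitzWith.of_dist_le_mul fun s t => ?_
    rw [Real.dist_eq, Real.dist_eq, NNReal.coe_one, one_mul]
    refine (abs_max_sub_max_le_max _ _ _ _).trans (max_le (by simp) ?_)
    exact (abs_min_sub_min_le_max _ _ _ _).trans (max_le le_rfl (by simp))
  have hL0 : max 0 (min 0 c) = 0 := by rw [min_eq_left hc0.le, max_self]
  have hmono : Monotone fun t : ℝ => max 0 (min t c) := fun s t hst =>
    max_le_max le_rfl (min_le_min hst le_rfl)
  -- The clamp of `d` to `[0, c]` is a test function in `D(Q^(D))` whose value at `x` is `c`.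
  set φ := ncomp hL hL0 d with hφ
  have hφx : ∀ y, fn φ y = max 0 (min (fn d y) c) := fn_ncomp_apply hL hL0 d
  have hφ0 : ∀ y, 0 ≤ fn φ y := fun y => by rw [hφx]; exact le_max_left _ _
  have hφc : ∀ y, fn φ y ≤ c := fun y => by
    rw [hφx]; exact max_le hc0.le (min_le_right _ _)
  have hφm : φ ∈ dirSub m G := ncomp_mem_dirSub _ _ hdm
  have h1 : ‖φ‖ ^ 2 ≤ inner ℝ d φ := norm_sq_ncomp_le_inner hL hL0 d hmono
  have h2 : inner ℝ d φ = -inner ℝ v φ := by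
    rw [hd, inner_sub_left, Submodule.inner_left_of_mem_orthogonal hφm (harm_mem v), zero_sub]
  have hK0 : 0 ≤ K := (abs_nonneg _).trans (hK x)
  -- `ψ = u φ` also lies in `D(Q^(D))`, so the harmonic function `u` is orthogonal to it.
  obtain ⟨ψ, hψ⟩ := exists_mul (f := u) (g := φ) (K := max K c)
    (fun y => (hK y).trans (le_max_left _ _))
    (fun y => by rw [abs_of_nonneg (hφ0 y)]; exact (hφc y).trans (le_max_right _ _))
  have hψm : ψ ∈ dirSub m G := by
    refine mem_dirSub_of_abs_le (g := K • φ) (Submodule.smul_mem _ _ hφm) fun y => ?_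
    rw [hψ, fn_smul, abs_mul, abs_mul, abs_of_nonneg hK0]
    exact mul_le_mul_of_nonneg_right (hK y) (abs_nonneg _)
  have h3 : inner ℝ u ψ = 0 := Submodule.inner_left_of_mem_orthogonal hψm hu
  rw [neumann_inner v φ] at h2
  rw [neumann_inner] at h3
  have hA : inner ℝ (fn v) (fn φ) = inner ℝ (fn u) (fn ψ) := by
    refine (hasSum_inner _ _).unique ((hasSum_inner (fn u) (fn ψ)).congr_fun fun y => ?_)
    rw [hv, hψ]; ring
  have hA' : inner ℝ (fn v) (fn φ) ≤ c * ‖fn u‖ ^ 2 := by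
    refine hasSum_le (fun y => ?_) (hasSum_inner _ _) ((hasSum_norm_sq (fn u)).mul_left c)
    rw [hv]
    have := mul_le_mul_of_nonneg_left (hφc y)
      (mul_nonneg (weight_pos m y).le (sq_nonneg (fn u y)))
    linarith
  -- With `a, b` the values of `u` and `s, t` those of `φ` at the two ends, `-(a² - b²)(s - t) =
  -- -2(a - b)(as - bt) + (a - b)²(s + t)`, and `s + t ≤ 2c`.
  have hE : ∑' p, -energyTerm G (fn v) (fn φ) p ≤
      ∑' p, (-2 * energyTerm G (fn u) (fn ψ) p + 2 * c * energyTerm G (fn u) (fn u) p) := by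
    have s1 := summable_energyTerm G (summable_energy v) (summable_energy φ)
    have s2 := summable_energyTerm G (summable_energy u) (summable_energy ψ)
    refine s1.neg.tsum_le_tsum (fun p => ?_)
      ((s2.mul_left (-2)).add ((summable_energy u).mul_left (2 * c)))
    simp only [energyTerm, hv, hψ]
    have h5 : fn φ p.1 + fn φ p.2 ≤ 2 * c := by linarith [hφc p.1, hφc p.2]
    have h6 := mul_le_mul_of_nonneg_left h5
      (mul_nonneg (G.nonneg p.1 p.2) (sq_nonneg (fn u p.1 - fn u p.2)))
    nlinarith
  rw [tsum_neg, ((summable_energyTerm G (summable_energy u) (summable_energy ψ)).mul_left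
    (-2)).tsum_add ((summable_energy u).mul_left (2 * c)), tsum_mul_left, tsum_mul_left] at hE
  have hen : energy G (fn u) = 1 / 2 * ∑' p, energyTerm G (fn u) (fn u) p := rfl
  have h7 : m x * c ^ 2 ≤ ‖φ‖ ^ 2 := by
    have e : fn φ x = c := by rw [hφx, ← hc, min_self, max_eq_right hc0.le]
    have := weight_mul_sq_le (fn φ) x
    rw [e] at this
    exact this.trans (pow_le_pow_left₀ (norm_nonneg _) (Form.norm_incl_le _ _) 2)
  -- The chain is `m x c² ≤ ‖φ‖² ≤ ⟪d, φ⟫ = -⟪v, φ⟫ ≤ 2c ‖u‖²`; one factor `c` then cancels.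
  have h8 : m x * c ^ 2 ≤ 2 * c * ‖u‖ ^ 2 := by
    have : c * ‖u‖ ^ 2 = c * energy G (fn u) + c * ‖fn u‖ ^ 2 := by rw [hn]; ring
    have : 0 ≤ c * ‖fn u‖ ^ 2 := by positivity
    nlinarith
  have h9 : m x * c ≤ 2 * ‖u‖ ^ 2 := by
    refine le_of_mul_le_mul_right ?_ hc0
    linarith
  linarith

/-- On `∂X` the square of `f` is the trace of `u²` for `u = harm f`, so its integral is the value at
`x` of the harmonic part of `u²`. -/
lemma integral_extend_sq_le (f : BddDom m G) (x : X) :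
    ∫ ξ, Royden.extend f ξ.1 ^ 2 ∂(harmonicMeasure m G x) ≤ 3 * ‖ofBdd f‖ ^ 2 / m x := by
  obtain ⟨K, hK⟩ := f.2.2
  set u := harm (ofBdd f) with hu
  have huK : ∀ y, |fn u y| ≤ |K| :=
    abs_harm_le_of_abs_le (abs_nonneg K) fun y => (hK y).trans (le_abs_self K)
  obtain ⟨v, hv⟩ := exists_mul huK huK
  have hvb : ∃ C : ℝ, ∀ y, |fn v y| ≤ C := ⟨|K| * |K|, fun y => by
    rw [hv, abs_mul]
    exact mul_le_mul (huK y) (huK y) (abs_nonneg _) (abs_nonneg _)⟩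
  have e : ∀ ξ : Boundary m G, Royden.extend f ξ.1 ^ 2 = Royden.extend (mkBdd v hvb) ξ.1 := by
    intro ξ
    symm
    refine extend_eq_of_tendsto ?_
    have h1 : trace G (fn u) ξ = (Royden.extend f ξ.1 : ℝ) := by
      rw [hu, trace_harm, fn_ofBdd, trace_bdd]
    have h2 := (trace_eq_coe_iff.1 h1).pow 2
    refine h2.congr fun y => ?_
    rw [mkBdd_val, hv, sq]
  simp only [e]
  rw [integral_extend, le_div_iff₀ (weight_pos m x), mul_comm]
  refine (weight_mul_harm_sq_le (harm_mem (ofBdd f)) huK hv x).trans ?_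
  have := pow_le_pow_left₀ (norm_nonneg _) (norm_harm_le (ofBdd f)) 2
  linarith

end HarmonicMeasure

/-! ### The trace operator -/

section TraceOperator

variable {X : Type*} [MeasurableSpace X] [DiscreteMeasurableSpace X] {m : X → Ioi (0 : ℝ)}
  {G : WGraph X} {w : X → ℝ≥0}

/-- The trace of the truncation of a function at level `n`. -/
def truncTrace (f : NSpace m G) (n : ℕ) (ξ : Boundary m G) : ℝ :=
  Royden.extend (mkBdd (ntrunc n f) (ntrunc_bdd n f)) ξ.1

lemma continuous_truncTrace (f : NSpace m G) (n : ℕ) : Continuous (truncTrace f n) :=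
  continuous_extend_boundary _

lemma tendsto_truncTrace (f : NSpace m G) (n : ℕ) (ξ : Boundary m G) :
    Tendsto (fun x => max (-(n : ℝ)) (min (fn f x) n)) (vertexFilter ξ.1)
      (𝓝 (truncTrace f n ξ)) := by
  refine (tendsto_extend (mkBdd (ntrunc n f) (ntrunc_bdd n f)) ξ.1).congr fun x => ?_
  rw [mkBdd_val, fn_ntrunc, NNReal.coe_natCast]

lemma truncTrace_of_trace_eq {f : NSpace m G} {ξ : Boundary m G} {c : ℝ}
    (h : trace G (fn f) ξ = c) (n : ℕ) : truncTrace f n ξ = max (-(n : ℝ)) (min c n) :=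
  tendsto_nhds_unique (tendsto_truncTrace f n ξ)
    (((lipschitz_clamp n).continuous.tendsto c).comp (trace_eq_coe_iff.1 h))

lemma trace_of_abs_truncTrace_lt {f : NSpace m G} {ξ : Boundary m G} {n : ℕ}
    (h : |truncTrace f n ξ| < n) : trace G (fn f) ξ = (truncTrace f n ξ : ℝ) :=
  trace_eq_coe_iff.2 (tendsto_of_tendsto_clamp (tendsto_truncTrace f n ξ) h)

/-- The square of the absolute value of the trace, as an extended nonnegative number. -/
def sqTrace (f : NSpace m G) (ξ : Boundary m G) : ℝ≥0∞ :=
  ⨆ n : ℕ, ENNReal.ofReal (truncTrace f n ξ ^ 2)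

/-- Once `n` exceeds the square root of the supremum, truncation at `n` is inactive near `ξ`. -/
lemma exists_trace_eq {f : NSpace m G} {ξ : Boundary m G} (h : sqTrace f ξ < ⊤) :
    ∃ c : ℝ, trace G (fn f) ξ = c ∧ ENNReal.ofReal (c ^ 2) ≤ sqTrace f ξ := by
  obtain ⟨n, hn⟩ := exists_nat_gt (√(sqTrace f ξ).toReal)
  have h1 : ENNReal.ofReal (truncTrace f n ξ ^ 2) ≤ sqTrace f ξ :=
    le_iSup (fun n : ℕ => ENNReal.ofReal (truncTrace f n ξ ^ 2)) n
  refine ⟨truncTrace f n ξ, trace_of_abs_truncTrace_lt ?_, h1⟩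
  refine lt_of_le_of_lt ?_ hn
  refine Real.le_sqrt_of_sq_le ?_
  rw [sq_abs]
  exact (ENNReal.ofReal_le_iff_le_toReal h.ne).1 h1

lemma monotone_sq_truncTrace (f : NSpace m G) (ξ : Boundary m G) :
    Monotone fun n : ℕ => ENNReal.ofReal (truncTrace f n ξ ^ 2) := by
  intro n k hnk
  refine ENNReal.ofReal_le_ofReal ?_
  refine le_of_tendsto_of_tendsto' ((tendsto_truncTrace f n ξ).pow 2)
    ((tendsto_truncTrace f k ξ).pow 2) fun x => ?_
  rw [sq_le_sq]
  have hn : (n : ℝ) ≤ k := Nat.cast_le.2 hnk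
  -- Clamping at `n` factors through clamping at the larger level `k`, and a clamp does not increase
  -- absolute values.
  have e : max (-(n : ℝ)) (min (fn f x) n) =
      max (-(n : ℝ)) (min (max (-(k : ℝ)) (min (fn f x) k)) n) := by
    rcases le_total (fn f x) k with h1 | h1
    · rw [min_eq_left h1]
      rcases le_total (-(k : ℝ)) (fn f x) with h2 | h2
      · rw [max_eq_right h2]
      · have h0 : (0 : ℝ) ≤ n := Nat.cast_nonneg n
        rw [max_eq_left h2, min_eq_left (by linarith), min_eq_left (by linarith),
          max_eq_left (by linarith), max_eq_left (by linarith)]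
    · have h0 : (0 : ℝ) ≤ n := Nat.cast_nonneg n
      have h2 : max (-(k : ℝ)) k = k := max_eq_right (by linarith)
      rw [min_eq_right h1, h2, min_eq_right hn, min_eq_right (hn.trans h1)]
  rw [e]
  exact abs_le_of_lipschitz (lipschitz_clamp n) (clamp_zero (Nat.cast_nonneg n)) _

lemma measurable_sq_truncTrace (f : NSpace m G) (n : ℕ) :
    Measurable fun ξ => ENNReal.ofReal (truncTrace f n ξ ^ 2) :=
  ((continuous_truncTrace f n).pow 2).measurable.ennreal_ofReal

lemma lintegral_sqTrace_le (f : NSpace m G) (x : X) :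
    ∫⁻ ξ, sqTrace f ξ ∂(harmonicMeasure m G x) ≤ ENNReal.ofReal (3 * ‖f‖ ^ 2 / m x) := by
  unfold sqTrace
  rw [lintegral_iSup
    (fun n => measurable_sq_truncTrace f n)
    (fun n k hnk ξ => monotone_sq_truncTrace f ξ hnk)]
  refine iSup_le fun n => ?_
  set F := mkBdd (ntrunc n f) (ntrunc_bdd n f) with hF
  have hi : Integrable (fun ξ : Boundary m G => truncTrace f n ξ ^ 2) (harmonicMeasure m G x) :=
    ((continuous_truncTrace f n).pow 2).integrable_of_hasCompactSupport
      (HasCompactSupport.of_compactSpace _)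
  rw [← ofReal_integral_eq_lintegral_ofReal hi (Eventually.of_forall fun ξ => sq_nonneg _)]
  refine ENNReal.ofReal_le_ofReal ((integral_extend_sq_le F x).trans ?_)
  have h1 : ‖ofBdd F‖ ≤ ‖f‖ := norm_ncomp_le _ _ _
  have h2 := pow_le_pow_left₀ (norm_nonneg _) h1 2
  exact div_le_div_of_nonneg_right (by linarith) (weight_pos m x).le

/-- The constant in the norm estimate for the trace operator. -/
def traceConst (m : X → Ioi (0 : ℝ)) (w : X → ℝ≥0) : ℝ := 3 * ∑' x, (w x : ℝ) / (m x : ℝ)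

lemma traceConst_nonneg : 0 ≤ traceConst m w :=
  mul_nonneg (by norm_num) (tsum_nonneg fun x => div_nonneg (w x).2 (weight_pos m x).le)

lemma lintegral_sqTrace_refMeasure_le (hw : IsAdmissible m G w) (f : NSpace m G) :
    ∫⁻ ξ, sqTrace f ξ ∂(refMeasure m G w) ≤ ENNReal.ofReal (traceConst m w * ‖f‖ ^ 2) := by
  rw [refMeasure, lintegral_sum_measure]
  have e : traceConst m w * ‖f‖ ^ 2 = ∑' x, (w x : ℝ) * (3 * ‖f‖ ^ 2 / m x) := by
    rw [traceConst, mul_right_comm, ← tsum_mul_left]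
    exact tsum_congr fun x => by ring
  rw [e, ENNReal.ofReal_tsum_of_nonneg]
  · refine ENNReal.tsum_le_tsum fun x => ?_
    rw [lintegral_smul_measure, ENNReal.ofReal_mul (NNReal.coe_nonneg _), ENNReal.ofReal_coe_nnreal, smul_eq_mul]
    gcongr
    exact lintegral_sqTrace_le f x
  · intro x
    have := weight_pos m x
    positivity
  · refine (hw.summable_div.mul_left (3 * ‖f‖ ^ 2)).congr fun x => ?_
    ring

lemma measurable_sqTrace (f : NSpace m G) : Measurable (sqTrace f) :=
  Measurable.iSup fun n => measurable_sq_truncTrace f n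

lemma ae_sqTrace_lt_top (hw : IsAdmissible m G w) (f : NSpace m G) :
    ∀ᵐ ξ ∂(refMeasure m G w), sqTrace f ξ < ⊤ :=
  ae_lt_top (measurable_sqTrace f)
    ((lintegral_sqTrace_refMeasure_le hw f).trans_lt ENNReal.ofReal_lt_top).ne

/-- The real-valued trace. -/
def realTrace (f : NSpace m G) (ξ : Boundary m G) : ℝ := (trace G (fn f) ξ).toReal

lemma coe_realTrace {f : NSpace m G} {ξ : Boundary m G} (h : sqTrace f ξ < ⊤) :
    (realTrace f ξ : EReal) = trace G (fn f) ξ := by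
  obtain ⟨c, hc, -⟩ := exists_trace_eq h
  rw [realTrace, hc, EReal.toReal_coe]

lemma aestronglyMeasurable_realTrace (hw : IsAdmissible m G w) (f : NSpace m G) :
    AEStronglyMeasurable (realTrace f) (refMeasure m G w) := by
  refine aestronglyMeasurable_of_tendsto_ae atTop (f := fun n => truncTrace f n)
    (fun n => (continuous_truncTrace f n).aestronglyMeasurable) ?_
  filter_upwards [ae_sqTrace_lt_top hw f] with ξ hξ
  have h := (coe_realTrace hξ).symm
  refine tendsto_const_nhds.congr' ?_
  obtain ⟨N, hN⟩ := exists_nat_ge |realTrace f ξ|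
  filter_upwards [eventually_ge_atTop N] with n hn
  rw [truncTrace_of_trace_eq h, clamp_eq_self (hN.trans (Nat.cast_le.2 hn))]

lemma lintegral_realTrace_le (hw : IsAdmissible m G w) (f : NSpace m G) :
    ∫⁻ ξ, ‖realTrace f ξ‖ₑ ^ 2 ∂(refMeasure m G w) ≤
      ENNReal.ofReal (traceConst m w * ‖f‖ ^ 2) := by
  refine (lintegral_mono_ae ?_).trans (lintegral_sqTrace_refMeasure_le hw f)
  filter_upwards [ae_sqTrace_lt_top hw f] with ξ hξ
  obtain ⟨c, hc, hle⟩ := exists_trace_eq hξ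
  rw [realTrace, hc, EReal.toReal_coe, Real.enorm_eq_ofReal_abs,
    ← ENNReal.ofReal_pow (abs_nonneg _), sq_abs]
  exact hle

lemma memLp_realTrace (hw : IsAdmissible m G w) (f : NSpace m G) :
    MemLp (realTrace f) 2 (refMeasure m G w) := by
  refine ⟨aestronglyMeasurable_realTrace hw f, ?_⟩
  rw [eLpNorm_lt_top_iff_lintegral_rpow_enorm_lt_top (by norm_num) (by norm_num)]
  have := (lintegral_realTrace_le hw f).trans_lt ENNReal.ofReal_lt_top
  simpa using this

lemma isTrace_toLp (hw : IsAdmissible m G w) (f : NSpace m G) :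
    IsTrace G w (fn f) ((memLp_realTrace hw f).toLp _) := by
  unfold IsTrace
  filter_upwards [ae_sqTrace_lt_top hw f, (memLp_realTrace hw f).coeFn_toLp] with ξ h1 h2
  rw [h2, coe_realTrace h1]

lemma isTrace_iff_eq (hw : IsAdmissible m G w) {f : NSpace m G} {φ : BoundaryL2 m G w} :
    IsTrace G w (fn f) φ ↔ φ = (memLp_realTrace hw f).toLp _ := by
  constructor
  · intro h
    refine Lp.ext ?_
    filter_upwards [h, isTrace_toLp hw f] with ξ h1 h2
    rw [← h2] at h1
    exact EReal.coe_eq_coe_iff.1 h1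
  · rintro rfl
    exact isTrace_toLp hw f

lemma norm_toLp_realTrace_le (hw : IsAdmissible m G w) (f : NSpace m G) :
    ‖(memLp_realTrace hw f).toLp _‖ ≤ √(traceConst m w) * ‖f‖ := by
  rw [Lp.norm_toLp]
  have h1 := lintegral_realTrace_le hw f
  have h2 : eLpNorm (realTrace f) 2 (refMeasure m G w) ^ 2 =
      ∫⁻ ξ, ‖realTrace f ξ‖ₑ ^ 2 ∂(refMeasure m G w) := by
    have := eLpNorm_nnreal_pow_eq_lintegral (p := 2) (f := realTrace f) (μ := refMeasure m G w)
      (by norm_num)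
    simpa using this
  rw [← h2] at h1
  have h3 := ENNReal.toReal_mono ENNReal.ofReal_ne_top h1
  rw [ENNReal.toReal_pow, ENNReal.toReal_ofReal (mul_nonneg traceConst_nonneg (sq_nonneg _))] at h3
  refine abs_le_of_sq_le_sq' ?_ (by positivity) |>.2
  rw [mul_pow, Real.sq_sqrt traceConst_nonneg]
  exact h3

lemma IsTrace.add {f g : NSpace m G} {φ ψ : BoundaryL2 m G w} (hf : IsTrace G w (fn f) φ)
    (hg : IsTrace G w (fn g) ψ) : IsTrace G w (fn (f + g)) (φ + ψ) := by
  unfold IsTrace at *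
  filter_upwards [hf, hg, Lp.coeFn_add φ ψ] with ξ h1 h2 h3
  rw [h3, Pi.add_apply]
  refine (trace_eq_coe_iff.2 ?_).symm
  refine ((trace_eq_coe_iff.1 h1.symm).add (trace_eq_coe_iff.1 h2.symm)).congr fun x => ?_
  rw [fn_add]

lemma IsTrace.smul (a : ℝ) {f : NSpace m G} {φ : BoundaryL2 m G w} (hf : IsTrace G w (fn f) φ) :
    IsTrace G w (fn (a • f)) (a • φ) := by
  unfold IsTrace at *
  filter_upwards [hf, Lp.coeFn_smul a φ] with ξ h1 h3
  rw [h3, Pi.smul_apply, smul_eq_mul]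
  refine (trace_eq_coe_iff.2 ?_).symm
  refine ((trace_eq_coe_iff.1 h1.symm).const_mul a).congr fun x => ?_
  rw [fn_smul]

lemma IsTrace.ncomp {C : ℝ → ℝ} (hC : LipschitzWith 1 C) (h0 : C 0 = 0) {f : NSpace m G}
    {φ : BoundaryL2 m G w} (hf : IsTrace G w (fn f) φ) :
    IsTrace G w (fn (ncomp hC h0 f)) (hC.compLp h0 φ) := by
  unfold IsTrace at *
  filter_upwards [hf, hC.coeFn_compLp h0 φ] with ξ h1 h3
  rw [h3, Function.comp_apply]
  refine (trace_eq_coe_iff.2 ?_).symm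
  refine ((hC.continuous.tendsto _).comp (trace_eq_coe_iff.1 h1.symm)).congr fun x => ?_
  rw [fn_ncomp_apply, Function.comp_apply]

/-- The trace operator `γ : D(Q^(N)) → L²(∂X)`. -/
def traceOp (hw : IsAdmissible m G w) : NSpace m G →L[ℝ] BoundaryL2 m G w :=
  LinearMap.mkContinuous
    { toFun := fun f => (memLp_realTrace hw f).toLp _
      map_add' := fun f g =>
        ((isTrace_iff_eq hw).1 ((isTrace_toLp hw f).add (isTrace_toLp hw g))).symm
      map_smul' := fun a f => ((isTrace_iff_eq hw).1 ((isTrace_toLp hw f).smul a)).symm }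
    (√(traceConst m w)) (norm_toLp_realTrace_le hw)

lemma isTrace_iff (hw : IsAdmissible m G w) {f : NSpace m G} {φ : BoundaryL2 m G w} :
    IsTrace G w (fn f) φ ↔ φ = traceOp hw f := isTrace_iff_eq hw

lemma isTrace_traceOp (hw : IsAdmissible m G w) (f : NSpace m G) :
    IsTrace G w (fn f) (traceOp hw f) := isTrace_toLp hw f

lemma traceOp_ncomp (hw : IsAdmissible m G w) {C : ℝ → ℝ} (hC : LipschitzWith 1 C) (h0 : C 0 = 0)
    (f : NSpace m G) : traceOp hw (ncomp hC h0 f) = hC.compLp h0 (traceOp hw f) :=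
  ((isTrace_iff hw).1 ((isTrace_traceOp hw f).ncomp hC h0)).symm

/-- Harmonicity at a zero `c` of a nonnegative `h` reads `∑ b(c,z) h(z) = 0`, so `h` vanishes at all
neighbours of `c`. -/
lemma eq_zero_of_connected {h : NSpace m G} (hh : h ∈ (dirSub m G)ᗮ) (h0 : ∀ x, 0 ≤ fn h x)
    {x y : X} (hxy : G.Connected x y) (hy : fn h y = 0) : fn h x = 0 := by
  refine Relation.ReflTransGen.head_induction_on hxy hy fun {a c} hac _ hc => ?_
  have h1 := mem_dirSub_orthogonal_iff.1 hh c
  rw [inner_ndelta, hc, mul_zero, add_zero] at h1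
  simp only [zero_sub, mul_neg] at h1
  rw [tsum_neg, neg_eq_zero] at h1
  have h2 := (summable_row_mul_abs h c).congr fun z => by rw [abs_of_nonneg (h0 z)]
  have h3 := (hasSum_zero_iff_of_nonneg fun z => mul_nonneg (G.nonneg c z) (h0 z)).1
    (h1 ▸ h2.hasSum)
  have h4 : G.b c a * fn h a = 0 := congrFun h3 a
  rcases mul_eq_zero.1 h4 with h5 | h5
  · rw [G.symm] at h5
    exact absurd h5 hac.ne'
  · exact h5

variable [Countable X]

/-- The harmonic part of `|f|` at `x` is the integral of the trace of `|f|` against `μ_x`. It is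
nonnegative and vanishes where `w` is positive, a set that meets every component, hence it vanishes
everywhere. It dominates the harmonic part of `f`. -/
lemma mem_dirSub_of_ae_zero (hw : IsAdmissible m G w) (f : BddDom m G)
    (h : ∀ᵐ ξ ∂(refMeasure m G w), Royden.extend f ξ.1 = 0) : ofBdd f ∈ dirSub m G := by
  obtain ⟨K, hK⟩ := f.2.2
  set a := ncomp lipschitzWith_one_norm norm_zero (ofBdd f) with ha
  have hab : ∃ K : ℝ, ∀ x, |fn a x| ≤ K := ⟨K, fun x => by
    rw [ha, fn_ncomp_apply, Real.norm_eq_abs, abs_abs]; exact hK x⟩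
  set F := mkBdd a hab
  have hF : ∀ ξ : Boundary m G, Royden.extend F ξ.1 = |Royden.extend f ξ.1| := by
    intro ξ
    refine extend_eq_of_tendsto ?_
    refine (tendsto_extend f ξ.1).abs.congr fun x => ?_
    rw [mkBdd_val, ha, fn_ncomp_apply, Real.norm_eq_abs, fn_ofBdd]
  have hrepr : ∀ x, fn (harm a) x = ∫ ξ, |Royden.extend f ξ.1| ∂(harmonicMeasure m G x) := by
    intro x
    have := integral_extend F x
    simp only [hF] at this
    exact this.symm
  have h0 : ∀ x, 0 ≤ fn (harm a) x := fun x => by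
    rw [hrepr]; exact integral_nonneg fun ξ => abs_nonneg _
  rw [refMeasure, Measure.ae_sum_iff] at h
  have hz : ∀ x, fn (harm a) x = 0 := by
    intro x
    obtain ⟨y, hxy, hy⟩ := hw.meets x
    refine eq_zero_of_connected (harm_mem a) h0 hxy ?_
    have h1 := h y
    rw [Measure.ae_ennreal_smul_measure_iff (by simpa using hy.ne')] at h1
    rw [hrepr]
    refine integral_eq_zero_of_ae ?_
    filter_upwards [h1] with ξ hξ
    rw [hξ, abs_zero, Pi.zero_apply]
  rw [← harm_eq_zero_iff]
  refine fn_ext fun x => ?_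
  rw [fn_zero, ← integral_extend, ← abs_nonpos_iff]
  refine abs_integral_le_integral_abs.trans ?_
  rw [← hrepr, hz]

/-- The kernel of the trace operator is `D(Q^(D))`. -/
lemma traceOp_eq_zero_iff (hw : IsAdmissible m G w) {f : NSpace m G} :
    traceOp hw f = 0 ↔ f ∈ dirSub m G := by
  rw [eq_comm, ← isTrace_iff]
  constructor
  · intro h
    -- The truncations have trace zero almost everywhere, stay bounded in norm by `‖f‖`, and
    -- converge to `f` in `ℓ²`.
    refine mem_dirSub_of_bounded (u := fun n : ℕ => ntrunc n f) (K := ‖f‖)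
      (fun n => norm_ncomp_le _ _ _) (fun n => ?_) ?_
    · refine mem_dirSub_of_ae_zero hw (mkBdd (ntrunc n f) (ntrunc_bdd n f)) ?_
      filter_upwards [h, Lp.coeFn_zero ℝ 2 (refMeasure m G w)] with ξ h1 h2
      rw [h2, Pi.zero_apply] at h1
      have h3 := truncTrace_of_trace_eq h1.symm n
      rw [clamp_zero (Nat.cast_nonneg n)] at h3
      exact h3
    · refine ell2_tendsto_of_dominated (g := fn f) (fun n x => ?_) (fun x => le_rfl) fun x => ?_
      · rw [fn_ntrunc]
        exact abs_le_of_lipschitz (lipschitz_clamp _) (clamp_zero (NNReal.coe_nonneg _)) _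
      · refine tendsto_const_nhds.congr' ?_
        obtain ⟨N, hN⟩ := exists_nat_ge |fn f x|
        filter_upwards [eventually_ge_atTop N] with n hn
        rw [fn_ntrunc, NNReal.coe_natCast, clamp_eq_self (hN.trans (Nat.cast_le.2 hn))]
  · intro h
    unfold IsTrace
    filter_upwards [Lp.coeFn_zero ℝ 2 (refMeasure m G w)] with ξ h2
    rw [h2, Pi.zero_apply]
    exact (trace_eq_coe_iff.2 (tendsto_zero_of_mem_dirSub h ξ)).symm

lemma traceOp_eq_iff (hw : IsAdmissible m G w) {f g : NSpace m G} :
    traceOp hw f = traceOp hw g ↔ harm f = harm g := by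
  rw [← sub_eq_zero, ← map_sub, traceOp_eq_zero_iff, ← harm_eq_zero_iff, map_sub, sub_eq_zero]

lemma traceOp_harm (hw : IsAdmissible m G w) (f : NSpace m G) :
    traceOp hw (harm f) = traceOp hw f :=
  (traceOp_eq_iff hw).2 (harm_eq_self (harm_mem f))

/-- `harm f` is the only harmonic function with this trace class, so the choice in `harmonicExt` is
forced. -/
lemma harmonicExt_traceOp (hw : IsAdmissible m G w) (f : NSpace m G) :
    harmonicExt G w (traceOp hw f) = fn (harm f) := by
  have hex : ∃ u : ell2 m, u ∈ (neumannForm m G).dom ∧ IsHarmonic m G u ∧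
      IsTrace G w u (traceOp hw f) :=
    ⟨fn (harm f), Form.incl_mem _ _, isHarmonic_iff.2 (harm_mem f), by
      rw [← traceOp_harm]; exact isTrace_traceOp hw _⟩
  rw [harmonicExt, dif_pos hex]
  obtain ⟨h1, h2, h3⟩ := hex.choose_spec
  obtain ⟨u, hu⟩ := exists_fn_eq h1
  rw [← hu] at h2 h3 ⊢
  rw [isTrace_iff hw, traceOp_eq_iff, harm_eq_self (isHarmonic_iff.1 h2)] at h3
  rw [h3]

end TraceOperator

/-! ### The trace of a Dirichlet form -/

lemma Form.bilin_eq_zero_of_self {E : Type*} [AddCommGroup E] [Module ℝ E] (Q : Form E)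
    {g : Q.dom} (hg : Q.bilin g g = 0) (f : Q.dom) : Q.bilin f g = 0 := by
  by_contra hne
  -- Chosen so that `Q(f + t g) = -1`, contradicting positivity.
  set t : ℝ := -(Q.bilin f f + 1) / (2 * Q.bilin f g) with ht
  have h := Q.nonneg (f + t • g)
  simp only [map_add, LinearMap.add_apply, map_smul, LinearMap.smul_apply, smul_eq_mul] at h
  rw [hg, Q.symm g f] at h
  have e : t * Q.bilin f g = -(Q.bilin f f + 1) / 2 := by
    rw [ht]; field_simp
  linarith

lemma Form.bilin_add_self_of_self {E : Type*} [AddCommGroup E] [Module ℝ E] (Q : Form E)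
    {g : Q.dom} (hg : Q.bilin g g = 0) (f : Q.dom) :
    Q.bilin (f + g) (f + g) = Q.bilin f f := by
  simp only [map_add, LinearMap.add_apply]
  rw [hg, Q.symm g f, Q.bilin_eq_zero_of_self hg f]
  ring

section TraceForm

variable {X : Type*} [MeasurableSpace X] [DiscreteMeasurableSpace X] [Countable X]
  {m : X → Ioi (0 : ℝ)} {G : WGraph X} {w : X → ℝ≥0}

lemma val_fn (f : NSpace m G) : (neumannForm m G).val (fn f) = ENNReal.ofReal (energy G (fn f)) :=
  (neumannForm m G).val_of_mem ((neumannForm m G).toDom f)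

lemma dnForm_traceOp (hw : IsAdmissible m G w) (f : NSpace m G) :
    dnForm m G w (traceOp hw f) = ENNReal.ofReal (‖harm f‖ ^ 2) := by
  rw [dnForm, traceForm, if_pos ⟨fn f, Form.incl_mem _ _, isTrace_traceOp hw f⟩,
    harmonicExt_traceOp]
  exact (neumannForm m G).val₁_eq ((neumannForm m G).toDom (harm f))

lemma toReal_dnForm_traceOp (hw : IsAdmissible m G w) (f : NSpace m G) :
    (dnForm m G w (traceOp hw f)).toReal = ‖harm f‖ ^ 2 := by
  rw [dnForm_traceOp, ENNReal.toReal_ofReal (sq_nonneg _)]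

lemma exists_traceOp_eq_of_dnForm_ne_top (hw : IsAdmissible m G w) {φ : BoundaryL2 m G w}
    (h : dnForm m G w φ ≠ ⊤) : ∃ f, traceOp hw f = φ := by
  by_contra hc
  refine h ?_
  rw [dnForm, traceForm, if_neg]
  rintro ⟨f, hf, hφ⟩
  obtain ⟨f, rfl⟩ := exists_fn_eq hf
  exact hc ⟨f, ((isTrace_iff hw).1 hφ).symm⟩

/-! ### The trace form of an extension of `Q^(D)`. -/

section Extension

variable {Q : Form (ell2 m)}

lemma fn_mem_of_mem_dirSub (h : Q.Extends (dirichletForm m G)) {f : NSpace m G}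
    (hf : f ∈ dirSub m G) : fn f ∈ Q.dom := h.choose (mem_dirSub_iff.1 hf)

lemma fn_harm_mem (h : Q.Extends (dirichletForm m G)) {f : NSpace m G}
    (hf : fn f ∈ Q.dom) : fn (harm f) ∈ Q.dom := by
  have h1 := Q.dom.sub_mem hf (fn_mem_of_mem_dirSub h (sub_harm_mem f))
  rwa [← map_sub, sub_sub_cancel] at h1

lemma val_of_mem_dirSub (h : Q.Extends (dirichletForm m G)) {f : NSpace m G}
    (hf : f ∈ dirSub m G) : Q.val (fn f) = ENNReal.ofReal (energy G (fn f)) := by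
  rw [h.val_eq (mem_dirSub_iff.1 hf), (dirichletForm m G).val_of_mem ⟨_, mem_dirSub_iff.1 hf⟩]
  rfl

/-- The form `Q - Q^(N)` on `D(Q)`. -/
@[reducible] def diffForm (hQ : Q.IsClosed) (hM : Q.IsMarkovian) (hd : finSupp m ≤ Q.dom)
    (h : Q.Extends (dirichletForm m G)) : Form (ell2 m) where
  dom := Q.dom
  bilin := Q.bilin - (neumannForm m G).bilin.compl₁₂
    (Submodule.inclusion (dom_le_neumann_of_extends hQ hM hd h))
    (Submodule.inclusion (dom_le_neumann_of_extends hQ hM hd h))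
  symm f g := by
    simp only [LinearMap.sub_apply, LinearMap.compl₁₂_apply]
    rw [Q.symm, (neumannForm m G).symm]
  nonneg f := by
    simp only [LinearMap.sub_apply, LinearMap.compl₁₂_apply]
    exact sub_nonneg.2 (energy_le_of_extends hQ hM hd h f)

/-- `Q - Q^(N)` is a nonnegative form vanishing on `D(Q^(D))`, so these functions lie in its
radical, and `f - harm f` is one of them. -/
lemma diffForm_harm (hQ : Q.IsClosed) (hM : Q.IsMarkovian) (hd : finSupp m ≤ Q.dom)
    (h : Q.Extends (dirichletForm m G)) {f : NSpace m G} (hf : fn f ∈ Q.dom) :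
    (Q.val (fn (harm f))).toReal - energy G (fn (harm f)) =
      (Q.val (fn f)).toReal - energy G (fn f) := by
  set B := diffForm hQ hM hd h with hB
  have hval : ∀ {g : NSpace m G} (hg : fn g ∈ Q.dom),
      B.bilin ⟨fn g, hg⟩ ⟨fn g, hg⟩ = (Q.val (fn g)).toReal - energy G (fn g) := by
    intro g hg
    rw [Q.toReal_val ⟨fn g, hg⟩]
    rfl
  set r := f - harm f with hr
  have hrm : r ∈ dirSub m G := sub_harm_mem f
  have hrQ := fn_mem_of_mem_dirSub h hrm
  have h0 : B.bilin ⟨fn r, hrQ⟩ ⟨fn r, hrQ⟩ = 0 := by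
    rw [hval, val_of_mem_dirSub h hrm, ENNReal.toReal_ofReal (energy_nonneg _), sub_self]
  have h1 := B.bilin_add_self_of_self h0 ⟨fn (harm f), fn_harm_mem h hf⟩
  rw [hval (fn_harm_mem h hf)] at h1
  rw [← h1, ← hval hf]
  have e : (⟨fn (harm f), fn_harm_mem h hf⟩ + ⟨fn r, hrQ⟩ : B.dom) = ⟨fn f, hf⟩ :=
    Subtype.ext (by
      change fn (harm f) + fn r = fn f
      rw [← map_add, hr, add_sub_cancel])
  rw [e]

/-- A function in `D(Q)` with a given trace. -/
def traceRep (hw : IsAdmissible m G w) (φ : (Q.dom.comap (fn (m := m) (G := G)).toLinearMap).map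
    (traceOp hw).toLinearMap) : NSpace m G := (Submodule.mem_map.1 φ.2).choose

lemma fn_traceRep_mem (hw : IsAdmissible m G w)
    (φ : (Q.dom.comap (fn (m := m) (G := G)).toLinearMap).map (traceOp hw).toLinearMap) :
    fn (traceRep hw φ) ∈ Q.dom := (Submodule.mem_map.1 φ.2).choose_spec.1

lemma traceOp_traceRep (hw : IsAdmissible m G w)
    (φ : (Q.dom.comap (fn (m := m) (G := G)).toLinearMap).map (traceOp hw).toLinearMap) :
    traceOp hw (traceRep hw φ) = φ := (Submodule.mem_map.1 φ.2).choose_spec.2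

/-- The canonical lift of the domain of the trace form to the harmonic functions in `D(Q)`. -/
def traceLift (hw : IsAdmissible m G w) (h : Q.Extends (dirichletForm m G)) :
    (Q.dom.comap (fn (m := m) (G := G)).toLinearMap).map (traceOp hw).toLinearMap →ₗ[ℝ] Q.Space where
  toFun φ := Q.toSpace ⟨fn (harm (traceRep hw φ)), fn_harm_mem h (fn_traceRep_mem hw φ)⟩
  map_add' φ ψ := by
    rw [← map_add]
    refine congrArg _ (Subtype.ext ?_)
    change fn (harm (traceRep hw (φ + ψ))) = fn (harm (traceRep hw φ)) + fn (harm (traceRep hw ψ))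
    rw [← map_add, ← map_add]
    refine congrArg _ ((traceOp_eq_iff hw).1 ?_)
    rw [map_add, traceOp_traceRep, traceOp_traceRep, traceOp_traceRep, Submodule.coe_add]
  map_smul' a φ := by
    rw [RingHom.id_apply, ← map_smul]
    refine congrArg _ (Subtype.ext ?_)
    change fn (harm (traceRep hw (a • φ))) = a • fn (harm (traceRep hw φ))
    rw [← map_smul, ← map_smul]
    refine congrArg _ ((traceOp_eq_iff hw).1 ?_)
    rw [map_smul, traceOp_traceRep, traceOp_traceRep, Submodule.coe_smul]

/-- The trace form `Tr Q`. -/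
@[reducible] def trForm (hw : IsAdmissible m G w) (h : Q.Extends (dirichletForm m G)) :
    Form (BoundaryL2 m G w) where
  dom := (Q.dom.comap (fn (m := m) (G := G)).toLinearMap).map (traceOp hw).toLinearMap
  bilin := (innerₗ Q.Space).compl₁₂ (traceLift hw h) (traceLift hw h)
  symm φ ψ := by
    simp only [LinearMap.compl₁₂_apply, innerₗ_apply_apply]
    rw [real_inner_comm]
  nonneg φ := by
    simp only [LinearMap.compl₁₂_apply, innerₗ_apply_apply]
    exact real_inner_self_nonneg

variable (hw : IsAdmissible m G w) (h : Q.Extends (dirichletForm m G))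

lemma traceOp_mem_trForm {f : NSpace m G} (hf : fn f ∈ Q.dom) :
    traceOp hw f ∈ (trForm hw h).dom := ⟨f, hf, rfl⟩

lemma traceLift_traceOp {f : NSpace m G} (hf : fn f ∈ Q.dom) :
    traceLift hw h ⟨traceOp hw f, traceOp_mem_trForm hw h hf⟩ =
      Q.toSpace ⟨fn (harm f), fn_harm_mem h hf⟩ := by
  refine Q.incl_injective ?_
  change fn (harm (traceRep hw _)) = fn (harm f)
  exact congrArg _ ((traceOp_eq_iff hw).1 (traceOp_traceRep hw _))

lemma trForm_bilin (φ ψ : (trForm hw h).dom) :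
    (trForm hw h).bilin φ ψ = inner ℝ (traceLift hw h φ) (traceLift hw h ψ) := rfl

lemma trForm_val_traceOp {f : NSpace m G} (hf : fn f ∈ Q.dom) :
    (trForm hw h).val (traceOp hw f) = Q.val₁ (fn (harm f)) := by
  rw [(trForm hw h).val_of_mem ⟨_, traceOp_mem_trForm hw h hf⟩, trForm_bilin,
    traceLift_traceOp hw h hf, real_inner_self_eq_norm_sq]
  exact (Q.val₁_eq ⟨fn (harm f), fn_harm_mem h hf⟩).symm

lemma toReal_trForm_val_traceOp {f : NSpace m G} (hf : fn f ∈ Q.dom) :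
    ((trForm hw h).val (traceOp hw f)).toReal =
      (Q.val (fn (harm f))).toReal + ‖fn (harm f)‖ ^ 2 := by
  rw [trForm_val_traceOp hw h hf, Form.val₁, ENNReal.toReal_add
    (Q.mem_dom_iff.1 (fn_harm_mem h hf)) ENNReal.ofReal_ne_top,
    ENNReal.toReal_ofReal (sq_nonneg _)]

lemma trForm_val (hle : Q.dom ≤ (neumannForm m G).dom) :
    (trForm hw h).val = traceForm G w Q := by
  funext φ
  by_cases hφ : φ ∈ (trForm hw h).dom
  · obtain ⟨f, hf, rfl⟩ := hφ
    change (trForm hw h).val (traceOp hw f) = traceForm G w Q (traceOp hw f)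
    rw [trForm_val_traceOp hw h hf, traceForm, if_pos ⟨fn f, hf, isTrace_traceOp hw f⟩,
      harmonicExt_traceOp]
  · rw [(trForm hw h).val_of_notMem hφ, traceForm, if_neg]
    rintro ⟨f, hf, hf'⟩
    obtain ⟨f, rfl⟩ := exists_fn_eq (hle hf)
    rw [(isTrace_iff hw).1 hf'] at hφ
    exact hφ (traceOp_mem_trForm hw h hf)

/-- The `ℓ²`-norms of `harm f` cancel between `Q₁` and `Q^(N)₁`. What remains is `Q - Q^(N)` at
`harm f`, which agrees with its value at `f`. -/
lemma toReal_trForm_sub_dnForm (hQ : Q.IsClosed) (hM : Q.IsMarkovian)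
    (hd : finSupp m ≤ Q.dom) {f : NSpace m G} (hf : fn f ∈ Q.dom) :
    ((trForm hw h).val (traceOp hw f)).toReal - (dnForm m G w (traceOp hw f)).toReal =
      (Q.val (fn f)).toReal - energy G (fn f) := by
  rw [toReal_trForm_val_traceOp hw h hf, toReal_dnForm_traceOp, neumann_norm_sq,
    ← diffForm_harm hQ hM hd h hf]
  ring

lemma dnForm_le_trForm (hQ : Q.IsClosed) (hM : Q.IsMarkovian)
    (hd : finSupp m ≤ Q.dom) (φ : BoundaryL2 m G w) : dnForm m G w φ ≤ (trForm hw h).val φ := by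
  by_cases hφ : φ ∈ (trForm hw h).dom
  · obtain ⟨f, hf, rfl⟩ := hφ
    change dnForm m G w (traceOp hw f) ≤ (trForm hw h).val (traceOp hw f)
    rw [trForm_val_traceOp hw h hf, dnForm_traceOp, neumann_norm_sq,
      ENNReal.ofReal_add (energy_nonneg _) (sq_nonneg _), Form.val₁]
    gcongr
    rw [Q.val_of_mem ⟨_, fn_harm_mem h hf⟩]
    exact ENNReal.ofReal_le_ofReal (energy_le_of_extends hQ hM hd h ⟨_, fn_harm_mem h hf⟩)
  · rw [(trForm hw h).val_of_notMem hφ]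
    exact le_top

lemma trForm_sub_comp_le (hQ : Q.IsClosed) (hM : Q.IsMarkovian)
    (hd : finSupp m ≤ Q.dom) {C : ℝ → ℝ} (hC : LipschitzWith 1 C) (h0 : C 0 = 0)
    {φ : BoundaryL2 m G w} (hφ : φ ∈ (trForm hw h).dom) :
    hC.compLp h0 φ ∈ (trForm hw h).dom ∧
      ((trForm hw h).val (hC.compLp h0 φ)).toReal - (dnForm m G w (hC.compLp h0 φ)).toReal ≤
        ((trForm hw h).val φ).toReal - (dnForm m G w φ).toReal := by
  obtain ⟨f, hf, rfl⟩ := hφ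
  change hC.compLp h0 (traceOp hw f) ∈ (trForm hw h).dom ∧
      ((trForm hw h).val (hC.compLp h0 (traceOp hw f))).toReal -
        (dnForm m G w (hC.compLp h0 (traceOp hw f))).toReal ≤
      ((trForm hw h).val (traceOp hw f)).toReal - (dnForm m G w (traceOp hw f)).toReal
  have hf' : fn f ∈ Q.dom := hf
  have hCf : fn (ncomp hC h0 f) ∈ Q.dom := by
    rw [fn_ncomp]; exact hM.comp_mem hC h0 ⟨fn f, hf'⟩
  rw [← traceOp_ncomp]
  refine ⟨traceOp_mem_trForm hw h hCf, ?_⟩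
  rw [toReal_trForm_sub_dnForm hw h hQ hM hd hf', toReal_trForm_sub_dnForm hw h hQ hM hd hCf]
  have h1 := sub_energy_comp_le hQ hM hd h hC h0 ⟨fn f, hf'⟩
  rw [Q.toReal_val ⟨fn f, hf'⟩, Q.toReal_val ⟨_, hCf⟩]
  have e : (⟨_, hCf⟩ : Q.dom) = hM.comp hC h0 ⟨fn f, hf'⟩ := Subtype.ext (fn_ncomp hC h0 f)
  rw [e]
  dsimp only at h1 ⊢
  rw [← fn_ncomp] at h1
  exact h1

/-- The harmonic part has the least norm among functions with a given trace, and `C ∘ harm f` is a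
competitor for the trace `C ∘ γ f`. Thus `q^{DN}` is itself Markovian, and adding it to `Tr Q -
q^{DN}` gives the Markov property of `Tr Q`. -/
lemma toReal_dnForm_comp_le {C : ℝ → ℝ} (hC : LipschitzWith 1 C) (h0 : C 0 = 0) (f : NSpace m G) :
    (dnForm m G w (hC.compLp h0 (traceOp hw f))).toReal ≤
      (dnForm m G w (traceOp hw f)).toReal := by
  have e : hC.compLp h0 (traceOp hw f) = traceOp hw (ncomp hC h0 (harm f)) := by
    rw [traceOp_ncomp, traceOp_harm]
  rw [e, toReal_dnForm_traceOp, toReal_dnForm_traceOp]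
  exact pow_le_pow_left₀ (norm_nonneg _) ((norm_harm_le _).trans (norm_ncomp_le _ _ _)) 2

lemma trForm_isMarkovian (hQ : Q.IsClosed) (hM : Q.IsMarkovian)
    (hd : finSupp m ≤ Q.dom) : (trForm hw h).IsMarkovian := by
  intro C hC h0 φ
  by_cases hφ : φ ∈ (trForm hw h).dom
  · obtain ⟨h1, h2⟩ := trForm_sub_comp_le hw h hQ hM hd hC h0 hφ
    rw [← ENNReal.toReal_le_toReal ((trForm hw h).mem_dom_iff.1 h1)
      ((trForm hw h).mem_dom_iff.1 hφ)]
    obtain ⟨f, hf, rfl⟩ := hφ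
    have h3 := toReal_dnForm_comp_le hw hC h0 f
    have h2' : ((trForm hw h).val (hC.compLp h0 (traceOp hw f))).toReal -
        (dnForm m G w (hC.compLp h0 (traceOp hw f))).toReal ≤
        ((trForm hw h).val (traceOp hw f)).toReal - (dnForm m G w (traceOp hw f)).toReal := h2
    change ((trForm hw h).val (hC.compLp h0 (traceOp hw f))).toReal ≤
      ((trForm hw h).val (traceOp hw f)).toReal
    linarith
  · rw [(trForm hw h).val_of_notMem hφ]
    exact le_top

/-- The inclusion of the form space of `Q ≥ Q^(N)` in that of `Q^(N)`. -/
def toNeumann (hle : Q.dom ≤ (neumannForm m G).dom)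
    (hen : ∀ f : Q.dom, energy G (f : ell2 m) ≤ Q.bilin f f) : Q.Space →L[ℝ] NSpace m G :=
  LinearMap.mkContinuous
    ((neumannForm m G).toSpace.toLinearMap ∘ₗ Submodule.inclusion hle ∘ₗ Q.toDom.toLinearMap) 1
    (by
      intro f
      rw [one_mul]
      refine abs_le_of_sq_le_sq' ?_ (norm_nonneg _) |>.2
      have h1 := Q.norm_sq (Q.toDom f)
      have h2 := neumann_norm_sq ((neumannForm m G).toSpace (Submodule.inclusion hle (Q.toDom f)))
      have h3 := hen (Q.toDom f)
      have h4 : ‖f‖ ^ 2 = _ := h1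
      change ‖(neumannForm m G).toSpace (Submodule.inclusion hle (Q.toDom f))‖ ^ 2 ≤ ‖f‖ ^ 2
      rw [h4, h2]
      exact add_le_add h3 le_rfl)

lemma fn_toNeumann (hle : Q.dom ≤ (neumannForm m G).dom)
    (hen : ∀ f : Q.dom, energy G (f : ell2 m) ≤ Q.bilin f f) (f : Q.Space) :
    fn (toNeumann hle hen f) = Q.incl f := rfl

/-- The harmonic lifts of a Cauchy sequence converge in the complete space `D(Q)`. As `Q ≥ Q^(N)`,
they also converge in `D(Q^(N))`, so the limit is harmonic, and continuity of `γ` identifies its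
trace with the limit in `L²(∂X)`. -/
lemma trForm_isClosed (hQ : Q.IsClosed) (hM : Q.IsMarkovian)
    (hd : finSupp m ≤ Q.dom) : (trForm hw h).IsClosed := by
  rw [Form.isClosed_iff]
  have hQc : CompleteSpace Q.Space := Q.isClosed_iff.1 hQ
  set q := trForm hw h with hq
  set J := toNeumann (dom_le_neumann_of_extends hQ hM hd h) (energy_le_of_extends hQ hM hd h) with hJ
  have hJl : ∀ φ : q.dom, J (traceLift hw h φ) ∈ (dirSub m G)ᗮ ∧
      traceOp hw (J (traceLift hw h φ)) = φ.1 := by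
    rintro ⟨_, f, hf, rfl⟩
    have e : J (traceLift hw h ⟨traceOp hw f, traceOp_mem_trForm hw h hf⟩) = harm f := by
      rw [traceLift_traceOp hw h hf]
      rfl
    change J (traceLift hw h ⟨traceOp hw f, traceOp_mem_trForm hw h hf⟩) ∈ (dirSub m G)ᗮ ∧
      traceOp hw (J (traceLift hw h ⟨traceOp hw f, traceOp_mem_trForm hw h hf⟩)) = traceOp hw f
    rw [e]
    exact ⟨harm_mem f, traceOp_harm hw f⟩
  have hnorm : ∀ φ : q.dom, ‖q.toSpace φ‖ ^ 2 =
      ‖traceLift hw h φ‖ ^ 2 + ‖(φ : BoundaryL2 m G w)‖ ^ 2 := by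
    intro φ
    rw [q.norm_sq, trForm_bilin, real_inner_self_eq_norm_sq]
  let L : q.Space →L[ℝ] Q.Space := LinearMap.mkContinuous
    (traceLift hw h ∘ₗ q.toDom.toLinearMap) 1 (by
      intro φ
      rw [one_mul]
      refine abs_le_of_sq_le_sq' ?_ (norm_nonneg _) |>.2
      have h1 : ‖φ‖ ^ 2 = ‖traceLift hw h (q.toDom φ)‖ ^ 2 +
        ‖((q.toDom φ : q.dom) : BoundaryL2 m G w)‖ ^ 2 := hnorm (q.toDom φ)
      rw [h1]
      exact le_add_of_nonneg_right (sq_nonneg _))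
  have hL : ∀ φ : q.Space, L φ = traceLift hw h (q.toDom φ) := fun φ => rfl
  refine Metric.complete_of_cauchySeq_tendsto fun u hu => ?_
  obtain ⟨v, hv⟩ := cauchySeq_tendsto_of_complete (L.uniformContinuous.comp_cauchySeq hu)
  have hJv : Tendsto (fun n => J (L (u n))) atTop (𝓝 (J v)) := (J.continuous.tendsto v).comp hv
  have hJm : J v ∈ (dirSub m G)ᗮ :=
    (Submodule.isClosed_orthogonal _).mem_of_tendsto hJv
      (Eventually.of_forall fun n => (hJl (q.toDom (u n))).1)
  have hlim : Tendsto (fun n => q.incl (u n)) atTop (𝓝 (traceOp hw (J v))) := by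
    refine (((traceOp hw).continuous.tendsto (J v)).comp hJv).congr fun n => ?_
    exact (hJl (q.toDom (u n))).2
  have hvQ : fn (J v) ∈ Q.dom := by
    rw [hJ, fn_toNeumann]; exact Q.incl_mem v
  set φ : q.Space := q.toSpace ⟨traceOp hw (J v), traceOp_mem_trForm hw h hvQ⟩ with hφ
  have hLφ : L φ = v := by
    have h1 : L φ = Q.toSpace ⟨fn (harm (J v)), fn_harm_mem h hvQ⟩ := traceLift_traceOp hw h hvQ
    rw [h1]
    refine Q.incl_injective ?_
    rw [Q.incl_toSpace]
    dsimp only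
    rw [harm_eq_self hJm, hJ, fn_toNeumann]
  refine ⟨φ, ?_⟩
  rw [tendsto_iff_norm_sub_tendsto_zero]
  have h1 : ∀ n, ‖u n - φ‖ ^ 2 = ‖L (u n) - v‖ ^ 2 + ‖q.incl (u n) - traceOp hw (J v)‖ ^ 2 := by
    intro n
    have h2 : ‖u n - φ‖ ^ 2 = ‖L (u n - φ)‖ ^ 2 + ‖q.incl (u n - φ)‖ ^ 2 :=
      hnorm (q.toDom (u n - φ))
    rw [h2, map_sub, map_sub, hLφ]
    rfl
  have h2 : Tendsto (fun n => ‖u n - φ‖ ^ 2) atTop (𝓝 0) := by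
    have h3 := ((tendsto_iff_norm_sub_tendsto_zero.1 hv).pow 2).add
      ((tendsto_iff_norm_sub_tendsto_zero.1 hlim).pow 2)
    simp only [ne_eq, OfNat.ofNat_ne_zero, not_false_eq_true, zero_pow, add_zero] at h3
    exact h3.congr fun n => (h1 n).symm
  have h3 := h2.sqrt
  simpa [Real.sqrt_sq] using h3

/-- The trace of a Dirichlet form extending `Q^(D)` belongs to `Tr 𝔇(b,0)` and represents it. -/
theorem exists_traceForm_of_extends (hw : IsAdmissible m G w)
    (h : Q.Extends (dirichletForm m G)) (hQD : Q ∈ discreteForms m) :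
    ∃ q ∈ traceForms m G w, q.val = traceForm G w Q ∧ Represents G w q Q := by
  obtain ⟨⟨-, hQ, hM⟩, hd⟩ := hQD
  have hle := dom_le_neumann_of_extends hQ hM hd h
  refine ⟨trForm hw h, ⟨⟨trForm_isClosed hw h hQ hM hd, trForm_isMarkovian hw h hQ hM hd⟩,
    dnForm_le_trForm hw h hQ hM hd,
    fun C hC h0 φ hφ => trForm_sub_comp_le hw h hQ hM hd hC h0 hφ⟩, trForm_val hw h hle, hle, ?_⟩
  intro f hf
  obtain ⟨f, rfl⟩ := exists_fn_eq (hle hf)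
  refine ⟨traceOp hw f, traceOp_mem_trForm hw h hf, isTrace_traceOp hw f, ?_⟩
  have h1 := toReal_trForm_sub_dnForm hw h hQ hM hd hf
  rw [val_fn, ENNReal.toReal_ofReal (energy_nonneg _)]
  linarith

end Extension

end TraceForm

/-! ### Dirichlet forms with a given trace -/

section Representation

variable {X : Type*} [MeasurableSpace X] [DiscreteMeasurableSpace X] [Countable X]
  {m : X → Ioi (0 : ℝ)} {G : WGraph X} {w : X → ℝ≥0}

lemma Form.val_zero {E : Type*} [AddCommGroup E] [Module ℝ E] (Q : Form E) : Q.val 0 = 0 := by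
  have := Q.val_of_mem 0
  rw [map_zero, ENNReal.ofReal_zero] at this
  exact this

lemma dnForm_zero (hw : IsAdmissible m G w) : dnForm m G w 0 = 0 := by
  have := dnForm_traceOp hw 0
  rwa [map_zero, map_zero, norm_zero, zero_pow two_ne_zero, ENNReal.ofReal_zero] at this

/-- A Dirichlet form represented by some `q ∈ Tr 𝔇(b,0)` is an extension of `Q^(D)`. -/
theorem extends_of_represents (hw : IsAdmissible m G w) {Q : Form (ell2 m)}
    (hQD : Q ∈ discreteForms m) {q : Form (BoundaryL2 m G w)} (hr : Represents G w q Q) :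
    Q.Extends (dirichletForm m G) := by
  obtain ⟨⟨-, hQ, -⟩, hd⟩ := hQD
  have hQc : CompleteSpace Q.Space := Q.isClosed_iff.1 hQ
  -- Functions in `D(Q^(D))` have trace zero, so the boundary correction vanishes.
  have hval : ∀ f : NSpace m G, f ∈ dirSub m G → fn f ∈ Q.dom →
      Q.val (fn f) = (neumannForm m G).val (fn f) := by
    intro f hf hfQ
    obtain ⟨φ, hφ, htr, he⟩ := hr.2 _ hfQ
    rw [isTrace_iff hw, (traceOp_eq_zero_iff hw).2 hf] at htr
    rw [htr, q.val_zero, dnForm_zero hw, ENNReal.toReal_zero, add_zero, sub_zero] at he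
    exact (ENNReal.toReal_eq_toReal_iff' (Q.mem_dom_iff.1 hfQ)
      ((neumannForm m G).mem_dom_iff.1 (Form.incl_mem _ f))).1 he
  have hmem : ∀ f : NSpace m G, f ∈ dirSub m G → fn f ∈ Q.dom := by
    intro f hf
    obtain ⟨u, hu, hlim⟩ := mem_closure_iff_seq_limit.1 (show f ∈ closure _ from hf)
    have hu' : ∀ n, fn (u n) ∈ finSupp m := hu
    set v : ℕ → Q.Space := fun n => Q.toSpace ⟨fn (u n), hd (hu' n)⟩ with hv
    -- The norms of `Q` and `Q^(N)` agree on `C_c(X)`, so approximating sequences from `C_c(X)` are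
    -- Cauchy for `Q` as well; closedness of `Q` puts their limits into `D(Q)`.
    have hdist : ∀ n k, dist (v n) (v k) = dist (u n) (u k) := by
      intro n k
      have hmem : fn (u n - u k) ∈ finSupp m := by
        rw [map_sub]; exact Submodule.sub_mem _ (hu' n) (hu' k)
      have h1 := hval _ (mem_dirSub_of_finSupp hmem) (hd hmem)
      have h2 : v n - v k = Q.toSpace ⟨fn (u n - u k), hd hmem⟩ := by
        refine Q.incl_injective ?_
        rw [map_sub]
        exact (map_sub fn (u n) (u k)).symm
      rw [Q.val_of_mem ⟨_, hd hmem⟩, val_fn,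
        ENNReal.ofReal_eq_ofReal_iff (Q.nonneg _) (energy_nonneg _)] at h1
      have h3 : ‖v n - v k‖ ^ 2 = ‖u n - u k‖ ^ 2 := by
        rw [h2, Q.norm_sq, neumann_norm_sq, h1]
      rw [dist_eq_norm, dist_eq_norm]
      exact (pow_left_inj₀ (norm_nonneg _) (norm_nonneg _) two_ne_zero).1 h3
    have hvc : CauchySeq v := by
      have := hlim.cauchySeq
      rw [Metric.cauchySeq_iff] at this ⊢
      simpa only [hdist] using this
    obtain ⟨g, hg⟩ := cauchySeq_tendsto_of_complete hvc
    have h1 : Tendsto (fun n => Q.incl (v n)) atTop (𝓝 (Q.incl g)) :=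
      (Q.incl.continuous.tendsto g).comp hg
    have h2 : Tendsto (fun n => Q.incl (v n)) atTop (𝓝 (fn f)) :=
      ((fn (m := m) (G := G)).continuous.tendsto f).comp hlim
    rw [← tendsto_nhds_unique h1 h2]
    exact Q.incl_mem g
  refine Form.extends_of_val fun f hf => ?_
  have hfN : f ∈ (neumannForm m G).dom := hf.1
  obtain ⟨f, rfl⟩ := exists_fn_eq hfN
  have hf' := mem_dirSub_iff.2 hf
  rw [hval f hf' (hmem f hf'), (dirichletForm m G).val_of_mem ⟨_, hf⟩, val_fn]
  rfl

/-- A Dirichlet form extending `Q^(D)` is determined by its trace. -/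
lemma mem_and_val_eq_of_traceForm_eq (hw : IsAdmissible m G w) {Q Q' : Form (ell2 m)}
    (hQ : Q ∈ discreteForms m) (hQ' : Q' ∈ discreteForms m) (h : Q.Extends (dirichletForm m G))
    (h' : Q'.Extends (dirichletForm m G)) (he : traceForm G w Q = traceForm G w Q')
    {f : ell2 m} (hf : f ∈ Q.dom) : Q.val f = Q'.val f := by
  obtain ⟨q, -, hq, hr⟩ := exists_traceForm_of_extends hw h hQ
  obtain ⟨q', -, hq', hr'⟩ := exists_traceForm_of_extends hw h' hQ'
  have hqq : q = q' := Form.ext_of_val (by rw [hq, hq', he])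
  subst hqq
  obtain ⟨f, rfl⟩ := exists_fn_eq (hr.1 hf)
  obtain ⟨φ, hφ, htr, hv⟩ := hr.2 _ hf
  -- The common trace domain provides `g ∈ D(Q')` with the same trace as `f`. Then `f - g` lies in
  -- `D(Q^(D))`, which is contained in `D(Q')`.
  have hf' : fn f ∈ Q'.dom := by
    have h1 := q.mem_dom_iff.1 hφ
    rw [hq', traceForm] at h1
    have hex : ∃ g ∈ Q'.dom, IsTrace G w g φ := by
      by_contra hc
      exact h1 (if_neg hc)
    obtain ⟨g, hg, hgt⟩ := hex
    obtain ⟨g, rfl⟩ := exists_fn_eq (hr'.1 hg)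
    rw [isTrace_iff hw] at htr hgt
    have h2 : f - g ∈ dirSub m G := by
      rw [← traceOp_eq_zero_iff hw, map_sub, ← htr, ← hgt, sub_self]
    have h3 := Q'.dom.add_mem (fn_mem_of_mem_dirSub h' h2) hg
    rwa [← map_add, sub_add_cancel] at h3
  obtain ⟨φ', -, htr', hv'⟩ := hr'.2 _ hf'
  rw [isTrace_iff hw] at htr htr'
  rw [htr', ← htr, ← hv] at hv'
  exact ((ENNReal.toReal_eq_toReal_iff' (Q'.mem_dom_iff.1 hf') (Q.mem_dom_iff.1 hf)).1 hv').symm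

theorem eq_of_traceForm_eq (hw : IsAdmissible m G w) {Q Q' : Form (ell2 m)}
    (hQ : Q ∈ discreteForms m) (hQ' : Q' ∈ discreteForms m) (h : Q.Extends (dirichletForm m G))
    (h' : Q'.Extends (dirichletForm m G)) (he : traceForm G w Q = traceForm G w Q') : Q = Q' := by
  refine Form.ext_of_val (funext fun f => ?_)
  by_cases hf : f ∈ Q.dom
  · exact mem_and_val_eq_of_traceForm_eq hw hQ hQ' h h' he hf
  · by_cases hf' : f ∈ Q'.dom
    · exact (mem_and_val_eq_of_traceForm_eq hw hQ' hQ h' h he.symm hf').symm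
    · rw [Q.val_of_notMem hf, Q'.val_of_notMem hf']

/-! ### Construction of a Dirichlet form with prescribed trace. -/

section Construction

variable (hw : IsAdmissible m G w) {q : Form (BoundaryL2 m G w)} (hq : q ∈ traceForms m G w)

lemma norm_harm_sq_le_of_mem (hq : q ∈ traceForms m G w) {f : NSpace m G}
    (hf : traceOp hw f ∈ q.dom) :
    ‖harm f‖ ^ 2 ≤ q.bilin ⟨traceOp hw f, hf⟩ ⟨traceOp hw f, hf⟩ := by
  have h1 := hq.2.1 (traceOp hw f)
  rw [dnForm_traceOp, q.val_of_mem ⟨_, hf⟩] at h1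
  exact (ENNReal.ofReal_le_ofReal_iff (q.nonneg _)).1 h1

/-- The functions in `D(Q^(N))` whose trace belongs to `D(q)`, as a subspace of `ℓ²(X,m)`. -/
def liftDom (q : Form (BoundaryL2 m G w)) : Submodule ℝ (ell2 m) :=
  (q.dom.comap (traceOp hw).toLinearMap).map (fn (m := m) (G := G)).toLinearMap

lemma fn_mem_liftDom {f : NSpace m G} : fn f ∈ liftDom hw q ↔ traceOp hw f ∈ q.dom := by
  constructor
  · rintro ⟨g, hg, he⟩
    have : g = f := (neumannForm m G).incl_injective he
    rw [← this]
    exact hg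
  · intro h
    exact ⟨f, h, rfl⟩

lemma liftDom_le : liftDom hw q ≤ (neumannForm m G).dom := by
  rintro _ ⟨g, -, rfl⟩
  exact Form.incl_mem _ g

/-- The element of the form space of `Q^(N)` given by an element of `liftDom`. -/
def liftN (q : Form (BoundaryL2 m G w)) : liftDom hw q →ₗ[ℝ] NSpace m G :=
  (neumannForm m G).toSpace.toLinearMap ∘ₗ Submodule.inclusion (liftDom_le hw)

lemma fn_liftN (f : liftDom hw q) : fn (liftN hw q f) = f := rfl

lemma liftN_fn {f : NSpace m G} (hf : fn f ∈ liftDom hw q) : liftN hw q ⟨fn f, hf⟩ = f :=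
  (neumannForm m G).incl_injective rfl

/-- The trace of the elements of `liftDom`. -/
def liftTrace (q : Form (BoundaryL2 m G w)) : liftDom hw q →ₗ[ℝ] q.dom :=
  LinearMap.codRestrict q.dom ((traceOp hw).toLinearMap ∘ₗ liftN hw q) fun f =>
    (fn_mem_liftDom hw (f := liftN hw q f)).1 f.2

/-- The form `Q^(N)(f) + q(γ f) - q^{DN}(γ f)`. -/
@[reducible] def liftForm (hq : q ∈ traceForms m G w) : Form (ell2 m) where
  dom := liftDom hw q
  bilin := (neumannForm m G).bilin.compl₁₂ (Submodule.inclusion (liftDom_le hw))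
      (Submodule.inclusion (liftDom_le hw)) + q.bilin.compl₁₂ (liftTrace hw q) (liftTrace hw q) -
    (innerₗ (NSpace m G)).compl₁₂ ((harm (m := m) (G := G)).toLinearMap ∘ₗ liftN hw q)
      ((harm (m := m) (G := G)).toLinearMap ∘ₗ liftN hw q)
  symm f g := by
    simp only [LinearMap.sub_apply, LinearMap.add_apply, LinearMap.compl₁₂_apply,
      innerₗ_apply_apply]
    rw [(neumannForm m G).symm, q.symm, real_inner_comm]
  nonneg f := by
    simp only [LinearMap.sub_apply, LinearMap.add_apply, LinearMap.compl₁₂_apply,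
      innerₗ_apply_apply, real_inner_self_eq_norm_sq]
    have h1 := norm_harm_sq_le_of_mem hw hq ((fn_mem_liftDom hw (f := liftN hw q f)).1 f.2)
    have h2 := (neumannForm m G).nonneg (Submodule.inclusion (liftDom_le hw) f)
    have h3 : ‖harm (liftN hw q f)‖ ^ 2 ≤ q.bilin (liftTrace hw q f) (liftTrace hw q f) := h1
    change 0 ≤ _ + _ - ‖harm (liftN hw q f)‖ ^ 2
    linarith

lemma liftForm_bilin_self (f : liftDom hw q) :
    (liftForm hw hq).bilin f f = energy G (fn (liftN hw q f)) +
      q.bilin (liftTrace hw q f) (liftTrace hw q f) - ‖harm (liftN hw q f)‖ ^ 2 := by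
  rw [← real_inner_self_eq_norm_sq]
  rfl

lemma liftForm_bilin_ge (f : liftDom hw q) :
    energy G (f : ell2 m) ≤ (liftForm hw hq).bilin f f := by
  rw [liftForm_bilin_self, fn_liftN]
  have h3 : ‖harm (liftN hw q f)‖ ^ 2 ≤ q.bilin (liftTrace hw q f) (liftTrace hw q f) :=
    norm_harm_sq_le_of_mem hw hq ((fn_mem_liftDom hw (f := liftN hw q f)).1 f.2)
  linarith

lemma toReal_liftForm_val {f : NSpace m G} (hf : traceOp hw f ∈ q.dom) :
    ((liftForm hw hq).val (fn f)).toReal =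
      energy G (fn f) + (q.val (traceOp hw f)).toReal - (dnForm m G w (traceOp hw f)).toReal := by
  have hf' := (fn_mem_liftDom hw).2 hf
  rw [(liftForm hw hq).toReal_val ⟨fn f, hf'⟩, liftForm_bilin_self, toReal_dnForm_traceOp,
    q.toReal_val ⟨_, hf⟩]
  rfl

/-- A Cauchy sequence is Cauchy both in `D(Q^(N))` and, through its traces, in `D(q)`. Continuity of
`γ` matches the two limits, and the two norms together dominate the form norm. -/
lemma liftForm_isClosed : (liftForm hw hq).IsClosed := by
  rw [Form.isClosed_iff]
  set Q := liftForm hw hq with hQ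
  have hqc : CompleteSpace q.Space := q.isClosed_iff.1 hq.1.1
  set J : Q.Space →L[ℝ] NSpace m G :=
    toNeumann (Q := Q) (liftDom_le hw) (liftForm_bilin_ge hw hq) with hJ
  have hJn : ∀ f : Q.Space, J f = liftN hw q (Q.toDom f) := fun f => rfl
  have hnorm : ∀ f : Q.Space, ‖f‖ ^ 2 = ‖J f‖ ^ 2 +
      (q.bilin (liftTrace hw q (Q.toDom f)) (liftTrace hw q (Q.toDom f)) - ‖harm (J f)‖ ^ 2) := by
    intro f
    have h1 : ‖f‖ ^ 2 = Q.bilin (Q.toDom f) (Q.toDom f) + ‖((Q.toDom f : Q.dom) : ell2 m)‖ ^ 2 :=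
      Q.norm_sq (Q.toDom f)
    rw [h1, neumann_norm_sq, hJn]
    have h2 : Q.bilin (Q.toDom f) (Q.toDom f) = _ := liftForm_bilin_self hw hq (Q.toDom f)
    rw [h2, fn_liftN]
    ring
  have hqn : ∀ f : Q.Space, ‖q.toSpace (liftTrace hw q (Q.toDom f))‖ ^ 2 =
      q.bilin (liftTrace hw q (Q.toDom f)) (liftTrace hw q (Q.toDom f)) +
        ‖traceOp hw (J f)‖ ^ 2 := fun f => q.norm_sq _
  -- The constant comes from `q(γ f) = ‖f‖² - ‖J f‖² + ‖harm (J f)‖² ≤ ‖f‖²` and from `‖γ (J f)‖ ≤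
  -- ‖γ‖ ‖f‖`.
  let T : Q.Space →L[ℝ] q.Space := LinearMap.mkContinuous
    (q.toSpace.toLinearMap ∘ₗ liftTrace hw q ∘ₗ Q.toDom.toLinearMap)
    (√(1 + ‖traceOp hw‖ ^ 2)) (by
      intro f
      refine abs_le_of_sq_le_sq' ?_ (by positivity) |>.2
      change ‖q.toSpace (liftTrace hw q (Q.toDom f))‖ ^ 2 ≤ _
      rw [mul_pow, Real.sq_sqrt (by positivity), hqn]
      have h1 := hnorm f
      have h2 : ‖harm (J f)‖ ^ 2 ≤ ‖J f‖ ^ 2 := pow_le_pow_left₀ (norm_nonneg _) (norm_harm_le _) 2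
      have h3 : ‖traceOp hw (J f)‖ ^ 2 ≤ ‖traceOp hw‖ ^ 2 * ‖J f‖ ^ 2 := by
        rw [← mul_pow]
        exact pow_le_pow_left₀ (norm_nonneg _) ((traceOp hw).le_opNorm _) 2
      have h5 : ‖harm (J f)‖ ^ 2 ≤
          q.bilin (liftTrace hw q (Q.toDom f)) (liftTrace hw q (Q.toDom f)) :=
        norm_harm_sq_le_of_mem hw hq ((fn_mem_liftDom hw (f := J f)).1 (Q.toDom f).2)
      have h4 : ‖traceOp hw‖ ^ 2 * ‖J f‖ ^ 2 ≤ ‖traceOp hw‖ ^ 2 * ‖f‖ ^ 2 :=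
        mul_le_mul_of_nonneg_left (by linarith) (sq_nonneg _)
      linarith)
  have hT : ∀ f, q.incl (T f) = traceOp hw (J f) := fun f => rfl
  refine Metric.complete_of_cauchySeq_tendsto fun u hu => ?_
  obtain ⟨f, hf⟩ := cauchySeq_tendsto_of_complete (J.uniformContinuous.comp_cauchySeq hu)
  obtain ⟨ψ, hψ⟩ := cauchySeq_tendsto_of_complete (T.uniformContinuous.comp_cauchySeq hu)
  have htr : traceOp hw f = q.incl ψ := by
    have h1 : Tendsto (fun n => traceOp hw (J (u n))) atTop (𝓝 (traceOp hw f)) :=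
      ((traceOp hw).continuous.tendsto f).comp hf
    have h2 : Tendsto (fun n => q.incl (T (u n))) atTop (𝓝 (q.incl ψ)) :=
      (q.incl.continuous.tendsto ψ).comp hψ
    exact tendsto_nhds_unique h1 h2
  have hfm : traceOp hw f ∈ q.dom := by rw [htr]; exact q.incl_mem ψ
  set g : Q.Space := Q.toSpace ⟨fn f, (fn_mem_liftDom hw).2 hfm⟩ with hg
  have hJg : J g = f := liftN_fn hw _
  have hTg : T g = ψ := q.incl_injective (by rw [hT, hJg, htr])
  refine ⟨g, ?_⟩
  have hle : ∀ n, ‖u n - g‖ ^ 2 ≤ ‖J (u n) - f‖ ^ 2 + ‖T (u n) - ψ‖ ^ 2 := by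
    intro n
    have h1 := hnorm (u n - g)
    have h2 := hqn (u n - g)
    have h3 : ‖T (u n - g)‖ ^ 2 = _ := h2
    rw [map_sub, hTg] at h3
    rw [map_sub J, hJg] at h1
    rw [h1, h3]
    linarith [sq_nonneg ‖traceOp hw (J (u n - g))‖, sq_nonneg ‖harm (J (u n) - f)‖]
  rw [tendsto_iff_norm_sub_tendsto_zero]
  have h2 : Tendsto (fun n => ‖u n - g‖ ^ 2) atTop (𝓝 0) := by
    have h3 := ((tendsto_iff_norm_sub_tendsto_zero.1 hf).pow 2).add
      ((tendsto_iff_norm_sub_tendsto_zero.1 hψ).pow 2)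
    simp only [ne_eq, OfNat.ofNat_ne_zero, not_false_eq_true, zero_pow, add_zero] at h3
    exact squeeze_zero (fun _ => sq_nonneg _) hle h3
  have h3 := h2.sqrt
  simpa [Real.sqrt_sq] using h3

/-- The energy and the correction `(q - q^{DN})(γ f)` decrease separately under contractions, the
latter because `γ` commutes with them. -/
lemma liftForm_isMarkovian : (liftForm hw hq).IsMarkovian := by
  intro C hC h0 f
  by_cases hf : f ∈ (liftForm hw hq).dom
  · obtain ⟨f, rfl⟩ := exists_fn_eq (liftDom_le hw hf)
    have hf' : traceOp hw f ∈ q.dom := (fn_mem_liftDom hw).1 hf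
    obtain ⟨h1, h2⟩ := hq.2.2 C hC h0 _ hf'
    rw [← traceOp_ncomp] at h1 h2
    rw [← fn_ncomp, ← ENNReal.toReal_le_toReal
      ((liftForm hw hq).mem_dom_iff.1 ((fn_mem_liftDom hw).2 h1))
      ((liftForm hw hq).mem_dom_iff.1 hf), toReal_liftForm_val hw hq h1,
      toReal_liftForm_val hw hq hf']
    have := energy_ncomp_le hC h0 f
    linarith
  · rw [(liftForm hw hq).val_of_notMem hf]
    exact le_top

lemma dirSub_le_liftDom {f : NSpace m G} (hf : f ∈ dirSub m G) : fn f ∈ liftDom hw q := by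
  rw [fn_mem_liftDom, (traceOp_eq_zero_iff hw).2 hf]
  exact q.dom.zero_mem

lemma finSupp_le_liftDom : finSupp m ≤ liftDom hw q := by
  intro f hf
  obtain ⟨f, rfl⟩ := exists_fn_eq (finSupp_le_neumannDom (G := G) hf)
  exact dirSub_le_liftDom hw (mem_dirSub_of_finSupp hf)

lemma liftForm_extends : (liftForm hw hq).Extends (dirichletForm m G) := by
  refine Form.extends_of_val fun f hf => ?_
  have hfN : f ∈ (neumannForm m G).dom := hf.1
  obtain ⟨f, rfl⟩ := exists_fn_eq hfN
  have hf' := mem_dirSub_iff.2 hf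
  have h1 := dirSub_le_liftDom hw hf' (q := q)
  rw [← ENNReal.toReal_eq_toReal_iff' ((liftForm hw hq).mem_dom_iff.1 h1)
    ((dirichletForm m G).mem_dom_iff.1 hf), toReal_liftForm_val hw hq ((fn_mem_liftDom hw).1 h1),
    (traceOp_eq_zero_iff hw).2 hf', q.val_zero, dnForm_zero hw, ENNReal.toReal_zero,
    add_zero, sub_zero, (dirichletForm m G).toReal_val ⟨_, hf⟩]
  rfl

lemma liftForm_mem_discreteForms : liftForm hw hq ∈ discreteForms m :=
  ⟨⟨(dense_finSupp m).mono (finSupp_le_liftDom hw), liftForm_isClosed hw hq,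
    liftForm_isMarkovian hw hq⟩, finSupp_le_liftDom hw⟩

/-- Every element of `D(q)` is a trace because `q ≥ q^{DN}`. At `γ f` both `Tr Q - q^{DN}` and `q -
q^{DN}` equal `Q(f) - Q^(N)(f)`. -/
lemma traceForm_liftForm : traceForm G w (liftForm hw hq) = q.val := by
  rw [← trForm_val hw (liftForm_extends hw hq) (liftDom_le hw)]
  set h := liftForm_extends hw hq
  funext φ
  by_cases hφ : φ ∈ q.dom
  · obtain ⟨f, rfl⟩ := exists_traceOp_eq_of_dnForm_ne_top hw
      ((hq.2.1 φ).trans_lt (lt_top_iff_ne_top.2 (q.mem_dom_iff.1 hφ))).ne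
    have hf : fn f ∈ (liftForm hw hq).dom := (fn_mem_liftDom hw).2 hφ
    rw [← ENNReal.toReal_eq_toReal_iff'
      ((trForm hw h).mem_dom_iff.1 (traceOp_mem_trForm hw h hf)) (q.mem_dom_iff.1 hφ)]
    have h1 := toReal_trForm_sub_dnForm hw h (liftForm_isClosed hw hq)
      (liftForm_isMarkovian hw hq) (finSupp_le_liftDom hw) hf
    rw [toReal_liftForm_val hw hq hφ] at h1
    linarith
  · rw [q.val_of_notMem hφ, (trForm hw h).val_of_notMem]
    rintro ⟨f, hf, rfl⟩
    exact hφ ((fn_mem_liftDom hw).1 hf)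

end Construction

end Representation

/-! ### The correspondence -/

section Correspondence

variable {X : Type*} [MeasurableSpace X] [DiscreteMeasurableSpace X]
  {m : X → Ioi (0 : ℝ)} {w : WGraph X → X → ℝ≥0}

/-- A graph together with a form on its boundary belongs to `Q`. -/
def IsTraceData (w : WGraph X → X → ℝ≥0) (Q : Form (ell2 m))
    (σ : Σ G : WGraph X, {q : Form (BoundaryL2 m G (w G)) // q ∈ traceForms m G (w G)}) : Prop :=
  Q.Extends (dirichletForm m σ.1) ∧ σ.2.1.val = traceForm σ.1 (w σ.1) Q

lemma IsTraceData.unique {Q : Form (ell2 m)} (hQ : Q ∈ discreteForms m)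
    {σ τ : Σ G : WGraph X, {q : Form (BoundaryL2 m G (w G)) // q ∈ traceForms m G (w G)}}
    (hσ : IsTraceData w Q σ) (hτ : IsTraceData w Q τ) : σ = τ := by
  obtain ⟨G, q, hq⟩ := σ
  obtain ⟨G', q', hq'⟩ := τ
  obtain rfl : G = G' := graph_unique hQ.2 hσ.1 hτ.1
  obtain rfl : q = q' := Form.ext_of_val (hσ.2.trans hτ.2.symm)
  rfl

end Correspondence

end GraphForm

end

theorem mainTheorem2 {X : Type*} [Countable X] [MeasurableSpace X] [DiscreteMeasurableSpace X]
    (m : X → Ioi (0 : ℝ)) (w : WGraph X → X → ℝ≥0) (hw : ∀ G, IsAdmissible m G (w G)) :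
    (∀ Q ∈ discreteForms m,
      ((∃ G : WGraph X, Q.Extends (dirichletForm m G)) ↔
        ∃ G : WGraph X, ∃ q ∈ traceForms m G (w G), Represents G (w G) q Q) ∧
      (∀ G : WGraph X, Q.Extends (dirichletForm m G) ↔
        ∃ q ∈ traceForms m G (w G), Represents G (w G) q Q) ∧
      (∀ G G' : WGraph X, Q.Extends (dirichletForm m G) → Q.Extends (dirichletForm m G') →
        G = G') ∧
      ∀ G : WGraph X, Q.Extends (dirichletForm m G) →
        ∃ q ∈ traceForms m G (w G), q.val = traceForm G (w G) Q ∧ Represents G (w G) q Q) ∧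
    ∃ Φ : {Q : Form (ell2 m) // Q ∈ discreteForms m ∧ ∃ G, Q.Extends (dirichletForm m G)} →
        Σ G : WGraph X, {q : Form (BoundaryL2 m G (w G)) // q ∈ traceForms m G (w G)},
      Function.Bijective Φ ∧
      ∀ Q, Q.1.Extends (dirichletForm m (Φ Q).1) ∧
        (Φ Q).2.1.val = traceForm (Φ Q).1 (w (Φ Q).1) Q.1 := by
  refine ⟨fun Q hQ => ?_, ?_⟩
  · have hiff : ∀ G : WGraph X, Q.Extends (dirichletForm m G) ↔
        ∃ q ∈ traceForms m G (w G), Represents G (w G) q Q := fun G =>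
      ⟨fun h => (exists_traceForm_of_extends (hw G) h hQ).imp fun _ hq => ⟨hq.1, hq.2.2⟩,
        fun ⟨_, _, hr⟩ => extends_of_represents (hw G) hQ hr⟩
    exact ⟨exists_congr hiff, hiff, fun _ _ h h' => graph_unique hQ.2 h h',
      fun G h => exists_traceForm_of_extends (hw G) h hQ⟩
  · have hex : ∀ Q : {Q : Form (ell2 m) // Q ∈ discreteForms m ∧
        ∃ G, Q.Extends (dirichletForm m G)}, ∃ σ, IsTraceData w Q.1 σ := by
      rintro ⟨Q, hQ, G, h⟩
      obtain ⟨q, hq, hv, -⟩ := exists_traceForm_of_extends (hw G) h hQ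
      exact ⟨⟨G, q, hq⟩, h, hv⟩
    choose Φ hΦ using hex
    refine ⟨Φ, ⟨fun Q Q' he => ?_, fun σ => ?_⟩, hΦ⟩
    · have h := hΦ Q
      have h' := hΦ Q'
      rw [← he] at h'
      exact Subtype.ext (eq_of_traceForm_eq (hw _) Q.2.1 Q'.2.1 h.1 h'.1 (h.2.symm.trans h'.2))
    -- The constructed form has trace data `(G, q)`, and the data of a form are unique, so the
    -- chosen map sends it there.
    · obtain ⟨G, q, hq⟩ := σ
      have hmem := liftForm_mem_discreteForms (hw G) hq
      have hext := liftForm_extends (hw G) hq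
      exact ⟨⟨liftForm (hw G) hq, hmem, G, hext⟩,
        (hΦ _).unique hmem ⟨hext, (traceForm_liftForm (hw G) hq).symm⟩⟩
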